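/- A \emph{skew partition} $\beta/\gamma$ consists of partitions $\gamma\subseteq\beta$ with the same fixed number $\ell$ of parts, $\beta=(\beta_1\ge\dots\ge\beta_\ell\ge 0)$, $\gamma=(\gamma_1\ge\dots\ge\gamma_\ell\ge 0)$, $\gamma_i\le\beta_i$; zero parts are allowed. Its cells are the pairs $(i,j)$ with $\gamma_i<j\le\beta_i$ (row $i$, column $j$), and the content of $(i,j)$ is $j-i$. A semistandard tableau of shape $\beta/\gamma$ with entries in $\{1,\dots,n\}$ is a filling of the cells with $T(i,j)\le T(i,j')$ for $j<j'$ and $T(i,j)<T(i',j)$ for $i<i'$. Let $\boldsymbol\beta/\boldsymbol\gamma=(\beta^{(1)}/\gamma^{(1)},\dots,\beta^{(k)}/\gamma^{(k)})$ be a tuple of skew partitions and let $T=(T^{(1)},\dots,T^{(k)})$ be a tuple of semistandard tableaux of these shapes. A \emph{triple} consists of a cell $v$ of the $p$-th shape and of $u=(r,j)$, $w=(r,j+1)$ in a row $r$ of the $q$-th shape, where $p<q$, $\gamma^{(q)}_r\le j\le\beta^{(q)}_r$, and $v$, $w$ have the same content. Let $b$ be the entry of $v$, $a$ the entry of $u$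 ($a=0$ if $u$ is not a cell of the $q$-th shape) and $c$ the entry of $w$ ($c=\infty$ if $w$ is not a cell of the $q$-th shape). It is a coinversion triple if $a\le b\le c$, and $\mathrm{coinv}(T)$ is the number of coinversion triples. The coinversion LLT polynomial is $$\mathcal L_{\boldsymbol\beta/\boldsymbol\gamma}(X_n;t)=\sum_{T}t^{\mathrm{coinv}(T)}x^T ,\qquad X_n=\{x_1,\dots,x_n\},$$ the sum being over all tuples $T$ of semistandard tableaux of shape $\boldsymbol\beta/\boldsymbol\gamma$ with entries in $\{1,\dots,n\}$. Now let $k=2$ and $(\boldsymbol\beta/\boldsymbol\gamma)_{swap}=(\beta^{(2)}/\gamma^{(2)},\beta^{(1)}/\gamma^{(1)})$. On the top boundary put a blue path in every column $\beta^{(1)}_m-m+1$ and a red path in every column $\beta^{(2)}_m-m+1$; on the bottom boundary put a blue path in every column $\gamma^{(1)}_m-m+1$ and a red path in every column $\gamma^{(2)}_m-m+1$. The \emph{beads} are the paths in whose column there is no path of the other color on the same boundary; they form a top row and a bottom row, ordered by column. The label of a bead is the number of paths of both colors on the same boundary in columns strictly to its right. A \emph{matching} is a set of arcs, each joining two beads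 of different colors in the same row or two beads of the same color in different rows, such that every bead lies on exactly one arc; it is \emph{non-crossing} if the arcs can be drawn in the strip between the two rows without crossing. The weight $w(a)$ of an arc $a$ is: - $t^{(j-i)/2}$ if $a$ joins a blue bead labelled $i$ in the top row and a blue bead labelled $j$ in the bottom row; - $t^{(j-i)/2}$ if $a$ joins a red bead labelled $j$ in the top row and a red bead labelled $i$ in the bottom row; - $t^{(j-i+1)/2}$ (resp. $t^{(j-i-1)/2}$) if $a$ joins, in the top row, a red bead labelled $j$ and a blue bead labelled $i$ to its right (resp. to its left); - $t^{(j-i+1)/2}$ (resp. $t^{(j-i-1)/2}$) if $a$ joins, in the bottom row, a red bead labelled $i$ and a blue bead labelled $j$ to its right (resp. to its left). \textbf{Theorem.} If there is exactly one non-crossing matching $M$ of the beads of $\boldsymbol\beta/\boldsymbol\gamma=(\beta^{(1)}/\gamma^{(1)},\beta^{(2)}/\gamma^{(2)})$, then for every $n\ge 0$ the polynomials $\mathcal L_{\boldsymbol\beta/\boldsymbol\gamma}(X_n;t)$ and $\mathcal L_{(\boldsymbol\beta/\boldsymbol\gamma)_{swap}}(X_n;t)$ are equal up to an integral power of $t$.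 Explicitly, each weight $w(a)$, $a\in M$, is an integral power of $t$, and $$\mathcal L_{\boldsymbol\beta/\boldsymbol\gamma}(X_n;t)=\Bigl(\prod_{a\in M}w(a)\Bigr)\,\mathcal L_{(\boldsymbol\beta/\boldsymbol\gamma)_{swap}}(X_n;t).$$ -/

import Mathlib

/-- A skew partition `β/γ`: two partitions `γ ⊆ β` with the same fixed number `len` of parts
(parts equal to zero are allowed).  Rows are indexed from `0`: the row `i : Fin len` is the row
with number `i + 1` in the usual indexing. -/
structure SkewPartition where
  len : ℕ
  outer : Fin len → ℕ
  inner : Fin len → ℕ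
  outer_antitone : Antitone outer
  inner_antitone : Antitone inner
  inner_le_outer : ∀ i, inner i ≤ outer i

namespace SkewPartition

/-- The cells of `β/γ`: in row `i` the columns `j` with `γ_i < j ≤ β_i`
(columns are numbered from `1`). -/
abbrev Cell (S : SkewPartition) : Type :=
  (i : Fin S.len) × Finset.Ioc (S.inner i) (S.outer i)

/-- The content of the cell in row `i` (indexed from `0`) and column `j` (indexed from `1`). -/
def content {m : ℕ} (i : Fin m) (j : ℕ) : ℤ := (j : ℤ) - ((i : ℤ) + 1)

/-- Semistandard fillings by the alphabet `1, …, n`, French convention: weakly increasing along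
rows, strictly increasing up columns.  The element `x : Fin n` stands for the letter `x + 1`. -/
def IsSemistandard (S : SkewPartition) {n : ℕ} (T : S.Cell → Fin n) : Prop :=
  (∀ c d : S.Cell, c.1 = d.1 → (c.2 : ℕ) ≤ (d.2 : ℕ) → T c ≤ T d) ∧
  (∀ c d : S.Cell, c.1 < d.1 → (c.2 : ℕ) = (d.2 : ℕ) → T c < T d)

instance (S : SkewPartition) {n : ℕ} (T : S.Cell → Fin n) : Decidable (S.IsSemistandard T) := by
  unfold IsSemistandard; infer_instance

/-- `SSYT(β/γ)` with entries in `1, …, n`. -/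
abbrev Tableau (S : SkewPartition) (n : ℕ) : Type :=
  {T : S.Cell → Fin n // S.IsSemistandard T}

/-- The letter in the cell `(r, j)`, with the value `0` if the cell is not in the shape. -/
def entryOrZero {S : SkewPartition} {n : ℕ} (T : S.Tableau n) (r : Fin S.len) (j : ℕ) : ℕ∞ :=
  if h : j ∈ Finset.Ioc (S.inner r) (S.outer r) then (((T.1 ⟨r, j, h⟩ : ℕ) + 1 : ℕ) : ℕ∞) else 0

/-- The letter in the cell `(r, j)`, with the value `∞` if the cell is not in the shape. -/
def entryOrTop {S : SkewPartition} {n : ℕ} (T : S.Tableau n) (r : Fin S.len) (j : ℕ) : ℕ∞ :=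
  if h : j ∈ Finset.Ioc (S.inner r) (S.outer r) then (((T.1 ⟨r, j, h⟩ : ℕ) + 1 : ℕ) : ℕ∞) else ⊤

end SkewPartition

section LLT

variable {k : ℕ} (S : Fin k → SkewPartition)

/-- `SSYT` of a tuple of skew partitions: one tableau for each shape. -/
abbrev TableauTuple (n : ℕ) : Type := (p : Fin k) → (S p).Tableau n

/-- The data `(u, v, w)` of a possible triple: shapes `p`, `q`, a cell `v` of the shape `p`, a row
`r` of the shape `q` and a column `j` with `γ_r ≤ j ≤ β_r`.  Then `u = (r, j)`, `w = (r, j + 1)`: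
both lie between the cells `(r, γ_r)` and `(r, β_r + 1)`, inclusive. -/
abbrev TripleData : Type :=
  (p : Fin k) × (q : Fin k) × (S p).Cell ×
    ((r : Fin (S q).len) × Finset.Icc ((S q).inner r) ((S q).outer r))

variable {S}

/-- The shape of `w` comes later than that of `v`, and `v`, `w` are on the same content line. -/
def IsTriple : TripleData S → Prop
  | ⟨p, q, v, ⟨r, j⟩⟩ =>
    p < q ∧ SkewPartition.content v.1 (v.2 : ℕ) = SkewPartition.content r ((j : ℕ) + 1)

/-- `a ≤ b ≤ c` for the entries `a`, `b`, `c` of `u`, `v`, `w`, where `a = 0` and `c = ∞`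
for cells outside the shape. -/
def IsCoinversion {n : ℕ} (T : TableauTuple S n) : TripleData S → Prop
  | ⟨p, q, v, ⟨r, j⟩⟩ =>
    SkewPartition.entryOrZero (T q) r (j : ℕ) ≤ ((((T p).1 v : ℕ) + 1 : ℕ) : ℕ∞) ∧
      ((((T p).1 v : ℕ) + 1 : ℕ) : ℕ∞) ≤ SkewPartition.entryOrTop (T q) r ((j : ℕ) + 1)

open Classical in
/-- The number of coinversion triples of `T`. -/
noncomputable def coinv {n : ℕ} (T : TableauTuple S n) : ℕ :=
  (Finset.univ.filter fun x : TripleData S => IsTriple x ∧ IsCoinversion T x).card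

variable (S)

/-- The coinversion LLT polynomial `∑_T t^{coinv T} x^T` in the variables `x_1, …, x_n`, regarded
as a polynomial over the Laurent polynomials `ℤ[t, t⁻¹]`. -/
noncomputable def coinvLLT (n : ℕ) : MvPolynomial (Fin n) (LaurentPolynomial ℤ) :=
  ∑ T : TableauTuple S n,
    MvPolynomial.C (LaurentPolynomial.T (coinv T : ℤ)) *
      ∏ p : Fin k, ∏ c : (S p).Cell, MvPolynomial.X ((T p).1 c)

end LLT

/-- Equality up to an overall power of `t`. -/
def LLTEquivalent {n : ℕ} (F G : MvPolynomial (Fin n) (LaurentPolynomial ℤ)) : Prop :=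
  ∃ e : ℤ, F = MvPolynomial.C (LaurentPolynomial.T e) * G

/-- The two rows of beads (the top and the bottom boundary). -/
inductive BeadRow : Type
  | top
  | bottom
  deriving DecidableEq

/-- The paths of the first shape are blue, those of the second shape are red. -/
inductive BeadColor : Type
  | blue
  | red
  deriving DecidableEq

/-- A path end on the boundary: its row, its color, and its column in the lattice. -/
structure Bead : Type where
  row : BeadRow
  color : BeadColor
  col : ℤ
  deriving DecidableEq

namespace Bead

/-- The columns with a path of the shape `β/γ` on the given boundary: `β_m - m + 1` on the top and
`γ_m - m + 1` on the bottom, for `m = 1, …, ℓ` (here `m = i + 1`). -/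
def pathCols (S : SkewPartition) : BeadRow → Finset ℤ
  | .top => Finset.univ.image fun i : Fin S.len => (S.outer i : ℤ) - (i : ℤ)
  | .bottom => Finset.univ.image fun i : Fin S.len => (S.inner i : ℤ) - (i : ℤ)

/-- The beads of the pair `(S₁, S₂)`: the singleton paths on the two boundaries, that is, those
in whose column there is no path of the other color on the same boundary. -/
def IsBead (S₁ S₂ : SkewPartition) (b : Bead) : Prop :=
  match b.color with
  | .blue => b.col ∈ pathCols S₁ b.row ∧ b.col ∉ pathCols S₂ b.row
  | .red => b.col ∈ pathCols S₂ b.row ∧ b.col ∉ pathCols S₁ b.row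

/-- The label of a bead: the number of paths (of both colors) to its right on its boundary. -/
def label (S₁ S₂ : SkewPartition) (b : Bead) : ℤ :=
  (((pathCols S₁ b.row).filter fun i => b.col < i).card : ℤ) +
    (((pathCols S₂ b.row).filter fun i => b.col < i).card : ℤ)

/-- An arc joins beads of different colors in the same row,
or beads of the same color in different rows. -/
def ArcAllowed (b c : Bead) : Prop :=
  (b.row = c.row ∧ b.color ≠ c.color) ∨ (b.row ≠ c.row ∧ b.color = c.color)

/-- A matching: a set of allowed arcs such that every bead is on exactly one arc. -/
structure IsMatching (S₁ S₂ : SkewPartition) (M : Finset (Sym2 Bead)) : Prop where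
  isBead : ∀ a ∈ M, ∀ b ∈ a, IsBead S₁ S₂ b
  allowed : ∀ b c : Bead, s(b, c) ∈ M → ArcAllowed b c
  covers : ∀ b : Bead, IsBead S₁ S₂ b → ∃! a : Sym2 Bead, a ∈ M ∧ b ∈ a

/-- The order in which one meets the beads along the boundary of the strip between the two rows:
first the top row from left to right, then the bottom row from right to left. -/
def Before (b c : Bead) : Prop :=
  match b.row, c.row with
  | .top, .top => b.col < c.col
  | .top, .bottom => True
  | .bottom, .top => False
  | .bottom, .bottom => c.col < b.col

/-- Two arcs drawn in the strip between the two rows have to cross exactly if their endpoints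
alternate along the boundary of the strip. -/
def IsNonCrossing (M : Finset (Sym2 Bead)) : Prop :=
  ∀ b₁ b₂ c₁ c₂ : Bead, s(b₁, c₁) ∈ M → s(b₂, c₂) ∈ M →
    ¬ (Before b₁ b₂ ∧ Before b₂ c₁ ∧ Before c₁ c₂)

/-- The table of arc weights: the value is twice the exponent of `t`.  Only one of the two orders
of the endpoints of an arc is listed; the value for the other order is `0`. -/
def arcTable (S₁ S₂ : SkewPartition) (b c : Bead) : ℤ :=
  match b.row, b.color, c.row, c.color with
  -- blue bead `b` in the top row labelled `i`, blue bead `c` in the bottom row labelled `j`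
  | .top, .blue, .bottom, .blue => label S₁ S₂ c - label S₁ S₂ b
  -- red bead `b` in the top row labelled `j`, red bead `c` in the bottom row labelled `i`
  | .top, .red, .bottom, .red => label S₁ S₂ b - label S₁ S₂ c
  -- top row: red bead `b` labelled `j`, blue bead `c` labelled `i`
  | .top, .red, .top, .blue =>
    if b.col < c.col then label S₁ S₂ b - label S₁ S₂ c + 1 else label S₁ S₂ b - label S₁ S₂ c - 1
  -- bottom row: red bead `b` labelled `i`, blue bead `c` labelled `j`
  | .bottom, .red, .bottom, .blue =>
    if b.col < c.col then label S₁ S₂ c - label S₁ S₂ b + 1 else label S₁ S₂ c - label S₁ S₂ b - 1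
  | _, _, _, _ => 0

/-- Twice the exponent of `t` in the weight of an arc. -/
def twiceArcExponent (S₁ S₂ : SkewPartition) : Sym2 Bead → ℤ :=
  Sym2.lift ⟨fun b c => arcTable S₁ S₂ b c + arcTable S₁ S₂ c b, fun _ _ => add_comm _ _⟩

/-- The weight of an arc, an integral power of `t` if `twiceArcExponent` is even. -/
noncomputable def arcWeight (S₁ S₂ : SkewPartition) (a : Sym2 Bead) : LaurentPolynomial ℤ :=
  LaurentPolynomial.T (twiceArcExponent S₁ S₂ a / 2)

end Bead

/-! A pair of tableaux is drawn as two families of lattice paths, blue for the first shape and red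
for the second. Each letter is a row of the lattice, and a cell is a horizontal step whose column is
given by its content. The power of `t` counts blue steps leaving a vertex that also carries a red
path, and these are exactly the coinversion triples. So the LLT polynomial is the partition function
`latticeZ` (`coinvLLT_pair_eq_latticeZ`).

The model has a quantum sl(2) symmetry acting on the colors. A column with one path behaves like a
spin one half, and a column with none or two like a singlet. Concretely, the operator that turns one
blue path red, weighted by the paths to its right, commutes with every row transfer matrix
(`flipMatrix_commute_rowMatrix`). This is an induction on the columns whose step is a finite check
at one vertex.

Join the two boundaries into one line, the bottom from left to right and then the top from right to
left, and let `P` be the set of beads that are blue below or red above. Arcs join `P` to its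
complement, and swapping the shapes replaces `P` by its complement. After normalization by signs and
powers of `t`, the partition function as a function of `P` is killed by a lowering operator
(`IsWindow.loweringRelation`).

Uniqueness of the non-crossing matching forbids four beads with alternating classes
(`not_hasAlternation_of_unique`), so one of the two classes is an interval. Rotating the line makes
the classes two halves. There the lowering relations sum to a two-term recursion with `q`-integer
coefficients, and the values at `P` and at its complement are proportional
(`LoweringRelation.halves`, `LoweringRelation.middle`).

The constant depends on the beads through their ranks along the line and through the number `d` of
arcs that start in `P` and point forward. As one class is an interval, `d` is the same for every
bijection from `P` to its complement. Labels are linear in ranks and flip exponents, so the product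
of the arc weights is the same power of `t`. The signs cancel because the ranks of all `2 * a` beads
sum to a number of the parity of `a`. -/

/-! ### Functionals killed by a lowering operator, on colorings whose classes do not alternate -/

section CyclicIntervals

variable {α R : Type*} [DecidableEq α] [CommRing R]

/-- Exchange the choice of a subset and of one of its elements. -/
theorem sum_powersetCard_succ_sum_mem (X : Finset α) (k : ℕ) (F : Finset α → α → R) :
    ∑ C ∈ X.powersetCard (k + 1), ∑ i ∈ C, F C i =
      ∑ C ∈ X.powersetCard k, ∑ i ∈ X \ C, F (insert i C) i := by
  rw [Finset.sum_sigma', Finset.sum_sigma']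
  refine Finset.sum_bij' (fun p _ => ⟨p.1.erase p.2, p.2⟩) (fun p _ => ⟨insert p.2 p.1, p.2⟩)
    ?_ ?_ ?_ ?_ ?_
  · rintro ⟨C, i⟩ h
    simp only [Finset.mem_sigma, Finset.mem_powersetCard, Finset.mem_sdiff] at h ⊢
    obtain ⟨⟨hC, hc⟩, hi⟩ := h
    refine ⟨⟨(Finset.erase_subset _ _).trans hC, ?_⟩, hC hi, Finset.notMem_erase _ _⟩
    rw [Finset.card_erase_of_mem hi, hc]; rfl
  · rintro ⟨C, i⟩ h
    simp only [Finset.mem_sigma, Finset.mem_powersetCard, Finset.mem_sdiff] at h ⊢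
    obtain ⟨⟨hC, hc⟩, hi, hn⟩ := h
    refine ⟨⟨Finset.insert_subset hi hC, ?_⟩, Finset.mem_insert_self _ _⟩
    rw [Finset.card_insert_of_notMem hn, hc]
  · rintro ⟨C, i⟩ h
    simp only [Finset.mem_sigma] at h
    simp [Finset.insert_erase h.2]
  · rintro ⟨C, i⟩ h
    simp only [Finset.mem_sigma, Finset.mem_sdiff] at h
    simp [Finset.erase_insert h.2.2]
  · rintro ⟨C, i⟩ h
    simp only [Finset.mem_sigma] at h
    simp [Finset.insert_erase h.2]

/-- The `q`-integer as a sum over the elements of a linearly ordered set. -/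
theorem sum_card_filter_lt (q : ℤ → R) (hq : ∀ a b, q (a + b) = q a * q b) (pos : α → ℤ)
    (A : Finset α) (hpos : Set.InjOn pos A) :
    ∑ i ∈ A, q ((A.erase i).filter fun j => pos i < pos j).card =
      ∑ m ∈ Finset.range A.card, q m := by
  induction A using Finset.induction_on_max_value pos with
  | empty => simp
  | insert a s ha hmax ih =>
    have hlt : ∀ x ∈ s, pos x < pos a := fun x hx => lt_of_le_of_ne (hmax x hx) fun h =>
      ha (by
        have := hpos (Finset.mem_coe.2 (Finset.mem_insert_of_mem hx))
          (Finset.mem_coe.2 (Finset.mem_insert_self a s)) h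
        rwa [← this])
    rw [Finset.sum_insert ha, Finset.card_insert_of_notMem ha, Finset.sum_range_succ']
    have h1 : ((insert a s).erase a).filter (fun j => pos a < pos j) = ∅ := by
      rw [Finset.erase_insert ha]
      exact Finset.filter_eq_empty_iff.2 fun x hx => not_lt.2 (hmax x hx)
    -- The new maximum lies to the right of every old element, so each old power gains one factor `q
    -- 1`.
    have h2 : ∀ i ∈ s, q (((insert a s).erase i).filter fun j => pos i < pos j).card =
        q 1 * q ((s.erase i).filter fun j => pos i < pos j).card := by
      intro i hi
      have hne : a ≠ i := fun h => ha (h ▸ hi)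
      rw [Finset.erase_insert_of_ne hne, Finset.filter_insert, if_pos (hlt i hi),
        Finset.card_insert_of_notMem (by simp [ha]), ← hq]
      congr 1; push_cast; ring
    rw [h1, Finset.sum_congr rfl h2, ← Finset.mul_sum,
      ih (hpos.mono (by simp)), Finset.mul_sum, add_comm]
    congr 1
    refine Finset.sum_congr rfl fun m _ => ?_
    rw [← hq]; congr 1; push_cast; ring

/-- The linear relations satisfied by a functional on subsets of size `a` that is annihilated by
a lowering operator. -/
def LoweringRelation (q : ℤ → R) (pos : α → ℤ) (s : Finset α) (a : ℕ) (H : Finset α → R) : Prop :=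
  ∀ Q ⊆ s, Q.card = a + 1 →
    ∑ i ∈ Q, q ((s \ Q).filter fun j => pos i < pos j).card * H (Q.erase i) = 0

/-- Sum the relation over all `Q` with `k + 1` elements in `X` and `a - k` in `Y`. Deleting an
element of `X` gives the sum on the right, deleting one of `Y` the sum on the left. The ways of
putting the deleted element back add up to a `q`-integer. The factor `q k` comes from the `k`
elements of `Y` outside `Q`, all of which lie to the right of `X`. -/
theorem LoweringRelation.two_term {q : ℤ → R} (hq : ∀ a b, q (a + b) = q a * q b) {pos : α → ℤ}
    {X Y : Finset α} {a : ℕ} (hX : X.card = a) (hY : Y.card = a)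
    (hXY : ∀ x ∈ X, ∀ y ∈ Y, pos x < pos y) (hpos : Set.InjOn pos (X ∪ Y : Finset α))
    {H : Finset α → R} (hH : LoweringRelation q pos (X ∪ Y) a H) {k : ℕ} (hk : k < a) :
    (∑ m ∈ Finset.range (k + 1), q m) *
        ∑ C ∈ X.powersetCard (k + 1), ∑ D ∈ Y.powersetCard (a - (k + 1)), H (C ∪ D) =
      -(q k * ∑ m ∈ Finset.range (a - k), q m) *
        ∑ C ∈ X.powersetCard k, ∑ D ∈ Y.powersetCard (a - k), H (C ∪ D) := by
  have hdisj : Disjoint X Y := Finset.disjoint_left.2 fun x hx hy => lt_irrefl _ (hXY x hx x hy)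
  have hnot : ∀ x ∈ X, x ∉ Y := fun x hx => Finset.disjoint_left.1 hdisj hx
  have hnot' : ∀ x ∈ Y, x ∉ X := fun x hx => Finset.disjoint_right.1 hdisj hx
  have key : ∀ C ∈ X.powersetCard (k + 1), ∀ D ∈ Y.powersetCard (a - k),
      ∑ i ∈ C, q ((X \ C).filter fun j => pos i < pos j).card * q k * H (C.erase i ∪ D) +
      ∑ i ∈ D, q ((Y \ D).filter fun j => pos i < pos j).card * H (C ∪ D.erase i) = 0 := by
    intro C hC D hD
    rw [Finset.mem_powersetCard] at hC hD
    have hCD : Disjoint C D := hdisj.mono hC.1 hD.1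
    have h := hH (C ∪ D) (Finset.union_subset_union hC.1 hD.1)
      (by rw [Finset.card_union_of_disjoint hCD, hC.2, hD.2]; omega)
    rw [Finset.sum_union hCD] at h
    rw [← h]
    have hsd : (X ∪ Y) \ (C ∪ D) = (X \ C) ∪ (Y \ D) := by
      ext x
      simp only [Finset.mem_sdiff, Finset.mem_union]
      have h1 := hnot x
      have h2 := @hC.1 x
      have h3 := @hD.1 x
      tauto
    congr 1
    · refine Finset.sum_congr rfl fun i hi => ?_
      have hiX := hC.1 hi
      rw [← hq, hsd, Finset.filter_union, Finset.card_union_of_disjoint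
        (Finset.disjoint_filter_filter (hdisj.mono Finset.sdiff_subset Finset.sdiff_subset)),
        Finset.filter_true_of_mem (s := Y \ D)
          (fun j hj => hXY i hiX j (Finset.mem_sdiff.1 hj).1),
        Finset.card_sdiff_of_subset hD.1, hD.2, hY]
      have hiD : i ∉ D := Finset.disjoint_left.1 hCD hi
      congr 2
      · push_cast
        congr 1
        omega
      · ext x
        simp only [Finset.mem_union, Finset.mem_erase]
        grind
    · refine Finset.sum_congr rfl fun i hi => ?_
      have hiY := hD.1 hi
      rw [hsd, Finset.filter_union, Finset.filter_false_of_mem (s := X \ C)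
          (fun j hj => not_lt.2 (hXY j (Finset.mem_sdiff.1 hj).1 i hiY).le), Finset.empty_union]
      congr 2
      ext x
      simp only [Finset.mem_union, Finset.mem_erase]
      have : i ∉ C := Finset.disjoint_right.1 hCD hi
      grind
  have hsum : ∑ C ∈ X.powersetCard (k + 1), ∑ D ∈ Y.powersetCard (a - k),
      (∑ i ∈ C, q ((X \ C).filter fun j => pos i < pos j).card * q k * H (C.erase i ∪ D) +
      ∑ i ∈ D, q ((Y \ D).filter fun j => pos i < pos j).card * H (C ∪ D.erase i)) = 0 :=
    Finset.sum_eq_zero fun C hC => Finset.sum_eq_zero fun D hD => key C hC D hD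
  simp_rw [Finset.sum_add_distrib] at hsum
  -- Choosing a set and an element to delete is choosing the smaller set and an element outside it.
  -- The powers of `q` over the outside elements sum to a `q`-integer by `sum_card_filter_lt`.
  have gen : ∀ (Z : Finset α), Set.InjOn pos Z → ∀ (l : ℕ) (G : Finset α → R),
      ∑ C ∈ Z.powersetCard (l + 1), ∑ i ∈ C,
        q ((Z \ C).filter fun j => pos i < pos j).card * G (C.erase i) =
      (∑ m ∈ Finset.range (Z.card - l), q m) * ∑ C ∈ Z.powersetCard l, G C := by
    intro Z hZ l G
    rw [sum_powersetCard_succ_sum_mem Z l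
      (fun C i => q ((Z \ C).filter fun j => pos i < pos j).card * G (C.erase i)), Finset.mul_sum]
    refine Finset.sum_congr rfl fun C hC => ?_
    rw [Finset.mem_powersetCard] at hC
    have h1 := sum_card_filter_lt q hq pos (Z \ C)
      (hZ.mono (by simp))
    rw [Finset.card_sdiff_of_subset hC.1, hC.2] at h1
    rw [← h1, Finset.sum_mul]
    refine Finset.sum_congr rfl fun i hi => ?_
    rw [Finset.erase_insert (Finset.mem_sdiff.1 hi).2, Finset.sdiff_insert]
  have e1 : ∑ C ∈ X.powersetCard (k + 1), ∑ D ∈ Y.powersetCard (a - k),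
      ∑ i ∈ C, q ((X \ C).filter fun j => pos i < pos j).card * q k * H (C.erase i ∪ D) =
      q k * (∑ m ∈ Finset.range (a - k), q m) *
        ∑ C ∈ X.powersetCard k, ∑ D ∈ Y.powersetCard (a - k), H (C ∪ D) := by
    have := gen X (hpos.mono (by simp)) k
      (fun C => q k * ∑ D ∈ Y.powersetCard (a - k), H (C ∪ D))
    rw [hX] at this
    rw [mul_comm (q k), mul_assoc, Finset.mul_sum (a := q k), ← this]
    refine Finset.sum_congr rfl fun C _ => ?_
    rw [Finset.sum_comm]
    refine Finset.sum_congr rfl fun i _ => ?_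
    rw [Finset.mul_sum, Finset.mul_sum]
    exact Finset.sum_congr rfl fun D _ => by ring
  have e2 : ∑ C ∈ X.powersetCard (k + 1), ∑ D ∈ Y.powersetCard (a - k),
      ∑ i ∈ D, q ((Y \ D).filter fun j => pos i < pos j).card * H (C ∪ D.erase i) =
      (∑ m ∈ Finset.range (k + 1), q m) *
        ∑ C ∈ X.powersetCard (k + 1), ∑ D ∈ Y.powersetCard (a - (k + 1)), H (C ∪ D) := by
    rw [Finset.mul_sum]
    refine Finset.sum_congr rfl fun C _ => ?_
    have := gen Y (hpos.mono (by simp)) (a - (k + 1)) (fun D => H (C ∪ D))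
    rw [hY, show a - (k + 1) + 1 = a - k by omega, show a - (a - (k + 1)) = k + 1 by omega] at this
    exact this
  rw [e1, e2] at hsum
  linear_combination hsum

/-- The values of a functional annihilated by the lowering operator on two complementary halves. -/
theorem LoweringRelation.halves [IsDomain R] {q : ℤ → R} (hq : ∀ a b, q (a + b) = q a * q b)
    (hq0 : q 0 = 1) (hne : ∀ k : ℕ, ∑ m ∈ Finset.range (k + 1), q m ≠ 0) {pos : α → ℤ}
    {X Y : Finset α} {a : ℕ} (hX : X.card = a) (hY : Y.card = a)
    (hXY : ∀ x ∈ X, ∀ y ∈ Y, pos x < pos y) (hpos : Set.InjOn pos (X ∪ Y : Finset α))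
    {H : Finset α → R} (hH : LoweringRelation q pos (X ∪ Y) a H) :
    H X = (-1) ^ a * q ((a.choose 2 : ℕ) : ℤ) * H Y := by
  set g : ℕ → R := fun k => ∑ C ∈ X.powersetCard k, ∑ D ∈ Y.powersetCard (a - k), H (C ∪ D)
    with hg
  -- The recursion telescopes; the factors `q 0, …, q (m - 1)` multiply to the power with exponent
  -- `m.choose 2`.
  have hprod : ∀ m ≤ a, (∏ k ∈ Finset.range m, ∑ j ∈ Finset.range (k + 1), q j) * g m =
      ((-1) ^ m * q ((m.choose 2 : ℕ) : ℤ) *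
        ∏ k ∈ Finset.range m, ∑ j ∈ Finset.range (a - k), q j) * g 0 := by
    intro m
    induction m with
    | zero => intro _; simp [hq0]
    | succ m ih =>
      intro hm
      have h1 := LoweringRelation.two_term hq hX hY hXY hpos hH (k := m) (by omega)
      have h2 := ih (by omega)
      have hc : q (((m + 1).choose 2 : ℕ) : ℤ) = q m * q ((m.choose 2 : ℕ) : ℤ) := by
        rw [← hq, Nat.choose_succ_succ' m 1]; simp
      rw [Finset.prod_range_succ, Finset.prod_range_succ, hc, pow_succ]
      change _ * g (m + 1) = _ * g m at h1
      linear_combination (∏ k ∈ Finset.range m, ∑ j ∈ Finset.range (k + 1), q j) * h1 -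
        (q m * ∑ j ∈ Finset.range (a - m), q j) * h2
  have h := hprod a le_rfl
  -- At `m = a` both products are the `q`-factorial of `a`, which is nonzero and cancels.
  have hrefl : ∏ k ∈ Finset.range a, ∑ j ∈ Finset.range (a - k), q j =
      ∏ k ∈ Finset.range a, ∑ j ∈ Finset.range (k + 1), q j := by
    rw [← Finset.prod_range_reflect]
    refine Finset.prod_congr rfl fun k hk => ?_
    rw [Finset.mem_range] at hk
    congr 2; omega
  have hga : g a = H X := by
    simp only [hg, Nat.sub_self, Finset.powersetCard_zero, Finset.sum_singleton, Finset.union_empty]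
    rw [← hX, Finset.powersetCard_self, Finset.sum_singleton]
  have hg0 : g 0 = H Y := by
    simp only [hg, Nat.sub_zero, Finset.powersetCard_zero, Finset.sum_singleton]
    rw [← hY, Finset.powersetCard_self, Finset.sum_singleton, Finset.empty_union]
  rw [hrefl, hga, hg0] at h
  have hnz : (∏ k ∈ Finset.range a, ∑ j ∈ Finset.range (k + 1), q j) ≠ 0 :=
    Finset.prod_ne_zero_iff.2 fun k _ => hne k
  refine mul_left_cancel₀ hnz ?_
  linear_combination h

/-- The same for a block in the middle and its complement: rotating the leftmost block to the right
end turns this into the case of two halves. -/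
theorem LoweringRelation.middle [IsDomain R] {q : ℤ → R} (hq : ∀ a b, q (a + b) = q a * q b)
    (hq0 : q 0 = 1) (hne : ∀ k : ℕ, ∑ m ∈ Finset.range (k + 1), q m ≠ 0) {pos : α → ℤ}
    {X Y Z : Finset α} {a : ℕ} (hY : Y.card = a) (hXZc : X.card + Z.card = a)
    (hXY : ∀ x ∈ X, ∀ y ∈ Y, pos x < pos y) (hYZ : ∀ y ∈ Y, ∀ z ∈ Z, pos y < pos z)
    (hXZ : ∀ x ∈ X, ∀ z ∈ Z, pos x < pos z)
    (hpos : Set.InjOn pos (X ∪ (Y ∪ Z) : Finset α))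
    {H : Finset α → R} (hH : LoweringRelation q pos (X ∪ (Y ∪ Z)) a H) :
    H Y = (-1) ^ a * q ((a.choose 2 : ℕ) - (a - 1) * X.card) * H (X ∪ Z) := by
  have dXY : Disjoint X Y := Finset.disjoint_left.2 fun x hx hy => lt_irrefl _ (hXY x hx x hy)
  have dYZ : Disjoint Y Z := Finset.disjoint_left.2 fun x hx hy => lt_irrefl _ (hYZ x hx x hy)
  have dXZ : Disjoint X Z := Finset.disjoint_left.2 fun x hx hy => lt_irrefl _ (hXZ x hx x hy)
  have dXW : Disjoint X (Y ∪ Z) := Finset.disjoint_union_right.2 ⟨dXY, dXZ⟩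
  set s := X ∪ (Y ∪ Z) with hs
  -- A shift exceeding the spread of `s`, so that adding it to the positions of `X` carries `X` past
  -- everything else.
  obtain ⟨K, hK⟩ : ∃ K : ℤ, ∀ i ∈ s, ∀ j ∈ s, pos i < pos j + K := by
    obtain ⟨B, hB⟩ := (s.image pos).bddAbove
    obtain ⟨B', hB'⟩ := (s.image pos).bddBelow
    refine ⟨B - B' + 1, fun i hi j hj => ?_⟩
    have h1 := hB (Finset.mem_coe.2 (Finset.mem_image_of_mem pos hi))
    have h2 := hB' (Finset.mem_coe.2 (Finset.mem_image_of_mem pos hj))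
    omega
  set pos' : α → ℤ := fun i => if i ∈ X then pos i + K else pos i with hpos'
  have pX : ∀ i ∈ X, pos' i = pos i + K := fun i hi => if_pos hi
  have pN : ∀ i, i ∉ X → pos' i = pos i := fun i hi => if_neg hi
  -- The rotation changes the exponent at `i` by `|X \ Q|` if `i ∉ X`, and by `|X \ Q| - (a - 1)` if
  -- `i ∈ X`. The discrepancy depends only on whether the deleted element is in `X`, and twisting by
  -- `|P ∩ X|` absorbs it.
  set H' : Finset α → R := fun P => q (-((a - 1) * (P ∩ X).card)) * H P with hH'
  have hs' : s = Y ∪ (X ∪ Z) := by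
    ext x; simp only [hs, Finset.mem_union]; tauto
  have hXs : X ⊆ s := Finset.subset_union_left
  have hrel : LoweringRelation q pos' s a H' := by
    intro Q hQ hQc
    have hcard : ((X \ Q).card : ℤ) + (((Y ∪ Z) \ Q).card : ℤ) = a - 1 := by
      have h1 : (X \ Q).card + ((Y ∪ Z) \ Q).card = (s \ Q).card := by
        rw [← Finset.card_union_of_disjoint
          (dXW.mono Finset.sdiff_subset Finset.sdiff_subset), ← Finset.union_sdiff_distrib]
      have h2 : s.card = 2 * a := by
        rw [hs, Finset.card_union_of_disjoint dXW, Finset.card_union_of_disjoint dYZ]; omega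
      have h3 := Finset.card_sdiff_add_card_eq_card hQ
      omega
    have hsd : s \ Q = (X \ Q) ∪ ((Y ∪ Z) \ Q) := Finset.union_sdiff_distrib _ _ _
    have hdj : Disjoint (X \ Q) ((Y ∪ Z) \ Q) := dXW.mono Finset.sdiff_subset Finset.sdiff_subset
    have hterm : ∀ i ∈ Q, q ((s \ Q).filter fun j => pos' i < pos' j).card * H' (Q.erase i) =
        q ((X \ Q).card - (a - 1) * (Q ∩ X).card) *
          (q ((s \ Q).filter fun j => pos i < pos j).card * H (Q.erase i)) := by
      intro i hi
      simp only [hH']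
      rw [← mul_assoc, ← mul_assoc, ← hq, ← hq, hsd, Finset.filter_union, Finset.filter_union,
        Finset.card_union_of_disjoint (Finset.disjoint_filter_filter hdj),
        Finset.card_union_of_disjoint (Finset.disjoint_filter_filter hdj)]
      congr 2
      by_cases hiX : i ∈ X
      · have c1 : (X \ Q).filter (fun j => pos' i < pos' j) =
            (X \ Q).filter (fun j => pos i < pos j) := by
          refine Finset.filter_congr fun j hj => ?_
          rw [pX i hiX, pX j (Finset.mem_sdiff.1 hj).1]; simp
        have c2 : ((Y ∪ Z) \ Q).filter (fun j => pos' i < pos' j) = ∅ := by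
          refine Finset.filter_false_of_mem fun j hj => ?_
          have hj' := (Finset.mem_sdiff.1 hj).1
          rw [pX i hiX, pN j (Finset.disjoint_right.1 dXW hj'), not_lt]
          exact (hK j (Finset.mem_union_right _ hj') i (hXs hiX)).le
        have c3 : ((Y ∪ Z) \ Q).filter (fun j => pos i < pos j) = (Y ∪ Z) \ Q := by
          refine Finset.filter_true_of_mem fun j hj => ?_
          rcases Finset.mem_union.1 (Finset.mem_sdiff.1 hj).1 with h | h
          · exact hXY i hiX j h
          · exact hXZ i hiX j h
        have c4 : ((Q.erase i ∩ X).card : ℤ) = (Q ∩ X).card - 1 := by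
          rw [Finset.erase_inter, Finset.card_erase_of_mem (Finset.mem_inter.2 ⟨hi, hiX⟩)]
          have : 0 < (Q ∩ X).card := Finset.card_pos.2 ⟨i, Finset.mem_inter.2 ⟨hi, hiX⟩⟩
          omega
        rw [c1, c2, c3, c4]
        push_cast
        simp only [Finset.card_empty]
        push_cast
        linear_combination -hcard
      · have c1 : (X \ Q).filter (fun j => pos' i < pos' j) = X \ Q := by
          refine Finset.filter_true_of_mem fun j hj => ?_
          have hj' := (Finset.mem_sdiff.1 hj).1
          rw [pN i hiX, pX j hj']
          exact hK i (hQ hi) j (hXs hj')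
        have c2 : ((Y ∪ Z) \ Q).filter (fun j => pos' i < pos' j) =
            ((Y ∪ Z) \ Q).filter (fun j => pos i < pos j) := by
          refine Finset.filter_congr fun j hj => ?_
          rw [pN i hiX, pN j (Finset.disjoint_right.1 dXW (Finset.mem_sdiff.1 hj).1)]
        have c3 : (X \ Q).filter (fun j => pos i < pos j) = ∅ := by
          refine Finset.filter_false_of_mem fun j hj => ?_
          have hj' := (Finset.mem_sdiff.1 hj).1
          rw [not_lt]
          rcases Finset.mem_union.1 (hQ hi) with h | h
          · exact absurd h hiX
          rcases Finset.mem_union.1 h with h | h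
          · exact (hXY j hj' i h).le
          · exact (hXZ j hj' i h).le
        have c4 : Q.erase i ∩ X = Q ∩ X := by
          rw [Finset.erase_inter, Finset.erase_eq_of_notMem]
          exact fun h => hiX (Finset.mem_inter.1 h).2
        rw [c1, c2, c3, c4]
        push_cast
        simp only [Finset.card_empty]
        push_cast
        ring
    rw [Finset.sum_congr rfl hterm, ← Finset.mul_sum, hH Q hQ hQc, mul_zero]
  have hinj : Set.InjOn pos' (Y ∪ (X ∪ Z) : Finset α) := by
    rw [← hs']
    intro i hi j hj hij
    rw [Finset.mem_coe] at hi hj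
    by_cases hiX : i ∈ X <;> by_cases hjX : j ∈ X
    · rw [pX i hiX, pX j hjX] at hij
      exact hpos (Finset.mem_coe.2 hi) (Finset.mem_coe.2 hj) (by omega)
    · rw [pX i hiX, pN j hjX] at hij
      have := hK j hj i hi
      omega
    · rw [pN i hiX, pX j hjX] at hij
      have := hK i hi j hj
      omega
    · rw [pN i hiX, pN j hjX] at hij
      exact hpos (Finset.mem_coe.2 hi) (Finset.mem_coe.2 hj) hij
  have hord : ∀ x ∈ Y, ∀ y ∈ X ∪ Z, pos' x < pos' y := by
    intro x hx y hy
    rw [pN x (Finset.disjoint_right.1 dXY hx)]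
    rcases Finset.mem_union.1 hy with h | h
    · rw [pX y h]
      exact hK x (by rw [hs']; exact Finset.mem_union_left _ hx) y (hXs h)
    · rw [pN y (Finset.disjoint_right.1 dXZ h)]
      exact hYZ x hx y h
  have hfin := LoweringRelation.halves hq hq0 hne hY
    (by rw [Finset.card_union_of_disjoint dXZ, hXZc]) hord hinj (hs' ▸ hrel)
  simp only [hH'] at hfin
  rw [Finset.inter_comm Y, Finset.disjoint_iff_inter_eq_empty.1 dXY, Finset.union_inter_cancel_left]
    at hfin
  simp only [Finset.card_empty, Nat.cast_zero, mul_zero, neg_zero, hq0, one_mul] at hfin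
  rw [hfin, sub_eq_add_neg ((a.choose 2 : ℕ) : ℤ), hq]
  ring

theorem sum_card_filter_lt_eq_choose (pos : α → ℤ) (A : Finset α) (hpos : Set.InjOn pos A) :
    ∑ i ∈ A, (A.filter fun j => pos j < pos i).card = A.card.choose 2 := by
  induction A using Finset.induction_on_max_value pos with
  | empty => simp
  | insert a s ha hmax ih =>
    have hlt : ∀ x ∈ s, pos x < pos a := fun x hx => lt_of_le_of_ne (hmax x hx) fun h =>
      ha (by
        have := hpos (Finset.mem_coe.2 (Finset.mem_insert_of_mem hx))
          (Finset.mem_coe.2 (Finset.mem_insert_self a s)) h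
        rwa [← this])
    rw [Finset.sum_insert ha, Finset.card_insert_of_notMem ha, Nat.choose_succ_succ' _ 1,
      ← ih (hpos.mono (by simp)), Finset.filter_insert, if_neg (lt_irrefl _),
      Finset.filter_true_of_mem hlt, Nat.choose_one_right]
    congr 1
    refine Finset.sum_congr rfl fun i hi => ?_
    rw [Finset.filter_insert, if_neg (not_lt.2 (hmax i hi))]

/-- A two-coloring of a linearly ordered set is alternating somewhere if some four elements have
alternating colors. -/
def HasAlternation (pos : α → ℤ) (s P : Finset α) : Prop :=
  ∃ i ∈ s, ∃ j ∈ s, ∃ k ∈ s, ∃ l ∈ s, pos i < pos j ∧ pos j < pos k ∧ pos k < pos l ∧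
    (i ∈ P ↔ j ∉ P) ∧ (j ∈ P ↔ k ∉ P) ∧ (k ∈ P ↔ l ∉ P)

/-- Without an alternation, one of the two color classes is an interval. -/
theorem exists_blocks_of_not_hasAlternation {pos : α → ℤ} {s P : Finset α} (hPs : P ⊆ s)
    (hpos : Set.InjOn pos s) (halt : ¬ HasAlternation pos s P) (hP : P.Nonempty)
    (hPc : (s \ P).Nonempty) :
    ∃ Y X Z : Finset α, (Y = P ∨ Y = s \ P) ∧ X ∪ Z = s \ Y ∧
      (∀ x ∈ X, ∀ y ∈ Y, pos x < pos y) ∧ (∀ y ∈ Y, ∀ z ∈ Z, pos y < pos z) ∧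
      (∀ x ∈ X, ∀ z ∈ Z, pos x < pos z) := by
  -- If neither class is convex, there are patterns `p, n, p'` with only `n` outside `P`, and `n₁,
  -- r, n₂` with only `r` in `P`. Comparing `p'` with `n₂` and `n₁` with `p` produces an alternation
  -- in every case.
  have conv : ∃ Y, (Y = P ∨ Y = s \ P) ∧
      ∀ y ∈ Y, ∀ y' ∈ Y, ∀ j ∈ s, pos y < pos j → pos j < pos y' → j ∈ Y := by
    by_contra hcon
    push Not at hcon
    obtain ⟨p, hp, p', hp', n, hn, h1, h2, hnP⟩ := hcon P (Or.inl rfl)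
    obtain ⟨n₁, hn₁, n₂, hn₂, r, hr, h3, h4, hrP⟩ := hcon (s \ P) (Or.inr rfl)
    simp only [Finset.mem_sdiff] at hn₁ hn₂ hrP
    have hrP' : r ∈ P := by by_contra h; exact hrP ⟨hr, h⟩
    have hps := hPs hp
    have hps' := hPs hp'
    have hne : ∀ i ∈ s, ∀ j ∈ s, pos i = pos j → i = j := fun i hi j hj h =>
      hpos (Finset.mem_coe.2 hi) (Finset.mem_coe.2 hj) h
    apply halt
    rcases lt_trichotomy (pos p') (pos n₂) with h | h | h
    · exact ⟨p, hps, n, hn, p', hps', n₂, hn₂.1, h1, h2, h, by tauto, by tauto, by tauto⟩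
    · exact absurd (hne _ hps' _ hn₂.1 h) (fun e => hn₂.2 (e ▸ hp'))
    rcases lt_trichotomy (pos n₁) (pos p) with h' | h' | h'
    · exact ⟨n₁, hn₁.1, p, hps, n, hn, p', hps', h', h1, h2, by tauto, by tauto, by tauto⟩
    · exact absurd (hne _ hn₁.1 _ hps h') (fun e => hn₁.2 (e ▸ hp))
    exact ⟨p, hps, n₁, hn₁.1, r, hr, n₂, hn₂.1, h', h3, h4, by tauto, by tauto, by tauto⟩
  obtain ⟨Y, hY, hconv⟩ := conv
  have hYs : Y ⊆ s := by
    rcases hY with rfl | rfl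
    · exact hPs
    · exact Finset.sdiff_subset
  have hYne : Y.Nonempty := by rcases hY with rfl | rfl <;> assumption
  obtain ⟨y₀, hy₀⟩ := hYne
  refine ⟨Y, (s \ Y).filter fun j => ∀ y ∈ Y, pos j < pos y,
    (s \ Y).filter fun j => ∀ y ∈ Y, pos y < pos j, hY, ?_, ?_, ?_, ?_⟩
  · rw [← Finset.filter_or]
    refine Finset.filter_true_of_mem fun j hj => ?_
    rw [Finset.mem_sdiff] at hj
    have hne : ∀ y ∈ Y, pos j ≠ pos y := fun y hy h => hj.2
      (by rwa [hpos (Finset.mem_coe.2 hj.1) (Finset.mem_coe.2 (hYs hy)) h])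
    by_contra hcon
    push Not at hcon
    obtain ⟨⟨y, hy, h1⟩, y', hy', h2⟩ := hcon
    exact hj.2 (hconv y hy y' hy' j hj.1 (lt_of_le_of_ne h1 (hne y hy).symm)
      (lt_of_le_of_ne h2 (hne y' hy')))
  · exact fun x hx => (Finset.mem_filter.1 hx).2
  · exact fun y hy z hz => (Finset.mem_filter.1 hz).2 y hy
  · exact fun x hx z hz => ((Finset.mem_filter.1 hx).2 y₀ hy₀).trans
      ((Finset.mem_filter.1 hz).2 y₀ hy₀)

/-- The sum of the ranks over a color class. -/
theorem sum_rank_eq (pos : α → ℤ) (s P : Finset α) (hPs : P ⊆ s) (hpos : Set.InjOn pos s) :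
    ∑ i ∈ P, (s.filter fun j => pos j < pos i).card =
      P.card.choose 2 + ∑ i ∈ P, ((s \ P).filter fun j => pos j < pos i).card := by
  rw [← sum_card_filter_lt_eq_choose pos P (hpos.mono (by simpa using hPs)),
    ← Finset.sum_add_distrib]
  refine Finset.sum_congr rfl fun i _ => ?_
  rw [← Finset.card_union_of_disjoint (Finset.disjoint_filter_filter Finset.disjoint_sdiff),
    ← Finset.filter_union, Finset.union_sdiff_of_subset hPs]

/-- For a coloring without alternations, a functional annihilated by the lowering operator takes
proportional values on the two color classes. -/
theorem LoweringRelation.compl_of_not_hasAlternation [IsDomain R] {q : ℤ → R}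
    (hq : ∀ a b, q (a + b) = q a * q b) (hq0 : q 0 = 1)
    (hne : ∀ k : ℕ, ∑ m ∈ Finset.range (k + 1), q m ≠ 0) {pos : α → ℤ}
    {s P : Finset α} {a : ℕ} (hPs : P ⊆ s) (hP : P.card = a) (hPc : (s \ P).card = a)
    (hpos : Set.InjOn pos s) (halt : ¬ HasAlternation pos s P)
    {H : Finset α → R} (hH : LoweringRelation q pos s a H) :
    ∃ d : ℕ, H P = (-1) ^ a * q ((a - 1) * d - (a.choose 2 : ℕ)) * H (s \ P) ∧
      (∀ π : α → α, Set.BijOn π P (s \ P : Finset α) →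
        (P.filter fun i => pos i < pos (π i)).card = d) ∧
      (∑ i ∈ P, ((s.filter fun j => pos j < pos i).card : ℤ)) -
        ∑ i ∈ s \ P, ((s.filter fun j => pos j < pos i).card : ℤ) = a * a - 2 * a * d := by
  have hsP : s \ (s \ P) = P := Finset.sdiff_sdiff_eq_self hPs
  rcases Nat.eq_zero_or_pos a with ha | ha
  · subst ha
    rw [Finset.card_eq_zero] at hP hPc
    refine ⟨0, ?_, ?_, ?_⟩
    · rw [hP] at hPc ⊢
      rw [hPc]; simp [hq0]
    · intro π _; simp [hP]
    · rw [hP] at hPc ⊢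
      rw [hPc]; simp
  have hPne : P.Nonempty := Finset.card_pos.1 (by omega)
  have hPcne : (s \ P).Nonempty := Finset.card_pos.1 (by omega)
  obtain ⟨Y, X, Z, hY, hXZ, h1, h2, h3⟩ :=
    exists_blocks_of_not_hasAlternation hPs hpos halt hPne hPcne
  have hYs : Y ⊆ s := by
    rcases hY with rfl | rfl
    · exact hPs
    · exact Finset.sdiff_subset
  have dXZ : Disjoint X Z := Finset.disjoint_left.2 fun x hx hy => lt_irrefl _ (h3 x hx x hy)
  have hYc : Y.card = a := by rcases hY with rfl | rfl <;> assumption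
  have hXZc : X.card + Z.card = a := by
    rw [← Finset.card_union_of_disjoint dXZ, hXZ]
    rcases hY with rfl | rfl
    · assumption
    · rw [hsP]; assumption
  have hs : X ∪ (Y ∪ Z) = s := by
    have : X ∪ (Y ∪ Z) = Y ∪ (X ∪ Z) := by
      ext x; simp only [Finset.mem_union]; tauto
    rw [this, hXZ, Finset.union_sdiff_of_subset hYs]
  have hmid := LoweringRelation.middle hq hq0 hne hYc hXZc h1 h2 h3 (hs.symm ▸ hpos)
    (hs.symm ▸ hH)
  have hYX : ∑ i ∈ Y, ((X ∪ Z).filter fun j => pos j < pos i).card = a * X.card := by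
    rw [← hYc, Finset.sum_const_nat]
    intro y hy
    rw [Finset.filter_union, Finset.filter_true_of_mem (fun x hx => h1 x hx y hy),
      Finset.filter_false_of_mem (fun z hz => not_lt.2 (h2 y hy z hz).le), Finset.union_empty]
  have hXY : ∑ i ∈ X ∪ Z, (Y.filter fun j => pos j < pos i).card = a * Z.card := by
    rw [Finset.sum_union dXZ, Finset.sum_eq_zero (s := X), zero_add, mul_comm,
      Finset.sum_const_nat]
    · intro z hz
      rw [Finset.filter_true_of_mem (fun y hy => h2 y hy z hz), hYc]
    · intro x hx
      rw [Finset.card_eq_zero]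
      exact Finset.filter_false_of_mem fun y hy => not_lt.2 (h1 x hx y hy).le
  have hXZi : (X.card : ℤ) + Z.card = a := by exact_mod_cast hXZc
  have hch : (2 : ℤ) * (a.choose 2 : ℕ) = a * (a - 1) := by
    rw [Nat.choose_two_right]
    have h2 : 2 ∣ a * (a - 1) := (Nat.even_mul_pred_self a).two_dvd
    have h4 : 2 * (a * (a - 1) / 2) = a * (a - 1) := Nat.mul_div_cancel' h2
    have h5 : ((a - 1 : ℕ) : ℤ) = a - 1 := by omega
    rw [← h5]
    exact_mod_cast h4
  have hr1 := sum_rank_eq pos s P hPs hpos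
  have hr2 := sum_rank_eq pos s (s \ P) Finset.sdiff_subset hpos
  rw [hsP, hPc] at hr2
  rw [hP] at hr1
  rcases hY with rfl | rfl
  -- `P` is the middle block: a bijection moves forward exactly the elements that it sends to `Z`.
  · refine ⟨Z.card, ?_, ?_, ?_⟩
    · rw [hmid, hXZ]
      congr 3
      have hX : (X.card : ℤ) = a - Z.card := by omega
      rw [hX]
      linear_combination hch
    · intro π hπ
      refine Finset.card_bij (fun i _ => π i) ?_ ?_ ?_
      · intro i hi
        rw [Finset.mem_filter] at hi
        have := Finset.mem_coe.1 (hπ.mapsTo (Finset.mem_coe.2 hi.1))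
        rw [← hXZ, Finset.mem_union] at this
        rcases this with h | h
        · exact absurd hi.2 (not_lt.2 (h1 _ h _ hi.1).le)
        · exact h
      · intro i hi j hj hij
        exact hπ.injOn (Finset.mem_coe.2 (Finset.mem_filter.1 hi).1)
          (Finset.mem_coe.2 (Finset.mem_filter.1 hj).1) hij
      · intro z hz
        obtain ⟨i, hi, rfl⟩ := hπ.surjOn
          (Finset.mem_coe.2 (hXZ ▸ Finset.mem_union_right X hz))
        exact ⟨i, Finset.mem_filter.2 ⟨Finset.mem_coe.1 hi, h2 _ (Finset.mem_coe.1 hi) _ hz⟩, rfl⟩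
    · rw [hXZ] at hYX hXY
      rw [hYX] at hr1
      rw [hXY] at hr2
      zify at hr1 hr2
      linear_combination hr1 - hr2 + a * hXZi
  · rw [hsP] at hXZ
    refine ⟨X.card, ?_, ?_, ?_⟩
    · rw [hmid, hXZ]
      have e1 : q ((a - 1) * X.card - (a.choose 2 : ℕ)) *
          q ((a.choose 2 : ℕ) - (a - 1) * X.card) = 1 := by
        rw [← hq, ← hq0]; congr 1; ring
      have e2 : ((-1 : R) ^ a) * (-1) ^ a = 1 := by
        rw [← mul_pow]; simp
      linear_combination (-H P) * e1 -
        q ((a - 1) * X.card - (a.choose 2 : ℕ)) * q ((a.choose 2 : ℕ) - (a - 1) * X.card) * H P * e2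
    · intro π hπ
      congr 1
      ext i
      rw [Finset.mem_filter]
      constructor
      · rintro ⟨hi, hlt⟩
        rcases Finset.mem_union.1 (hXZ ▸ hi) with h | h
        · exact h
        · exact absurd hlt (not_lt.2 (h2 _ (Finset.mem_coe.1 (hπ.mapsTo (Finset.mem_coe.2 hi))) _
            h).le)
      · intro hi
        have hiP : i ∈ P := hXZ ▸ Finset.mem_union_left Z hi
        exact ⟨hiP, h1 _ hi _ (Finset.mem_coe.1 (hπ.mapsTo (Finset.mem_coe.2 hiP)))⟩
    · rw [hXZ] at hYX hXY
      rw [hXY] at hr1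
      rw [hYX] at hr2
      zify at hr1 hr2
      linear_combination hr1 - hr2 + a * hXZi

end CyclicIntervals

/-! ### Non-crossing matchings: existence, uniqueness and parity -/

section Matchings

variable {α : Type*} [DecidableEq α]

/-- A perfect matching of `s` by pairs with one element in `P` and one element outside `P`, which
is non-crossing for the linear order given by `pos`. -/
structure IsNCMatching (pos : α → ℤ) (s P : Finset α) (M : Finset (Sym2 α)) : Prop where
  mem : ∀ a ∈ M, ∀ b ∈ a, b ∈ s
  opposite : ∀ b c, s(b, c) ∈ M → (b ∈ P ↔ c ∉ P)
  covers : ∀ b ∈ s, ∃! a, a ∈ M ∧ b ∈ a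
  noncrossing : ∀ b₁ b₂ c₁ c₂, s(b₁, c₁) ∈ M → s(b₂, c₂) ∈ M →
    ¬ (pos b₁ < pos b₂ ∧ pos b₂ < pos c₁ ∧ pos c₁ < pos c₂)

variable {pos : α → ℤ} {s P : Finset α} {M : Finset (Sym2 α)}

/-- No end of another arc lies between two neighbors, so an arc joining them crosses nothing.
Neighbors of different color can thus be matched first, and the rest independently. -/
theorem IsNCMatching.insert_adjacent {x y : α} (hx : x ∈ s) (hy : y ∈ s) (hxy : pos x < pos y)
    (hadj : ∀ j ∈ s, pos x < pos j → ¬ pos j < pos y) (hP : x ∈ P ↔ y ∉ P)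
    (hM : IsNCMatching pos ((s.erase x).erase y) P M) :
    IsNCMatching pos s P (insert s(x, y) M) := by
  have hmem : ∀ a ∈ M, ∀ b ∈ a, b ∈ s ∧ b ≠ x ∧ b ≠ y := fun a ha b hb => by
    have := hM.mem a ha b hb
    simp only [Finset.mem_erase] at this
    tauto
  have hl : ∀ b c, s(b, c) ∈ M → b ∈ s := fun b c h => (hmem _ h b (Sym2.mem_mk_left _ _)).1
  have hr : ∀ b c, s(b, c) ∈ M → c ∈ s := fun b c h => (hmem _ h c (Sym2.mem_mk_right _ _)).1
  refine ⟨?_, ?_, ?_, ?_⟩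
  · intro a ha b hb
    rcases Finset.mem_insert.1 ha with rfl | ha
    · rcases Sym2.mem_iff.1 hb with rfl | rfl <;> assumption
    · exact (hmem a ha b hb).1
  · intro b c h
    rcases Finset.mem_insert.1 h with h | h
    · rcases Sym2.eq_iff.1 h with ⟨rfl, rfl⟩ | ⟨rfl, rfl⟩
      · exact hP
      · tauto
    · exact hM.opposite b c h
  · intro b hb
    by_cases hbxy : b = x ∨ b = y
    · refine ⟨s(x, y), ⟨Finset.mem_insert_self _ _, Sym2.mem_iff.2 hbxy⟩, ?_⟩
      rintro a ⟨ha, hba⟩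
      rcases Finset.mem_insert.1 ha with rfl | ha
      · rfl
      · have := hmem a ha b hba
        tauto
    · push Not at hbxy
      obtain ⟨a, ⟨ha, hba⟩, hu⟩ := hM.covers b (by
        simp only [Finset.mem_erase]; tauto)
      refine ⟨a, ⟨Finset.mem_insert_of_mem ha, hba⟩, ?_⟩
      rintro a' ⟨ha', hba'⟩
      rcases Finset.mem_insert.1 ha' with rfl | ha'
      · rcases Sym2.mem_iff.1 hba' with h | h <;> tauto
      · exact hu a' ⟨ha', hba'⟩
  · intro b₁ b₂ c₁ c₂ h₁ h₂ ⟨l₁, l₂, l₃⟩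
    rcases Finset.mem_insert.1 h₁ with g₁ | g₁ <;> rcases Finset.mem_insert.1 h₂ with g₂ | g₂
    · rcases Sym2.eq_iff.1 g₁ with ⟨rfl, rfl⟩ | ⟨rfl, rfl⟩ <;>
        rcases Sym2.eq_iff.1 g₂ with ⟨rfl, rfl⟩ | ⟨rfl, rfl⟩ <;> omega
    · rcases Sym2.eq_iff.1 g₁ with ⟨rfl, rfl⟩ | ⟨rfl, rfl⟩
      · exact hadj b₂ (hl _ _ g₂) l₁ l₂
      · omega
    · rcases Sym2.eq_iff.1 g₂ with ⟨rfl, rfl⟩ | ⟨rfl, rfl⟩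
      · exact hadj c₁ (hr _ _ g₁) l₂ l₃
      · omega
    · exact hM.noncrossing _ _ _ _ g₁ g₂ ⟨l₁, l₂, l₃⟩

/-- Between two elements of different color there are neighbors of different color. -/
theorem exists_adjacent (hpos : Set.InjOn pos s) {p r : α} (hp : p ∈ s) (hr : r ∈ s)
    (hpr : pos p < pos r) (hP : p ∈ P ↔ r ∉ P) :
    ∃ x ∈ s, ∃ y ∈ s, pos p ≤ pos x ∧ pos x < pos y ∧ pos y ≤ pos r ∧
      (∀ j ∈ s, pos x < pos j → ¬ pos j < pos y) ∧ (x ∈ P ↔ p ∈ P) ∧ (y ∈ P ↔ r ∈ P) := by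
  -- `x` is the last element before `r` with the color of `p`, and `y` is its successor; maximality
  -- of `x` gives `y` the color of `r`.
  obtain ⟨x, hx, hxmax⟩ := Finset.exists_max_image
    (s.filter fun j => pos p ≤ pos j ∧ pos j < pos r ∧ (j ∈ P ↔ p ∈ P)) pos
    ⟨p, by simp [hp, hpr]⟩
  rw [Finset.mem_filter] at hx
  obtain ⟨y, hy, hymin⟩ := Finset.exists_min_image
    (s.filter fun j => pos x < pos j ∧ pos j ≤ pos r) pos ⟨r, by simp [hr, hx.2.2.1]⟩
  rw [Finset.mem_filter] at hy
  refine ⟨x, hx.1, y, hy.1, hx.2.1, hy.2.1, hy.2.2, ?_, hx.2.2.2, ?_⟩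
  · intro j hj h1 h2
    have := hymin j (Finset.mem_filter.2 ⟨hj, h1, by omega⟩)
    omega
  · rcases hy.2.2.eq_or_lt with h | h
    · rw [hpos (Finset.mem_coe.2 hy.1) (Finset.mem_coe.2 hr) h]
    · by_contra hcon
      have := hxmax y (Finset.mem_filter.2 ⟨hy.1, by omega, h, by tauto⟩)
      omega

theorem balanced_erase {x y : α} (hx : x ∈ s) (hy : y ∈ s) (hP : x ∈ P ↔ y ∉ P)
    (hbal : (s.filter (· ∈ P)).card = (s.filter (· ∉ P)).card) :
    (((s.erase x).erase y).filter (· ∈ P)).card = (((s.erase x).erase y).filter (· ∉ P)).card := by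
  have hxy : x ≠ y := by rintro rfl; tauto
  by_cases h : x ∈ P
  · have h' : y ∉ P := hP.1 h
    have h1 : ((s.erase x).erase y).filter (· ∈ P) = (s.filter (· ∈ P)).erase x := by
      ext j; simp only [Finset.mem_filter, Finset.mem_erase]; grind
    have h2 : ((s.erase x).erase y).filter (· ∉ P) = (s.filter (· ∉ P)).erase y := by
      ext j; simp only [Finset.mem_filter, Finset.mem_erase]; grind
    rw [h1, h2, Finset.card_erase_of_mem (by simp [hx, h]),
      Finset.card_erase_of_mem (by simp [hy, h']), hbal]
  · have h' : y ∈ P := by tauto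
    have h1 : ((s.erase x).erase y).filter (· ∈ P) = (s.filter (· ∈ P)).erase y := by
      ext j; simp only [Finset.mem_filter, Finset.mem_erase]; grind
    have h2 : ((s.erase x).erase y).filter (· ∉ P) = (s.filter (· ∉ P)).erase x := by
      ext j; simp only [Finset.mem_filter, Finset.mem_erase]; grind
    rw [h1, h2, Finset.card_erase_of_mem (by simp [hy, h']),
      Finset.card_erase_of_mem (by simp [hx, h]), hbal]

theorem card_erase_erase_lt {x : α} (hx : x ∈ s) (y : α) : ((s.erase x).erase y).card < s.card :=
  (Finset.card_le_card (Finset.erase_subset _ _)).trans_lt (Finset.card_erase_lt_of_mem hx)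

theorem injOn_erase_erase (hpos : Set.InjOn pos s) (x y : α) :
    Set.InjOn pos ((s.erase x).erase y : Finset α) :=
  hpos.mono (Finset.coe_subset.2 ((Finset.erase_subset _ _).trans (Finset.erase_subset _ _)))

/-- A balanced coloring has a non-crossing matching. -/
theorem exists_isNCMatching (pos : α → ℤ) (P s : Finset α) (hpos : Set.InjOn pos s)
    (hbal : (s.filter (· ∈ P)).card = (s.filter (· ∉ P)).card) :
    ∃ M, IsNCMatching pos s P M := by
  induction hn : s.card using Nat.strong_induction_on generalizing s with
  | _ n ih =>
  rcases s.eq_empty_or_nonempty with rfl | hne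
  · exact ⟨∅, by simp, by simp, by simp, by simp⟩
  have hcard := Finset.card_filter_add_card_filter_not (s := s) (· ∈ P)
  have hspos := Finset.card_pos.2 hne
  obtain ⟨p, hp⟩ := Finset.card_pos.1 (show 0 < (s.filter (· ∈ P)).card by omega)
  obtain ⟨r, hr⟩ := Finset.card_pos.1 (show 0 < (s.filter (· ∉ P)).card by omega)
  rw [Finset.mem_filter] at hp hr
  have hadj : ∃ x ∈ s, ∃ y ∈ s, pos x < pos y ∧
      (∀ j ∈ s, pos x < pos j → ¬ pos j < pos y) ∧ (x ∈ P ↔ y ∉ P) := by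
    rcases lt_trichotomy (pos p) (pos r) with h | h | h
    · obtain ⟨x, hx, y, hy, -, h1, -, h2, h3, h4⟩ :=
        exists_adjacent (P := P) hpos hp.1 hr.1 h (by tauto)
      exact ⟨x, hx, y, hy, h1, h2, by tauto⟩
    · exact absurd (hpos (Finset.mem_coe.2 hp.1) (Finset.mem_coe.2 hr.1) h)
        (fun e => hr.2 (e ▸ hp.2))
    · obtain ⟨x, hx, y, hy, -, h1, -, h2, h3, h4⟩ :=
        exists_adjacent (P := P) hpos hr.1 hp.1 h (by tauto)
      exact ⟨x, hx, y, hy, h1, h2, by tauto⟩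
  obtain ⟨x, hx, y, hy, hxy, had, hP⟩ := hadj
  obtain ⟨M, hM⟩ := ih _ (hn ▸ card_erase_erase_lt hx y) _ (injOn_erase_erase hpos x y)
    (balanced_erase hx hy hP hbal) rfl
  exact ⟨_, hM.insert_adjacent hx hy hxy had hP⟩

/-- If the non-crossing matching is unique, the coloring has no alternation. -/
theorem not_hasAlternation_of_unique (pos : α → ℤ) (P s : Finset α) (hpos : Set.InjOn pos s)
    (hbal : (s.filter (· ∈ P)).card = (s.filter (· ∉ P)).card)
    (huniq : ∀ M M', IsNCMatching pos s P M → IsNCMatching pos s P M' → M = M') :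
    ¬ HasAlternation pos s P := by
  induction hn : s.card using Nat.strong_induction_on generalizing s with
  | _ n ih =>
  rintro ⟨i, hi, j, hj, k, hk, l, hl, hij, hjk, hkl, cij, cjk, ckl⟩
  obtain ⟨x₁, hx₁, y₁, hy₁, -, a₁, b₁, adj₁, cx₁, cy₁⟩ := exists_adjacent hpos hi hj hij cij
  obtain ⟨x₂, hx₂, y₂, hy₂, z₂, a₂, b₂, adj₂, cx₂, cy₂⟩ := exists_adjacent hpos hj hk hjk cjk
  obtain ⟨x₃, hx₃, y₃, hy₃, z₃, a₃, -, adj₃, cx₃, cy₃⟩ := exists_adjacent hpos hk hl hkl ckl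
  obtain ⟨M, hM⟩ := exists_isNCMatching pos P s hpos hbal
  -- Neighbors of different color always form an arc of `M`: the remaining elements are balanced, so
  -- they have a matching, and adding this arc to it gives `M` by uniqueness.
  have hin : ∀ x ∈ s, ∀ y ∈ s, pos x < pos y → (∀ j ∈ s, pos x < pos j → ¬ pos j < pos y) →
      (x ∈ P ↔ y ∉ P) → s(x, y) ∈ M := by
    intro x hx y hy hxy had hP
    obtain ⟨M', hM'⟩ := exists_isNCMatching pos P ((s.erase x).erase y)
      (injOn_erase_erase hpos x y) (balanced_erase hx hy hP hbal)
    rw [huniq _ _ hM (hM'.insert_adjacent hx hy hxy had hP)]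
    exact Finset.mem_insert_self _ _
  have hP₁ : x₁ ∈ P ↔ y₁ ∉ P := cx₁.trans (cij.trans (not_congr cy₁.symm))
  have hP₂ : x₂ ∈ P ↔ y₂ ∉ P := cx₂.trans (cjk.trans (not_congr cy₂.symm))
  have hP₃ : x₃ ∈ P ↔ y₃ ∉ P := cx₃.trans (ckl.trans (not_congr cy₃.symm))
  have m₁ := hin x₁ hx₁ y₁ hy₁ a₁ adj₁ hP₁
  have m₂ := hin x₂ hx₂ y₂ hy₂ a₂ adj₂ hP₂
  have m₃ := hin x₃ hx₃ y₃ hy₃ a₃ adj₃ hP₃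
  -- An element is on one arc only, so consecutive forced pairs share no element.
  have disj : ∀ x y x' y', s(x, y) ∈ M → s(x', y') ∈ M → pos x < pos y → pos x' < pos y' →
      y = x' → False := by
    rintro x y x' y' h h' l l' rfl
    have hy : y ∈ s := hM.mem _ h y (Sym2.mem_mk_right _ _)
    have e := (hM.covers y hy).unique ⟨h, Sym2.mem_mk_right _ _⟩ ⟨h', Sym2.mem_mk_left _ _⟩
    rcases Sym2.eq_iff.1 e with ⟨rfl, rfl⟩ | ⟨rfl, -⟩ <;> omega
  have n₁ : y₁ ≠ x₂ := fun h => disj _ _ _ _ m₁ m₂ a₁ a₂ h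
  have n₂ : y₂ ≠ x₃ := fun h => disj _ _ _ _ m₂ m₃ a₂ a₃ h
  have l₁ : pos y₁ < pos x₂ := lt_of_le_of_ne (by omega) fun h =>
    n₁ (hpos (Finset.mem_coe.2 hy₁) (Finset.mem_coe.2 hx₂) h)
  have l₂ : pos y₂ < pos x₃ := lt_of_le_of_ne (by omega) fun h =>
    n₂ (hpos (Finset.mem_coe.2 hy₂) (Finset.mem_coe.2 hx₃) h)
  -- Without the middle pair, `x₁, y₁, x₃, y₃` still alternate, and uniqueness is inherited because
  -- the removed arc can be put back.
  refine ih _ (hn ▸ card_erase_erase_lt hx₂ y₂) _ (injOn_erase_erase hpos x₂ y₂)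
    (balanced_erase hx₂ hy₂ hP₂ hbal) ?_ rfl ?_
  · intro N N' hN hN'
    have e := huniq _ _ (hN.insert_adjacent hx₂ hy₂ a₂ adj₂ hP₂)
      (hN'.insert_adjacent hx₂ hy₂ a₂ adj₂ hP₂)
    have hnot : ∀ K, IsNCMatching pos ((s.erase x₂).erase y₂) P K → s(x₂, y₂) ∉ K := fun K hK h => by
      have := hK.mem _ h x₂ (Sym2.mem_mk_left _ _)
      simp at this
    rw [← Finset.erase_insert (hnot N hN), e, Finset.erase_insert (hnot N' hN')]
  · have hne : ∀ z ∈ s, pos z < pos x₂ ∨ pos y₂ < pos z → z ∈ (s.erase x₂).erase y₂ := by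
      intro z hz h
      simp only [Finset.mem_erase]
      refine ⟨?_, ?_, hz⟩ <;> rintro rfl <;> omega
    exact ⟨x₁, hne _ hx₁ (by omega), y₁, hne _ hy₁ (by omega), x₃, hne _ hx₃ (by omega),
      y₃, hne _ hy₃ (by omega), a₁, by omega, a₃, hP₁,
      cy₁.trans (cjk.trans (not_congr cx₃.symm)), hP₃⟩

/-- The partner function of a matching. -/
theorem IsNCMatching.exists_partner (hM : IsNCMatching pos s P M) :
    ∃ π : α → α, (∀ b ∈ s, s(b, π b) ∈ M ∧ π b ∈ s ∧ (b ∈ P ↔ π b ∉ P) ∧ π (π b) = b) ∧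
      ∀ b c, s(b, c) ∈ M → c = π b := by
  have hex : ∀ b : α, ∃ c, b ∈ s → s(b, c) ∈ M := by
    intro b
    by_cases hb : b ∈ s
    · obtain ⟨a, ⟨ha, hba⟩, -⟩ := hM.covers b hb
      obtain ⟨c, rfl⟩ := Sym2.mem_iff_exists.1 hba
      exact ⟨c, fun _ => ha⟩
    · exact ⟨b, fun h => absurd h hb⟩
  choose π hπ using hex
  have hu : ∀ b c, s(b, c) ∈ M → c = π b := by
    intro b c h
    have hb : b ∈ s := hM.mem _ h b (Sym2.mem_mk_left _ _)
    have e := (hM.covers b hb).unique ⟨h, Sym2.mem_mk_left _ _⟩ ⟨hπ b hb, Sym2.mem_mk_left _ _⟩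
    exact Sym2.congr_right.1 e
  refine ⟨π, fun b hb => ⟨hπ b hb, hM.mem _ (hπ b hb) _ (Sym2.mem_mk_right _ _),
    hM.opposite _ _ (hπ b hb), ?_⟩, hu⟩
  exact (hu _ _ (by rw [Sym2.eq_swap]; exact hπ b hb)).symm

/-- The number of elements between the two ends of an arc of a non-crossing matching is even. -/
theorem IsNCMatching.even_card_between (hM : IsNCMatching pos s P M) (hpos : Set.InjOn pos s)
    {x y : α} (hxy : s(x, y) ∈ M) :
    Even (s.filter fun j => pos x < pos j ∧ pos j < pos y).card := by
  obtain ⟨π, hπ, hu⟩ := hM.exists_partner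
  rw [← ZMod.natCast_eq_zero_iff_even]
  have hx : x ∈ s := hM.mem _ hxy x (Sym2.mem_mk_left _ _)
  have hy : y ∈ s := hM.mem _ hxy y (Sym2.mem_mk_right _ _)
  have hyx : s(y, x) ∈ M := by rw [Sym2.eq_swap]; exact hxy
  have : ∑ j ∈ s.filter (fun j => pos x < pos j ∧ pos j < pos y), (1 : ZMod 2) = 0 := by
    -- As no arc crosses `s(x, y)`, the partner function is a fixed-point-free involution of the
    -- elements between its ends.
    refine Finset.sum_involution (fun j _ => π j) (fun _ _ => by decide) ?_ ?_ ?_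
    · intro j hj _ h
      have := (hπ j (Finset.mem_filter.1 hj).1).2.2.1
      rw [h] at this
      tauto
    · intro j hj
      rw [Finset.mem_filter] at hj ⊢
      obtain ⟨hjM, hπs, -, hππ⟩ := hπ j hj.1
      have hjM' : s(π j, j) ∈ M := by rw [Sym2.eq_swap]; exact hjM
      have n1 : pos (π j) ≠ pos x := fun h => by
        have e := hpos (Finset.mem_coe.2 hπs) (Finset.mem_coe.2 hx) h
        rw [← hππ, e, ← hu _ _ hxy] at hj
        omega
      have n2 : pos (π j) ≠ pos y := fun h => by
        have e := hpos (Finset.mem_coe.2 hπs) (Finset.mem_coe.2 hy) h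
        rw [← hππ, e, ← hu _ _ hyx] at hj
        omega
      have c1 := hM.noncrossing _ _ _ _ hxy hjM
      have c2 := hM.noncrossing _ _ _ _ hjM' hxy
      exact ⟨hπs, by omega, by omega⟩
    · intro j hj
      exact (hπ j (Finset.mem_filter.1 hj).1).2.2.2
  simpa using this

end Matchings

/-! ### The two-colored vertex model and its flip symmetry in one row -/

section Lattice

variable {R : Type*} [CommRing R]

/-- The weight of a vertex of the two-colored lattice model.  The pairs of Booleans are the blue
and the red occupation numbers of the left edge `h`, the bottom edge `a`, the top edge `b` and the
right edge `g`. -/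
def vertexWeight (t x : R) (h a b g : Bool × Bool) : R :=
  if h.1.toNat + a.1.toNat = b.1.toNat + g.1.toNat ∧ h.1.toNat + a.1.toNat ≤ 1 ∧
      h.2.toNat + a.2.toNat = b.2.toNat + g.2.toNat ∧ h.2.toNat + a.2.toNat ≤ 1 then
    x ^ (g.1.toNat + g.2.toNat) * t ^ (g.1.toNat * (h.2.toNat + a.2.toNat))
  else 0

/-- The weight of a row of the lattice model with bottom boundary `σ`, top boundary `τ`, left
boundary `h` and empty right boundary. -/
def rowWeight (t x : R) : {m : ℕ} → (Fin m → Bool × Bool) → (Fin m → Bool × Bool) → Bool × Bool → R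
  | 0, _, _, h => if h = (false, false) then 1 else 0
  | _ + 1, σ, τ, h =>
    ∑ g : Bool × Bool, vertexWeight t x h (σ 0) (τ 0) g * rowWeight t x (Fin.tail σ) (Fin.tail τ) g

/-- The contribution of one column to the coefficients of the flip operator. -/
def flipFactor (t : R) (a : Bool × Bool) : R :=
  (if a.1 then -1 else 1) * (if a.2 then -t else 1)

/-- The coefficient of the flip operator at the column `i`. -/
def flipCoeff (t : R) {m : ℕ} (σ : Fin m → Bool × Bool) (i : Fin m) : R :=
  ∏ j ∈ Finset.Ioi i, flipFactor t (σ j)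

/-- A vertex of nonzero weight conserves the number of paths of each color, and `flipFactor` is
multiplicative in these numbers. The right edge of the row is empty and contributes `1`. -/
theorem rowWeight_conservation (t x : R) {m : ℕ} (σ τ : Fin m → Bool × Bool) (h : Bool × Bool) :
    (∏ j, flipFactor t (τ j)) * rowWeight t x σ τ h =
      flipFactor t h * (∏ j, flipFactor t (σ j)) * rowWeight t x σ τ h := by
  induction m generalizing h with
  | zero =>
    simp only [rowWeight]
    split_ifs with hh
    · subst hh; simp [flipFactor]
    · simp
  | succ m ih =>
    rw [rowWeight, Fin.prod_univ_succ, Fin.prod_univ_succ, Finset.mul_sum, Finset.mul_sum]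
    refine Finset.sum_congr rfl fun g _ => ?_
    have := ih (Fin.tail σ) (Fin.tail τ) g
    have key : flipFactor t (τ 0) * flipFactor t g * vertexWeight t x h (σ 0) (τ 0) g =
        flipFactor t h * flipFactor t (σ 0) * vertexWeight t x h (σ 0) (τ 0) g := by
      rcases h with ⟨h₁, h₂⟩
      rcases g with ⟨g₁, g₂⟩
      rcases σ 0 with ⟨a₁, a₂⟩
      rcases τ 0 with ⟨b₁, b₂⟩
      cases h₁ <;> cases h₂ <;> cases g₁ <;> cases g₂ <;> cases a₁ <;> cases a₂ <;> cases b₁ <;>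
        cases b₂ <;> simp [vertexWeight, flipFactor]
    simp only [Fin.tail] at this ⊢
    linear_combination flipFactor t (τ 0) * vertexWeight t x h (σ 0) (τ 0) g * this +
      (∏ j : Fin m, flipFactor t (σ j.succ)) * rowWeight t x (Fin.tail σ) (Fin.tail τ) g * key

/-- Flipping blue to red on the bottom boundary of a row. -/
def flipBottom (t x : R) {m : ℕ} (σ τ : Fin m → Bool × Bool) (h : Bool × Bool) : R :=
  ∑ i, if σ i = (true, false) then
    flipCoeff t σ i * rowWeight t x (Function.update σ i (false, true)) τ h else 0

/-- Flipping red to blue on the top boundary of a row. -/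
def flipTop (t x : R) {m : ℕ} (σ τ : Fin m → Bool × Bool) (h : Bool × Bool) : R :=
  ∑ i, if τ i = (false, true) then
    flipCoeff t τ i * rowWeight t x σ (Function.update τ i (true, false)) h else 0

theorem flipCoeff_zero (t : R) {m : ℕ} (σ : Fin (m + 1) → Bool × Bool) :
    flipCoeff t σ 0 = ∏ j, flipFactor t (Fin.tail σ j) := by
  simp only [flipCoeff, Fin.tail]
  rw [Fin.prod_Ioi_zero]

theorem flipCoeff_succ (t : R) {m : ℕ} (σ : Fin (m + 1) → Bool × Bool) (i : Fin m) :
    flipCoeff t σ i.succ = flipCoeff t (Fin.tail σ) i := by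
  simp only [flipCoeff, Fin.tail]
  rw [Fin.prod_Ioi_succ]

/-- Splits off the leftmost column for the induction. Flip coefficients only look to the right, so a
flip in another column does not see the first one. -/
theorem flipBottom_succ (t x : R) {m : ℕ} (σ τ : Fin (m + 1) → Bool × Bool) (h : Bool × Bool) :
    flipBottom t x σ τ h =
      (if σ 0 = (true, false) then (∏ j, flipFactor t (Fin.tail σ j)) *
        ∑ g, vertexWeight t x h (false, true) (τ 0) g *
          rowWeight t x (Fin.tail σ) (Fin.tail τ) g else 0) +
      ∑ g, vertexWeight t x h (σ 0) (τ 0) g * flipBottom t x (Fin.tail σ) (Fin.tail τ) g := by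
  rw [flipBottom, Fin.sum_univ_succ]
  congr 1
  · rw [flipCoeff_zero]
    simp [rowWeight, Fin.tail_update_zero]
  · simp only [flipBottom, Finset.mul_sum]
    rw [Finset.sum_comm]
    refine Finset.sum_congr rfl fun i _ => ?_
    simp only [flipCoeff_succ, rowWeight, Fin.tail_update_succ]
    rw [Function.update_of_ne (Fin.succ_ne_zero i).symm]
    by_cases hi : σ i.succ = (true, false)
    · have hi' : Fin.tail σ i = (true, false) := hi
      simp only [if_pos hi, if_pos hi', Finset.mul_sum]
      exact Finset.sum_congr rfl fun g _ => by ring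
    · have hi' : ¬ Fin.tail σ i = (true, false) := hi
      simp only [if_neg hi, if_neg hi', mul_zero, Finset.sum_const_zero]

theorem flipTop_succ (t x : R) {m : ℕ} (σ τ : Fin (m + 1) → Bool × Bool) (h : Bool × Bool) :
    flipTop t x σ τ h =
      (if τ 0 = (false, true) then (∏ j, flipFactor t (Fin.tail τ j)) *
        ∑ g, vertexWeight t x h (σ 0) (true, false) g *
          rowWeight t x (Fin.tail σ) (Fin.tail τ) g else 0) +
      ∑ g, vertexWeight t x h (σ 0) (τ 0) g * flipTop t x (Fin.tail σ) (Fin.tail τ) g := by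
  rw [flipTop, Fin.sum_univ_succ]
  congr 1
  · rw [flipCoeff_zero]
    simp [rowWeight, Fin.tail_update_zero]
  · simp only [flipTop, Finset.mul_sum]
    rw [Finset.sum_comm]
    refine Finset.sum_congr rfl fun i _ => ?_
    simp only [flipCoeff_succ, rowWeight, Fin.tail_update_succ]
    rw [Function.update_of_ne (Fin.succ_ne_zero i).symm]
    by_cases hi : τ i.succ = (false, true)
    · have hi' : Fin.tail τ i = (false, true) := hi
      simp only [if_pos hi, if_pos hi', Finset.mul_sum]
      exact Finset.sum_congr rfl fun g _ => by ring
    · have hi' : ¬ Fin.tail τ i = (false, true) := hi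
      simp only [if_neg hi, if_neg hi', mul_zero, Finset.sum_const_zero]

/-- The row transfer operator commutes with the flip operator, up to the flip on the left edge. -/
theorem flipBottom_add_eq_flipTop (t x : R) {m : ℕ} (σ τ : Fin m → Bool × Bool) (h : Bool × Bool) :
    flipBottom t x σ τ h +
      (if h = (true, false) then (∏ j, flipFactor t (σ j)) * rowWeight t x σ τ (false, true) else 0) =
    flipTop t x σ τ h := by
  induction m generalizing h with
  | zero => simp [flipBottom, flipTop, rowWeight]
  | succ m ih =>
    rw [flipBottom_succ, flipTop_succ]
    have ih' : ∀ g, flipBottom t x (Fin.tail σ) (Fin.tail τ) g =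
        flipTop t x (Fin.tail σ) (Fin.tail τ) g -
        (if g = (true, false) then (∏ j, flipFactor t (Fin.tail σ j)) *
          rowWeight t x (Fin.tail σ) (Fin.tail τ) (false, true) else 0) :=
      fun g => eq_sub_of_add_eq (ih _ _ g)
    have hc := rowWeight_conservation t x (Fin.tail σ) (Fin.tail τ)
    simp only [ih', rowWeight, Fin.prod_univ_succ (fun j => flipFactor t (σ j))]
    have htail : ∏ j : Fin m, flipFactor t (σ j.succ) = ∏ j, flipFactor t (Fin.tail σ j) := rfl
    rw [htail]
    -- What remains is an identity at a single vertex. The weights and flips of the tail enter as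
    -- free variables, subject only to the conservation relations between the bottom product `p` and
    -- the top product `p'`.
    generalize (∏ j, flipFactor t (Fin.tail σ j)) = p at *
    generalize (∏ j, flipFactor t (Fin.tail τ j)) = p' at *
    have h00 := hc (false, false)
    have h01 := hc (false, true)
    have h10 := hc (true, false)
    have h11 := hc (true, true)
    simp only [Fintype.sum_prod_type, Fintype.sum_bool] at *
    generalize rowWeight t x (Fin.tail σ) (Fin.tail τ) (false, false) = w00 at *
    generalize rowWeight t x (Fin.tail σ) (Fin.tail τ) (false, true) = w01 at *
    generalize rowWeight t x (Fin.tail σ) (Fin.tail τ) (true, false) = w10 at *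
    generalize rowWeight t x (Fin.tail σ) (Fin.tail τ) (true, true) = w11 at *
    generalize flipTop t x (Fin.tail σ) (Fin.tail τ) (false, false) = f00
    generalize flipTop t x (Fin.tail σ) (Fin.tail τ) (false, true) = f01
    generalize flipTop t x (Fin.tail σ) (Fin.tail τ) (true, false) = f10
    generalize flipTop t x (Fin.tail σ) (Fin.tail τ) (true, true) = f11
    generalize σ 0 = a
    generalize τ 0 = b
    clear ih ih' hc htail
    simp [flipFactor] at h00 h01 h10 h11
    rcases h with ⟨h₁, h₂⟩
    rcases a with ⟨a₁, a₂⟩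
    rcases b with ⟨b₁, b₂⟩
    cases h₁ <;> cases h₂ <;> cases a₁ <;> cases a₂ <;> cases b₁ <;> cases b₂ <;>
      simp [vertexWeight, flipFactor] <;> grind

end Lattice

/-! ### Transfer matrices and partition functions -/

section Transfer

variable {R : Type*} [CommRing R]

/-- The row transfer matrix. -/
def rowMatrix (t : R) (m : ℕ) (x : R) : Matrix (Fin m → Bool × Bool) (Fin m → Bool × Bool) R :=
  fun σ τ => rowWeight t x σ τ (false, false)

/-- The matrix of the flip operator. -/
def flipMatrix (t : R) (m : ℕ) : Matrix (Fin m → Bool × Bool) (Fin m → Bool × Bool) R :=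
  fun σ ρ => ∑ i, if σ i = (true, false) ∧ ρ = Function.update σ i (false, true) then
    flipCoeff t σ i else 0

/-- The coefficient at `i` involves only columns strictly to the right of `i`, so it can be read off
before or after the flip. -/
theorem flipCoeff_update (t : R) {m : ℕ} (σ : Fin m → Bool × Bool) (i : Fin m) (a : Bool × Bool) :
    flipCoeff t (Function.update σ i a) i = flipCoeff t σ i := by
  refine Finset.prod_congr rfl fun j hj => ?_
  rw [Function.update_of_ne (Finset.mem_Ioi.1 hj).ne']

theorem flipMatrix_mul_apply (t : R) {m : ℕ}
    (A : Matrix (Fin m → Bool × Bool) (Fin m → Bool × Bool) R) (σ τ : Fin m → Bool × Bool) :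
    (flipMatrix t m * A) σ τ = ∑ i, if σ i = (true, false) then
      flipCoeff t σ i * A (Function.update σ i (false, true)) τ else 0 := by
  rw [Matrix.mul_apply]
  simp only [flipMatrix, Finset.sum_mul]
  rw [Finset.sum_comm]
  refine Finset.sum_congr rfl fun i _ => ?_
  by_cases hi : σ i = (true, false)
  · simp [hi]
  · simp [hi]

theorem mul_flipMatrix_apply (t : R) {m : ℕ}
    (A : Matrix (Fin m → Bool × Bool) (Fin m → Bool × Bool) R) (σ τ : Fin m → Bool × Bool) :
    (A * flipMatrix t m) σ τ = ∑ i, if τ i = (false, true) then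
      flipCoeff t τ i * A σ (Function.update τ i (true, false)) else 0 := by
  rw [Matrix.mul_apply]
  simp only [flipMatrix, Finset.mul_sum]
  rw [Finset.sum_comm]
  refine Finset.sum_congr rfl fun i _ => ?_
  have heq : ∀ ρ : Fin m → Bool × Bool,
      (ρ i = (true, false) ∧ τ = Function.update ρ i (false, true)) ↔
        (τ i = (false, true) ∧ ρ = Function.update τ i (true, false)) := by
    intro ρ
    constructor
    · rintro ⟨h, rfl⟩
      simp [← h]
    · rintro ⟨h, rfl⟩
      simp [← h]
  simp only [heq]
  by_cases hi : τ i = (false, true)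
  · simp [hi, flipCoeff_update, mul_comm]
  · simp [hi]

/-- The left edge of each row is empty, so the extra term in `flipBottom_add_eq_flipTop` vanishes.
-/
theorem flipMatrix_commute_rowMatrix (t : R) (m : ℕ) (x : R) :
    Commute (flipMatrix t m) (rowMatrix t m x) := by
  ext σ τ
  rw [flipMatrix_mul_apply, mul_flipMatrix_apply]
  have := flipBottom_add_eq_flipTop t x σ τ (false, false)
  simpa [flipBottom, flipTop, rowMatrix] using this

/-- The partition function of the lattice with one row for each entry of `x`. -/
def latticeZ (t : R) (m : ℕ) {n : ℕ} (x : Fin n → R) (σ τ : Fin m → Bool × Bool) : R :=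
  (List.ofFn fun k => rowMatrix t m (x k)).prod σ τ

/-- The flip operator passes through all the rows, from the bottom boundary to the top one. -/
theorem latticeZ_flip (t : R) (m : ℕ) {n : ℕ} (x : Fin n → R) (σ τ : Fin m → Bool × Bool) :
    (∑ i, if σ i = (true, false) then
      flipCoeff t σ i * latticeZ t m x (Function.update σ i (false, true)) τ else 0) =
    ∑ i, if τ i = (false, true) then
      flipCoeff t τ i * latticeZ t m x σ (Function.update τ i (true, false)) else 0 := by
  have hc : Commute (flipMatrix t m) (List.ofFn fun k => rowMatrix t m (x k)).prod := by
    refine Commute.list_prod_right _ _ fun A hA => ?_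
    obtain ⟨k, rfl⟩ := List.mem_ofFn.1 hA
    exact flipMatrix_commute_rowMatrix t m (x k)
  have h := congrFun (congrFun hc.eq σ) τ
  rw [flipMatrix_mul_apply, mul_flipMatrix_apply] at h
  exact h

/-- An entry of a product of matrices is a sum over paths. -/
theorem Matrix.list_ofFn_prod_apply {ι : Type*} [Fintype ι] [DecidableEq ι] {n : ℕ}
    (A : Fin n → Matrix ι ι R) (σ τ : ι) :
    (List.ofFn A).prod σ τ = ∑ g : Fin (n + 1) → ι,
      if g 0 = σ ∧ g (Fin.last n) = τ then ∏ k, A k (g k.castSucc) (g k.succ) else 0 := by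
  induction n generalizing σ with
  | zero =>
    rw [← (Equiv.funUnique (Fin 1) ι).symm.sum_comp]
    simp only [List.ofFn_zero, List.prod_nil, Matrix.one_apply]
    by_cases h : σ = τ
    · subst h; simp
    · rw [if_neg h, Finset.sum_eq_zero]
      intro a _
      rw [if_neg]
      rintro ⟨h1, h2⟩
      exact h (h1.symm.trans h2)
  | succ n ih =>
    rw [List.ofFn_succ, List.prod_cons, Matrix.mul_apply,
      ← (Fin.consEquiv fun _ : Fin (n + 2) => ι).sum_comp, Fintype.sum_prod_type]
    refine Eq.trans ?_ (Finset.sum_eq_single σ ?_ ?_).symm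
    · simp only [ih, Finset.mul_sum]
      rw [Finset.sum_comm]
      refine Finset.sum_congr rfl fun g _ => ?_
      rw [Finset.sum_eq_single (g 0)]
      · simp only [Fin.consEquiv, Equiv.coe_fn_mk, Fin.cons_zero, true_and, Fin.prod_univ_succ,
          Fin.castSucc_zero, Fin.cons_succ, ← Fin.succ_last, ← Fin.succ_castSucc, mul_ite, mul_zero]
      · intro ρ _ hρ
        rw [if_neg (fun h => hρ h.1.symm), mul_zero]
      · simp
    · intro a _ ha
      refine Finset.sum_eq_zero fun g _ => if_neg fun h => ha ?_
      simpa [Fin.consEquiv] using h.1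
    · simp

/-! ### Row weights in closed form, by counting occupied columns -/

/-- The number of occupied columns with index at least `c`. -/
def countFrom {m : ℕ} (α : Fin m → Bool) (c : ℕ) : ℕ :=
  (Finset.univ.filter fun i : Fin m => c ≤ (i : ℕ) ∧ α i = true).card

theorem countFrom_succ_succ {m : ℕ} (α : Fin (m + 1) → Bool) (c : ℕ) :
    countFrom α (c + 1) = countFrom (Fin.tail α) c := by
  simp only [countFrom, Finset.card_filter, Fin.sum_univ_succ, Fin.tail]
  simp
  rfl

theorem countFrom_eq_add {m : ℕ} (α : Fin m → Bool) (c : Fin m) :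
    countFrom α c = (α c).toNat + countFrom α (c + 1) := by
  have h : (Finset.univ.filter fun i : Fin m => (c : ℕ) ≤ (i : ℕ) ∧ α i = true) =
      (Finset.univ.filter fun i : Fin m => i = c ∧ α i = true) ∪
      (Finset.univ.filter fun i : Fin m => (c : ℕ) + 1 ≤ (i : ℕ) ∧ α i = true) := by
    ext i
    simp only [Finset.mem_filter, Finset.mem_univ, true_and, Finset.mem_union, Fin.ext_iff]
    grind
  rw [countFrom, h, Finset.card_union_of_disjoint, countFrom]
  · congr 1
    by_cases hc : α c = true
    · rw [hc, Bool.toNat_true, Finset.card_eq_one]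
      refine ⟨c, ?_⟩
      ext i
      simp only [Finset.mem_filter, Finset.mem_univ, true_and, Finset.mem_singleton]
      constructor
      · exact fun h => h.1
      · rintro rfl; exact ⟨rfl, hc⟩
    · rw [Bool.eq_false_iff.2 hc, Bool.toNat_false, Finset.card_eq_zero,
        Finset.filter_eq_empty_iff]
      rintro i - ⟨rfl, hi⟩
      exact hc hi
  · rw [Finset.disjoint_left]
    intro i h1 h2
    simp only [Finset.mem_filter, Finset.mem_univ, true_and] at h1 h2
    rw [h1.1] at h2
    omega

/-- The paths of one color can go through a row with bottom boundary `α`, top boundary `β` and left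
boundary `h`. -/
def IsStrip {m : ℕ} (α β : Fin m → Bool) (h : Bool) : Prop :=
  countFrom β 0 = countFrom α 0 + h.toNat ∧
    ∀ c, countFrom α c ≤ countFrom β c ∧ countFrom β c ≤ countFrom α (c + 1) + 1

/-- Counted from the empty right end, `countFrom β c - countFrom α c` is the occupation of the edge
left of column `c`, and `countFrom β c - countFrom α (c + 1)` is the number of paths through the
vertex `c`. The inequalities of `IsStrip` make the former nonnegative and the latter at most one,
which is the condition at each vertex. Here `g` is the edge between the columns `0` and `1`. -/
theorem isStrip_succ {m : ℕ} (α β : Fin (m + 1) → Bool) (h : Bool) :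
    IsStrip α β h ↔ ∃ g : Bool, h.toNat + (α 0).toNat = (β 0).toNat + g.toNat ∧
      h.toNat + (α 0).toNat ≤ 1 ∧ IsStrip (Fin.tail α) (Fin.tail β) g := by
  have eα := countFrom_eq_add α 0
  have eβ := countFrom_eq_add β 0
  simp only [Fin.val_zero, zero_add] at eα eβ
  constructor
  · rintro ⟨h0, hs⟩
    have hs0 := hs 0
    have hs1 := hs 1
    obtain ⟨g, hg⟩ : ∃ g : Bool, countFrom β 1 = countFrom α 1 + g.toNat := by
      have hh := Bool.toNat_le h
      have ha := Bool.toNat_le (α 0)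
      have hb := Bool.toNat_le (β 0)
      by_cases hle : countFrom β 1 = countFrom α 1
      · exact ⟨false, by simpa using hle⟩
      · refine ⟨true, ?_⟩
        rw [Bool.toNat_true]
        simp only [zero_add] at hs0
        omega
    simp only [zero_add] at hs0
    refine ⟨g, by omega, by omega, ?_, fun c => ?_⟩
    · rwa [← countFrom_succ_succ, ← countFrom_succ_succ]
    · rw [← countFrom_succ_succ, ← countFrom_succ_succ, ← countFrom_succ_succ]
      exact hs (c + 1)
  · rintro ⟨g, h1, h2, h3, h4⟩
    rw [← countFrom_succ_succ, ← countFrom_succ_succ] at h3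
    simp only [zero_add] at h3
    refine ⟨by omega, fun c => ?_⟩
    rcases c with _ | c
    · simp only [zero_add]
      omega
    · have := h4 c
      rwa [← countFrom_succ_succ, ← countFrom_succ_succ, ← countFrom_succ_succ] at this

/-- The number of paths on the edge to the left of column `c`. -/
def edgeCount {m : ℕ} (α β : Fin m → Bool) (c : ℕ) : ℕ := countFrom β c - countFrom α c

-- The two boundaries determine all inner edges of a row, so at most one term of the recursive sum
-- is nonzero. The power of `t` records a blue edge leaving a vertex together with the red paths
-- through it.
open Classical in
theorem rowWeight_eq (t x : R) {m : ℕ} (σ τ : Fin m → Bool × Bool) (h : Bool × Bool) :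
    rowWeight t x σ τ h =
      if IsStrip (fun i => (σ i).1) (fun i => (τ i).1) h.1 ∧
          IsStrip (fun i => (σ i).2) (fun i => (τ i).2) h.2 then
        ∏ c : Fin m,
          x ^ (edgeCount (fun i => (σ i).1) (fun i => (τ i).1) (c + 1) +
            edgeCount (fun i => (σ i).2) (fun i => (τ i).2) (c + 1)) *
          t ^ (edgeCount (fun i => (σ i).1) (fun i => (τ i).1) (c + 1) *
            (countFrom (fun i => (τ i).2) c - countFrom (fun i => (σ i).2) (c + 1)))
      else 0 := by
  induction m generalizing h with
  | zero =>
    have hs : ∀ (α β : Fin 0 → Bool) (b : Bool), IsStrip α β b ↔ b = false := by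
      intro α β b
      cases b <;> simp [IsStrip, countFrom]
    rcases h with ⟨h₁, h₂⟩
    simp only [rowWeight, hs, Prod.mk.injEq, Finset.univ_eq_empty, Finset.prod_empty]
  | succ m ih =>
    rw [rowWeight]
    have huniq : ∀ (α β : Fin m → Bool) (g g' : Bool), IsStrip α β g → IsStrip α β g' → g = g' := by
      intro α β g g' h1 h2
      have := h1.1.symm.trans h2.1
      cases g <;> cases g' <;> simp at this ⊢
    split_ifs with hs
    · obtain ⟨⟨g₁, a1, b1, c1⟩, ⟨g₂, a2, b2, c2⟩⟩ :=
        And.intro ((isStrip_succ _ _ _).1 hs.1) ((isStrip_succ _ _ _).1 hs.2)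
      rw [Finset.sum_eq_single (g₁, g₂)]
      · rw [ih, if_pos ⟨c1, c2⟩, Fin.prod_univ_succ]
        have e1 : edgeCount (fun i => (σ i).1) (fun i => (τ i).1) 1 = g₁.toNat := by
          rw [edgeCount, countFrom_succ_succ _ 0, countFrom_succ_succ _ 0]
          have := c1.1
          omega
        have e2 : edgeCount (fun i => (σ i).2) (fun i => (τ i).2) 1 = g₂.toNat := by
          rw [edgeCount, countFrom_succ_succ _ 0, countFrom_succ_succ _ 0]
          have := c2.1
          omega
        have e3 : countFrom (fun i => (τ i).2) 0 - countFrom (fun i => (σ i).2) 1 =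
            h.2.toNat + (σ 0).2.toNat := by
          have := hs.2.1
          have := countFrom_eq_add (fun i => (σ i).2) 0
          simp only [Fin.val_zero, zero_add] at this
          omega
        congr 1
        · rw [vertexWeight, if_pos ⟨a1, b1, a2, b2⟩]
          simp only [Fin.val_zero, zero_add, e1, e2, e3]
        · refine Finset.prod_congr rfl fun c _ => ?_
          simp only [edgeCount, Fin.val_succ, countFrom_succ_succ]
          rfl
      · intro g _ hg
        rw [ih, if_neg, mul_zero]
        rintro ⟨h1, h2⟩
        exact hg (Prod.ext (huniq _ _ _ _ h1 c1) (huniq _ _ _ _ h2 c2))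
      · simp
    · refine Finset.sum_eq_zero fun g _ => ?_
      rw [ih, vertexWeight]
      split_ifs with h1 h2
      · exact absurd ⟨(isStrip_succ _ _ _).2 ⟨g.1, h1.1, h1.2.1, h2.1⟩,
          (isStrip_succ _ _ _).2 ⟨g.2, h1.2.2.1, h1.2.2.2, h2.2⟩⟩ hs
      all_goals simp

end Transfer

/-! ### Tableaux as chains of partitions -/

namespace SkewPartition

variable {S : SkewPartition} {n : ℕ}

/-- The length of the part of the row `i` filled with letters of index less than `k`, as the column
of its last cell. -/
def level (T : S.Tableau n) (k : ℕ) (i : Fin S.len) : ℕ :=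
  max (S.inner i) (Finset.univ.sup fun j : Finset.Ioc (S.inner i) (S.outer i) =>
    if (T.1 ⟨i, j⟩ : ℕ) < k then (j : ℕ) else 0)

theorem inner_le_level (T : S.Tableau n) (k : ℕ) (i : Fin S.len) : S.inner i ≤ level T k i :=
  le_max_left _ _

theorem level_le_outer (T : S.Tableau n) (k : ℕ) (i : Fin S.len) : level T k i ≤ S.outer i := by
  refine max_le (S.inner_le_outer i) (Finset.sup_le fun j _ => ?_)
  split_ifs
  · exact (Finset.mem_Ioc.1 j.2).2
  · exact Nat.zero_le _

/-- Rows increase weakly, so the cells with letters of index below `k` form an initial segment of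
the row. -/
theorem le_level_iff (T : S.Tableau n) (k : ℕ) (i : Fin S.len)
    (j : Finset.Ioc (S.inner i) (S.outer i)) : (j : ℕ) ≤ level T k i ↔ (T.1 ⟨i, j⟩ : ℕ) < k := by
  have hj := Finset.mem_Ioc.1 j.2
  constructor
  · intro h
    rcases le_max_iff.1 h with h | h
    · omega
    · obtain ⟨j', -, hj'⟩ := (Finset.le_sup_iff (show (⊥ : ℕ) < j from by
        rw [Nat.bot_eq_zero]; omega)).1 h
      split_ifs at hj' with hlt
      · have := T.2.1 ⟨i, j⟩ ⟨i, j'⟩ rfl hj'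
        exact lt_of_le_of_lt (by exact_mod_cast this) hlt
      · omega
  · intro h
    refine le_max_of_le_right ?_
    have := Finset.le_sup (f := fun j : Finset.Ioc (S.inner i) (S.outer i) =>
      if (T.1 ⟨i, j⟩ : ℕ) < k then (j : ℕ) else 0) (Finset.mem_univ j)
    simpa [h] using this

theorem level_mono (T : S.Tableau n) {k l : ℕ} (hkl : k ≤ l) (i : Fin S.len) :
    level T k i ≤ level T l i := by
  by_cases h : level T k i ≤ S.inner i
  · exact h.trans (inner_le_level T l i)
  · have hj : level T k i ∈ Finset.Ioc (S.inner i) (S.outer i) :=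
      Finset.mem_Ioc.2 ⟨not_le.1 h, level_le_outer T k i⟩
    exact (le_level_iff T l i ⟨_, hj⟩).2 (((le_level_iff T k i ⟨_, hj⟩).1 le_rfl).trans_le hkl)

/-- Column strictness: a letter of index at most `k` in row `i'` forces a letter of index less than
`k` in the same column of row `i`. -/
theorem level_interlace (T : S.Tableau n) (k : ℕ) {i i' : Fin S.len} (hi : i < i') :
    level T (k + 1) i' ≤ level T k i := by
  by_cases h : level T (k + 1) i' ≤ S.inner i
  · exact h.trans (inner_le_level T k i)
  · have hb := level_le_outer T (k + 1) i'
    have h' : level T (k + 1) i' ∈ Finset.Ioc (S.inner i') (S.outer i') :=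
      Finset.mem_Ioc.2 ⟨(S.inner_antitone hi.le).trans_lt (not_le.1 h), hb⟩
    have hj : level T (k + 1) i' ∈ Finset.Ioc (S.inner i) (S.outer i) :=
      Finset.mem_Ioc.2 ⟨not_le.1 h, hb.trans (S.outer_antitone hi.le)⟩
    have h1 := (le_level_iff T (k + 1) i' ⟨_, h'⟩).1 le_rfl
    have h2 := T.2.2 ⟨i, ⟨_, hj⟩⟩ ⟨i', ⟨_, h'⟩⟩ hi rfl
    refine (le_level_iff T k i ⟨_, hj⟩).2 ?_
    have h3 : (T.1 ⟨i, ⟨_, hj⟩⟩ : ℕ) < T.1 ⟨i', ⟨_, h'⟩⟩ := h2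
    omega

theorem level_antitone (T : S.Tableau n) (k : ℕ) : Antitone (level T k) := by
  intro i i' h
  rcases h.eq_or_lt with rfl | h
  · exact le_rfl
  · exact (level_mono T (Nat.le_succ k) i').trans (level_interlace T k h)

theorem level_zero (T : S.Tableau n) : level T 0 = S.inner := by
  ext i
  refine le_antisymm ?_ (inner_le_level T 0 i)
  by_contra h
  have hj : level T 0 i ∈ Finset.Ioc (S.inner i) (S.outer i) :=
    Finset.mem_Ioc.2 ⟨not_le.1 h, level_le_outer T 0 i⟩
  exact absurd ((le_level_iff T 0 i ⟨_, hj⟩).1 le_rfl) (Nat.not_lt_zero _)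

theorem level_last (T : S.Tableau n) : level T n = S.outer := by
  ext i
  refine le_antisymm (level_le_outer T n i) ?_
  rcases (S.inner_le_outer i).eq_or_lt with h | h
  · rw [← h]; exact inner_le_level T n i
  · exact (le_level_iff T n i ⟨S.outer i, Finset.mem_Ioc.2 ⟨h, le_rfl⟩⟩).2 (Fin.is_lt _)

end SkewPartition

/-! ### Tableaux as chains of path boundaries -/

section Chains

/-- The occupied columns of a row boundary in the window `0, …, m - 1`, where the part `p i` puts
a path in the column `p i - i + L`. -/
def pathState (L m : ℕ) {l : ℕ} (p : Fin l → ℕ) : Fin m → Bool :=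
  fun c => decide (∃ i : Fin l, p i + (L - i) = c)

variable {L m l : ℕ} {p : Fin l → ℕ}

theorem pathIndex_strictAnti (hL : l ≤ L) (hp : Antitone p) :
    StrictAnti fun i : Fin l => p i + (L - i) := by
  intro i j hij
  have h1 := hp hij.le
  have h2 : (i : ℕ) < j := hij
  have h3 := j.2
  change p j + (L - j) < p i + (L - i)
  omega

theorem countFrom_pathState (hL : l ≤ L) (hp : Antitone p) (hm : ∀ i, p i + L < m) (c : ℕ) :
    countFrom (pathState L m p) c = (Finset.univ.filter fun i : Fin l => c ≤ p i + (L - i)).card := by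
  symm
  have hlt : ∀ i, p i + (L - i) < m := fun i => by have := hm i; omega
  refine Finset.card_bij (fun i _ => ⟨p i + (L - i), hlt i⟩) ?_ ?_ ?_
  · intro i hi
    simpa [pathState] using (Finset.mem_filter.1 hi).2
  · intro i _ j _ h
    exact (pathIndex_strictAnti hL hp).injective (Fin.mk.inj h)
  · intro c' hc'
    simp only [Finset.mem_filter, Finset.mem_univ, true_and, pathState, decide_eq_true_eq] at hc'
    obtain ⟨h1, i, hi⟩ := hc'
    exact ⟨i, by simp [hi, h1], Fin.ext hi⟩

/-- Path columns decrease strictly with the row, so the paths at or beyond column `c` belong to an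
initial segment of rows. This turns counts into conditions on a single row. -/
theorem countFrom_pathState_le_iff (hL : l ≤ L) (hp : Antitone p) (hm : ∀ i, p i + L < m) (c : ℕ)
    (i : Fin l) : countFrom (pathState L m p) c ≤ i ↔ p i + (L - i) < c := by
  rw [countFrom_pathState hL hp hm]
  have hanti := pathIndex_strictAnti hL hp
  constructor
  · intro h
    by_contra hcon
    have hsub : Finset.Iic i ⊆ Finset.univ.filter fun i : Fin l => c ≤ p i + (L - i) := by
      intro i' hi'
      have : p i + (L - i) ≤ p i' + (L - i') := hanti.antitone (Finset.mem_Iic.1 hi')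
      exact Finset.mem_filter.2 ⟨Finset.mem_univ _, by omega⟩
    have := Finset.card_le_card hsub
    rw [Fin.card_Iic] at this
    omega
  · intro h
    have hsub : (Finset.univ.filter fun i : Fin l => c ≤ p i + (L - i)) ⊆ Finset.Iio i := by
      intro i' hi'
      have := (Finset.mem_filter.1 hi').2
      rw [Finset.mem_Iio]
      by_contra hcon
      have : p i' + (L - i') ≤ p i + (L - i) := hanti.antitone (not_lt.1 hcon)
      omega
    have := Finset.card_le_card hsub
    rwa [Fin.card_Iio] at this

theorem countFrom_pathState_le (hL : l ≤ L) (hp : Antitone p) (hm : ∀ i, p i + L < m) (c : ℕ) :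
    countFrom (pathState L m p) c ≤ l := by
  rw [countFrom_pathState hL hp hm]
  exact (Finset.card_filter_le _ _).trans (by simp)

theorem countFrom_le_succ {m : ℕ} (α : Fin m → Bool) (c : ℕ) :
    countFrom α c ≤ countFrom α (c + 1) + 1 := by
  by_cases h : c < m
  · have := countFrom_eq_add α ⟨c, h⟩
    have h2 := Bool.toNat_le (α ⟨c, h⟩)
    simp only at this
    omega
  · have : countFrom α c = 0 := by
      rw [countFrom, Finset.card_eq_zero, Finset.filter_eq_empty_iff]
      intro i _ hi
      have := i.2
      omega
    omega

theorem countFrom_antitone {m : ℕ} (α : Fin m → Bool) : Antitone (countFrom α) := by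
  intro c d h
  refine Finset.card_le_card fun i hi => ?_
  rw [Finset.mem_filter] at hi ⊢
  exact ⟨hi.1, by omega, hi.2.2⟩

theorem countFrom_le_add {m : ℕ} (α : Fin m → Bool) (c d : ℕ) :
    countFrom α c ≤ countFrom α (c + d) + d := by
  induction d with
  | zero => simp
  | succ d ih =>
    have := countFrom_le_succ α (c + d)
    rw [show c + (d + 1) = c + d + 1 from rfl]
    omega

theorem eq_of_countFrom_eq {m : ℕ} {α β : Fin m → Bool} (h : ∀ c, countFrom α c = countFrom β c) :
    α = β := by
  ext c
  have h1 := countFrom_eq_add α c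
  have h2 := countFrom_eq_add β c
  have h3 := h c
  have h4 := h (c + 1)
  have h5 : (α c).toNat = (β c).toNat := by omega
  cases hα : α c <;> cases hβ : β c <;> simp_all

open SkewPartition

variable {S : SkewPartition} {n : ℕ}

/-- The chain of row boundaries of a tableau. -/
def tableauChain (L m : ℕ) (T : S.Tableau n) (k : Fin (n + 1)) : Fin m → Bool :=
  pathState L m (level T k)

theorem level_add_lt (hm : ∀ i, S.outer i + L < m) (T : S.Tableau n) (k : ℕ) (i : Fin S.len) :
    level T k i + L < m := by
  have := hm i
  have := level_le_outer T k i
  omega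

theorem lt_iff_lt_countFrom (hL : S.len ≤ L) (hm : ∀ i, S.outer i + L < m) (T : S.Tableau n)
    (k : Fin (n + 1)) (v : S.Cell) :
    (T.1 v : ℕ) < k ↔ (v.1 : ℕ) < countFrom (tableauChain L m T k) (v.2 + (L - v.1)) := by
  obtain ⟨i, j⟩ := v
  rw [← le_level_iff, ← not_le (b := (i : ℕ)), tableauChain, countFrom_pathState_le_iff hL
    (level_antitone T k) (level_add_lt hm T k)]
  simp

theorem tableauChain_injective (hL : S.len ≤ L) (hm : ∀ i, S.outer i + L < m) :
    Function.Injective (tableauChain L m : S.Tableau n → Fin (n + 1) → Fin m → Bool) := by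
  intro T T' h
  have hiff : ∀ (v : S.Cell) (k : Fin (n + 1)), (T.1 v : ℕ) < k ↔ (T'.1 v : ℕ) < k := fun v k => by
    rw [lt_iff_lt_countFrom hL hm T, lt_iff_lt_countFrom hL hm T', h]
  refine Subtype.ext (funext fun v => Fin.ext ?_)
  have h1 := (hiff v ⟨T.1 v + 1, by omega⟩).1 (by simp)
  have h2 := (hiff v ⟨T'.1 v + 1, by omega⟩).2 (by simp)
  simp only at h1 h2
  omega

/-- The chains of row boundaries that come from tableaux. -/
def IsBoundaryChain (S : SkewPartition) (L : ℕ) {m n : ℕ} (g : Fin (n + 1) → Fin m → Bool) : Prop :=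
  g 0 = pathState L m S.inner ∧ g (Fin.last n) = pathState L m S.outer ∧
    ∀ k : Fin n, IsStrip (g k.castSucc) (g k.succ) false

/-- The two strip inequalities come from `level_mono` and `level_interlace`; the number of paths is
always the number of parts. -/
theorem tableauChain_isBoundaryChain (hL : S.len ≤ L) (hm : ∀ i, S.outer i + L < m)
    (T : S.Tableau n) : IsBoundaryChain S L (tableauChain L m T) := by
  refine ⟨?_, ?_, fun k => ⟨?_, fun c => ⟨?_, ?_⟩⟩⟩
  · rw [tableauChain, Fin.val_zero, level_zero]
  · rw [tableauChain, Fin.val_last, level_last]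
  all_goals
    simp only [tableauChain, Fin.val_castSucc, Fin.val_succ]
  · rw [countFrom_pathState hL (level_antitone T _) (level_add_lt hm T _),
      countFrom_pathState hL (level_antitone T _) (level_add_lt hm T _)]
    simp
  · rw [countFrom_pathState hL (level_antitone T _) (level_add_lt hm T _),
      countFrom_pathState hL (level_antitone T _) (level_add_lt hm T _)]
    refine Finset.card_le_card fun i hi => ?_
    rw [Finset.mem_filter] at hi ⊢
    have := level_mono T (show (k : ℕ) ≤ k + 1 by omega) i
    exact ⟨hi.1, by omega⟩
  -- On the lower boundary the path of row `N` is left of column `c + 1`. By interlacing, the path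
  -- of row `N + 1` on the upper boundary is left of column `c`.
  · set N := countFrom (pathState L m (level T k)) (c + 1) with hN
    have hle := countFrom_pathState_le hL (level_antitone T (k + 1)) (level_add_lt hm T (k + 1)) c
    by_cases hlen : N + 1 < S.len
    · have h1 := (countFrom_pathState_le_iff hL (level_antitone T k) (level_add_lt hm T k) (c + 1)
        ⟨N, by omega⟩).1 hN.ge
      have h2 := level_interlace T k (i := ⟨N, by omega⟩) (i' := ⟨N + 1, hlen⟩)
        (Fin.mk_lt_mk.2 (Nat.lt_succ_self N))
      refine (countFrom_pathState_le_iff hL (level_antitone T (k + 1)) (level_add_lt hm T (k + 1)) c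
        ⟨N + 1, hlen⟩).2 ?_
      simp only at h1 ⊢
      omega
    · omega

/-- The letter of a cell is the step of the chain at which the path of its row reaches the cell. As
the counts grow along the chain, it is found by counting the steps after which the cell is still not
reached. -/
theorem IsBoundaryChain.exists_tableau (hL : S.len ≤ L) (hm : ∀ i, S.outer i + L < m)
    {g : Fin (n + 1) → Fin m → Bool} (hg : IsBoundaryChain S L g) :
    ∃ T : S.Tableau n, tableauChain L m T = g := by
  obtain ⟨h0, hlast, hstrip⟩ := hg
  have hmi : ∀ i, S.inner i + L < m := fun i => by
    have := hm i
    have := S.inner_le_outer i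
    omega
  have hmono : ∀ c, Monotone fun k => countFrom (g k) c := fun c =>
    Fin.monotone_iff_le_succ.2 fun k => ((hstrip k).2 c).1
  have hlow : ∀ (i : Fin S.len) c, countFrom (g 0) c ≤ i ↔ S.inner i + (L - i) < c := fun i c => by
    rw [h0, countFrom_pathState_le_iff hL S.inner_antitone hmi]
  have hhigh : ∀ (i : Fin S.len) c, countFrom (g (Fin.last n)) c ≤ i ↔ S.outer i + (L - i) < c :=
    fun i c => by rw [hlast, countFrom_pathState_le_iff hL S.outer_antitone hm]
  set N : S.Cell → Fin (n + 1) → ℕ := fun v k => countFrom (g k) (v.2 + (L - v.1)) with hN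
  have hN0 : ∀ v, N v 0 ≤ v.1 := fun v => (hlow v.1 _).2 (by
    have := (Finset.mem_Ioc.1 v.2.2).1
    omega)
  have hNl : ∀ v, (v.1 : ℕ) < N v (Fin.last n) := fun v => by
    rw [← not_le, hN, hhigh]
    have := (Finset.mem_Ioc.1 v.2.2).2
    omega
  set f : S.Cell → ℕ := fun v => (Finset.univ.filter fun k : Fin n => N v k.succ ≤ v.1).card with hf
  have hfk : ∀ v (k : Fin (n + 1)), f v < k ↔ (v.1 : ℕ) < N v k := by
    intro v k
    have hfv : f v = (Finset.univ.filter fun k : Fin n => N v k.succ ≤ v.1).card := rfl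
    constructor
    · intro h
      by_contra hcon
      have hsub : (Finset.univ.filter fun k' : Fin n => (k' : ℕ) < k) ⊆
          Finset.univ.filter fun k : Fin n => N v k.succ ≤ v.1 := by
        intro k' hk'
        rw [Finset.mem_filter] at hk' ⊢
        refine ⟨hk'.1, le_trans (hmono _ ?_) (not_lt.1 hcon)⟩
        rw [Fin.le_def, Fin.val_succ]
        omega
      have := Finset.card_le_card hsub
      rw [Fin.card_filter_val_lt] at this
      have := k.2
      omega
    · intro h
      have hk0 : (k : ℕ) ≠ 0 := fun hk => by
        have : k = 0 := Fin.ext hk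
        rw [this] at h
        have := hN0 v
        omega
      have hsub : (Finset.univ.filter fun k : Fin n => N v k.succ ≤ v.1) ⊆
          Finset.univ.filter fun k' : Fin n => (k' : ℕ) < k - 1 := by
        intro k' hk'
        rw [Finset.mem_filter] at hk' ⊢
        refine ⟨hk'.1, ?_⟩
        by_contra hcon
        have : N v k ≤ N v k'.succ := hmono _ (by rw [Fin.le_def, Fin.val_succ]; omega)
        omega
      have := Finset.card_le_card hsub
      rw [Fin.card_filter_val_lt] at this
      omega
  have hfn : ∀ v, f v < n := fun v => by simpa using (hfk v (Fin.last n)).2 (hNl v)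
  have hss : S.IsSemistandard fun v => (⟨f v, hfn v⟩ : Fin n) := by
    constructor
    · rintro ⟨i, j⟩ ⟨i', j'⟩ hi hj
      simp only at hi hj
      subst hi
      rw [Fin.mk_le_mk]
      have hlt := hfn ⟨i, j'⟩
      have h1 := (hfk ⟨i, j'⟩ ⟨f ⟨i, j'⟩ + 1, by omega⟩).1 (by simp)
      have h2 := (hfk ⟨i, j⟩ ⟨f ⟨i, j'⟩ + 1, by omega⟩).2 (h1.trans_le
        (countFrom_antitone _ (by simp only; omega)))
      simp only at h2
      omega
    · rintro ⟨i, j⟩ ⟨i', j'⟩ hi hj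
      simp only at hi hj
      have hi' : (i : ℕ) < i' := hi
      rw [Fin.mk_lt_mk]
      have hlt := hfn ⟨i', j'⟩
      set k : Fin n := ⟨f ⟨i', j'⟩, hlt⟩ with hk
      have h1 := (hfk ⟨i', j'⟩ k.succ).1 (by simp [hk])
      -- The strip condition goes down one boundary at the cost of one column and one path. Each of
      -- the remaining `i' - i - 1` columns costs at most one more path.
      have h2 : (i : ℕ) < N ⟨i, j⟩ k.castSucc := by
        simp only [hN] at h1 ⊢
        have h3 := ((hstrip k).2 (j' + (L - i'))).2
        have h4 := countFrom_le_add (g k.castSucc) (j' + (L - i') + 1) (i' - i - 1)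
        have h5 : (j' : ℕ) + (L - i') + 1 + (i' - i - 1) = j + (L - i) := by
          have := i'.2
          omega
        rw [h5] at h4
        omega
      simpa [hk] using (hfk ⟨i, j⟩ k.castSucc).2 h2
  refine ⟨⟨_, hss⟩, funext fun k => eq_of_countFrom_eq fun c => ?_⟩
  set T : S.Tableau n := ⟨_, hss⟩ with hT
  have hanti := level_antitone T k
  have hadd := level_add_lt hm T k
  have hle1 : countFrom (tableauChain L m T k) c ≤ S.len := countFrom_pathState_le hL hanti hadd c
  have hle2 : countFrom (g k) c ≤ S.len := (hmono c (Fin.le_last k)).trans (by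
    simp only [hlast]
    exact countFrom_pathState_le hL S.outer_antitone hm c)
  have hiff : ∀ i : Fin S.len, countFrom (tableauChain L m T k) c ≤ i ↔ countFrom (g k) c ≤ i := by
    intro i
    rw [tableauChain, countFrom_pathState_le_iff hL hanti hadd]
    have l1 := inner_le_level T k i
    have l2 := level_le_outer T k i
    -- Either the path of row `i` is at or beyond column `c` from the start, or it is still short of
    -- it at the end, or `c` is the column of a cell of the row.
    rcases le_or_gt c (S.inner i + (L - i)) with hc | hc
    · have h1 : ¬ countFrom (g 0) c ≤ i := by rw [hlow]; omega
      have h2 : countFrom (g 0) c ≤ countFrom (g k) c := hmono c (Fin.zero_le k)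
      constructor <;> intro <;> omega
    rcases lt_or_ge (S.outer i + (L - i)) c with hc' | hc'
    · have h1 := (hhigh i c).2 hc'
      have h2 : countFrom (g k) c ≤ countFrom (g (Fin.last n)) c := hmono c (Fin.le_last k)
      constructor <;> intro <;> omega
    · have hj : c - (L - i) ∈ Finset.Ioc (S.inner i) (S.outer i) :=
        Finset.mem_Ioc.2 ⟨by omega, by omega⟩
      have h1 := le_level_iff T k i ⟨_, hj⟩
      have h2 := hfk ⟨i, ⟨_, hj⟩⟩ k
      have h3 : c - (L - i) + (L - (i : ℕ)) = c := by omega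
      simp only [hN, h3] at h2
      have h4 : (T.1 ⟨i, ⟨_, hj⟩⟩ : ℕ) = f ⟨i, ⟨_, hj⟩⟩ := rfl
      rw [h4, h2] at h1
      simp only at h1
      constructor <;> intro <;> omega
  by_contra hne
  rcases lt_or_gt_of_ne hne with h | h
  · have := (hiff ⟨countFrom (tableauChain L m T k) c, by omega⟩).1 le_rfl
    simp only at this
    omega
  · have := (hiff ⟨countFrom (g k) c, by omega⟩).2 le_rfl
    simp only at this
    omega

end Chains

/-! ### The LLT polynomial as a partition function -/

section LatticeLLT

open SkewPartition

variable {S : SkewPartition} {n L m : ℕ}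

/-- A cell in row `i` and column `j` with letter `k` is the unit step of the path of row `i` into
the lattice column `j + (L - i)`, taken in lattice row `k`. -/
theorem edgeCount_tableauChain (hL : S.len ≤ L) (hm : ∀ i, S.outer i + L < m) (T : S.Tableau n)
    (k : Fin n) (c : ℕ) :
    edgeCount (tableauChain L m T k.castSucc) (tableauChain L m T k.succ) c =
      (Finset.univ.filter fun v : S.Cell => T.1 v = k ∧ (v.2 : ℕ) + (L - v.1) = c).card := by
  simp only [edgeCount, tableauChain, Fin.val_castSucc, Fin.val_succ]
  rw [countFrom_pathState hL (level_antitone T _) (level_add_lt hm T _),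
    countFrom_pathState hL (level_antitone T _) (level_add_lt hm T _), ← Finset.card_sdiff_of_subset]
  · symm
    refine Finset.card_bij (fun v _ => v.1) ?_ ?_ ?_
    · rintro ⟨i, j⟩ hv
      simp only [Finset.mem_filter, Finset.mem_univ, true_and] at hv
      have h1 := le_level_iff T k i j
      have h2 := le_level_iff T (k + 1) i j
      rw [hv.1] at h1 h2
      simp only [lt_self_iff_false, iff_false, not_le, Nat.lt_succ_self, iff_true] at h1 h2
      simp only [Finset.mem_sdiff, Finset.mem_filter, Finset.mem_univ, true_and]
      omega
    · rintro ⟨i, j⟩ hv ⟨i', j'⟩ hv' h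
      simp only [Finset.mem_filter, Finset.mem_univ, true_and] at hv hv' h
      subst h
      have : j = j' := Subtype.ext (by omega)
      rw [this]
    · intro i hi
      simp only [Finset.mem_sdiff, Finset.mem_filter, Finset.mem_univ, true_and] at hi
      have l1 := inner_le_level T k i
      have l2 := level_le_outer T (k + 1) i
      have hj : c - (L - i) ∈ Finset.Ioc (S.inner i) (S.outer i) :=
        Finset.mem_Ioc.2 ⟨by omega, by omega⟩
      refine ⟨⟨i, ⟨_, hj⟩⟩, ?_, rfl⟩
      have h1 := le_level_iff T k i ⟨_, hj⟩
      have h2 := le_level_iff T (k + 1) i ⟨_, hj⟩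
      simp only at h1 h2
      have h3 := h2.1 (by omega)
      have h4 := mt h1.2 (by omega)
      simp only [Finset.mem_filter, Finset.mem_univ, true_and]
      exact ⟨Fin.ext (by omega), by omega⟩
  · intro i hi
    rw [Finset.mem_filter] at hi ⊢
    have := level_mono T (show (k : ℕ) ≤ k + 1 by omega) i
    exact ⟨hi.1, by omega⟩

/-- The number of paths of one color in column `c` of the row with index `k`. -/
theorem countFrom_sub_countFrom_tableauChain (hL : S.len ≤ L) (hm : ∀ i, S.outer i + L < m)
    (T : S.Tableau n) (k : Fin n) (c : ℕ) :
    countFrom (tableauChain L m T k.succ) c - countFrom (tableauChain L m T k.castSucc) (c + 1) =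
      (Finset.univ.filter fun r : Fin S.len =>
        level T k r + (L - r) ≤ c ∧ c ≤ level T (k + 1) r + (L - r)).card := by
  simp only [tableauChain, Fin.val_castSucc, Fin.val_succ]
  rw [countFrom_pathState hL (level_antitone T _) (level_add_lt hm T _),
    countFrom_pathState hL (level_antitone T _) (level_add_lt hm T _), ← Finset.card_sdiff_of_subset]
  · congr 1
    ext r
    simp only [Finset.mem_sdiff, Finset.mem_filter, Finset.mem_univ, true_and]
    omega
  · intro i hi
    rw [Finset.mem_filter] at hi ⊢
    have := level_mono T (show (k : ℕ) ≤ k + 1 by omega) i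
    exact ⟨hi.1, by omega⟩

/-- A product over the cells, collected by the letter and by the content of the cell. -/
theorem prod_cells_eq {M : Type*} [CommMonoid M] (hm : ∀ i, S.outer i + L < m) (T : S.Tableau n)
    (F : S.Cell → M) :
    ∏ k : Fin n, ∏ c : Fin m, ∏ v ∈ Finset.univ.filter (fun v : S.Cell =>
      T.1 v = k ∧ (v.2 : ℕ) + (L - v.1) = c + 1), F v = ∏ v, F v := by
  have hlt : ∀ v : S.Cell, (v.2 : ℕ) + (L - v.1) - 1 < m := fun v => by
    have := hm v.1
    have := Finset.mem_Ioc.1 v.2.2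
    omega
  rw [← Finset.prod_fiberwise (s := Finset.univ)
    (g := fun v : S.Cell => ((T.1 v, ⟨_, hlt v⟩) : Fin n × Fin m)), Fintype.prod_prod_type]
  refine Finset.prod_congr rfl fun k _ => Finset.prod_congr rfl fun c _ => ?_
  refine Finset.prod_congr ?_ fun _ _ => rfl
  ext v
  have := Finset.mem_Ioc.1 v.2.2
  simp only [Finset.mem_filter, Finset.mem_univ, true_and, Prod.mk.injEq, Fin.ext_iff]
  omega

/-- The values `0` and `∞` outside the shape agree with the bounds of `level` by `inner` and
`outer`. So each half of the coinversion condition is one uniform inequality on levels, here and in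
`le_entryOrTop_iff`. -/
theorem entryOrZero_le_iff (T : S.Tableau n) (r : Fin S.len) {j : ℕ} (hj : S.inner r ≤ j)
    (hj' : j ≤ S.outer r) (k : Fin n) :
    entryOrZero T r j ≤ (((k : ℕ) + 1 : ℕ) : ℕ∞) ↔ j ≤ level T (k + 1) r := by
  rw [entryOrZero]
  split_ifs with h
  · rw [Nat.cast_le, ← Nat.lt_succ_iff, Nat.succ_eq_add_one, add_lt_add_iff_right]
    exact (le_level_iff T (k + 1) r ⟨j, h⟩).symm
  · have : j = S.inner r := by
      rw [Finset.mem_Ioc] at h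
      omega
    have := inner_le_level T (k + 1) r
    simp only [zero_le, true_iff]
    omega

theorem le_entryOrTop_iff (T : S.Tableau n) (r : Fin S.len) {j : ℕ} (hj : S.inner r ≤ j)
    (hj' : j ≤ S.outer r) (k : Fin n) :
    (((k : ℕ) + 1 : ℕ) : ℕ∞) ≤ entryOrTop T r (j + 1) ↔ level T k r ≤ j := by
  rw [entryOrTop]
  split_ifs with h
  · rw [Nat.cast_le, add_le_add_iff_right]
    have := le_level_iff T k r ⟨j + 1, h⟩
    simp only at this
    omega
  · have : j = S.outer r := by
      rw [Finset.mem_Ioc] at h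
      omega
    have := level_le_outer T k r
    simp only [le_top, true_iff]
    omega

/-- The number of coinversions of a pair of tableaux, counted by the cells of the first one. -/
def pairCoinv (L : ℕ) {S₁ S₂ : SkewPartition} (T₁ : S₁.Tableau n) (T₂ : S₂.Tableau n) : ℕ :=
  ∑ v : S₁.Cell, (Finset.univ.filter fun r : Fin S₂.len =>
    level T₂ (T₁.1 v) r + (L - r) ≤ (v.2 : ℕ) + (L - v.1) - 1 ∧
      (v.2 : ℕ) + (L - v.1) - 1 ≤ level T₂ (T₁.1 v + 1) r + (L - r)).card

/-- The condition `a ≤ b ≤ c` says that the path of row `r` passes through the column of `u` in the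
lattice row of the letter `b`. Equality of contents identifies this column with `v.2 + (L - v.1) -
1`, the one from which the step of `v` starts. -/
theorem coinv_pair (S₁ S₂ : SkewPartition) (hL₁ : S₁.len ≤ L) (hL₂ : S₂.len ≤ L)
    (T : TableauTuple ![S₁, S₂] n) : coinv T = pairCoinv (S₁ := S₁) (S₂ := S₂) L (T 0) (T 1) := by
  classical
  change coinv T = ∑ v : S₁.Cell, (Finset.univ.filter fun r : Fin S₂.len =>
      level (S := S₂) (T 1) ((T 0).1 v : ℕ) r + (L - r) ≤ (v.2 : ℕ) + (L - v.1) - 1 ∧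
        (v.2 : ℕ) + (L - v.1) - 1 ≤ level (S := S₂) (T 1) (((T 0).1 v : ℕ) + 1) r + (L - r)).card
  rw [← Finset.card_sigma, coinv]
  symm
  have hmem : ∀ (v : S₁.Cell) (r : Fin S₂.len),
      level (S := S₂) (T 1) ((T 0).1 v : ℕ) r + (L - r) ≤ (v.2 : ℕ) + (L - v.1) - 1 ∧
        (v.2 : ℕ) + (L - v.1) - 1 ≤ level (S := S₂) (T 1) (((T 0).1 v : ℕ) + 1) r + (L - r) →
      (v.2 : ℕ) + (L - v.1) - 1 - (L - r) ∈ Finset.Icc (S₂.inner r) (S₂.outer r) := by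
    intro v r h
    have h1 := inner_le_level (S := S₂) (T 1) ((T 0).1 v : ℕ) r
    have h2 := level_le_outer (S := S₂) (T 1) (((T 0).1 v : ℕ) + 1) r
    rw [Finset.mem_Icc]
    omega
  refine Finset.card_bij (fun x hx => (⟨0, 1, x.1, ⟨x.2, ⟨_, hmem x.1 x.2
    (Finset.mem_filter.1 (Finset.mem_sigma.1 hx).2).2⟩⟩⟩ : TripleData ![S₁, S₂])) ?_ ?_ ?_
  · rintro ⟨v, r⟩ hx
    have hx' := (Finset.mem_filter.1 (Finset.mem_sigma.1 hx).2).2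
    have hI := Finset.mem_Icc.1 (hmem v r hx')
    have hv := Finset.mem_Ioc.1 v.2.2
    have hv1 := v.1.2
    have hr := r.2
    refine Finset.mem_filter.2 ⟨Finset.mem_univ _, ⟨Fin.zero_lt_one, ?_⟩, ?_, ?_⟩
    · simp only [content] at hx' hI ⊢
      change ((v.2 : ℕ) : ℤ) - (((v.1 : ℕ) : ℤ) + 1) = _ - (((r : ℕ) : ℤ) + 1)
      omega
    · refine (entryOrZero_le_iff (S := S₂) (T 1) r hI.1 hI.2 ((T 0).1 v)).2 ?_
      simp only at hx'
      omega
    · refine (le_entryOrTop_iff (S := S₂) (T 1) r hI.1 hI.2 ((T 0).1 v)).2 ?_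
      simp only at hx'
      omega
  · rintro ⟨v, r⟩ hx ⟨v', r'⟩ hx' h
    simp only [Sigma.mk.injEq, heq_eq_eq, true_and] at h
    obtain ⟨rfl, rfl, -⟩ := h
    rfl
  · rintro ⟨p, q, v, r, j⟩ hx
    obtain ⟨-, ⟨hpq, hc⟩, h1, h2⟩ := Finset.mem_filter.1 hx
    obtain ⟨rfl, rfl⟩ : p = 0 ∧ q = 1 := by
      revert hpq; clear * -; revert p q; decide
    have hI := Finset.mem_Icc.1 j.2
    have hv := Finset.mem_Ioc.1 v.2.2
    have hv1 : (v.1 : ℕ) < S₁.len := v.1.2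
    have hr : (r : ℕ) < S₂.len := r.2
    have e1 := (entryOrZero_le_iff (S := S₂) (T 1) r hI.1 hI.2 ((T 0).1 v)).1 h1
    have e2 := (le_entryOrTop_iff (S := S₂) (T 1) r hI.1 hI.2 ((T 0).1 v)).1 h2
    have hc' : ((v.2 : ℕ) : ℤ) - (((v.1 : ℕ) : ℤ) + 1) =
        (((j : ℕ) + 1 : ℕ) : ℤ) - (((r : ℕ) : ℤ) + 1) := hc
    have hjj : (v.2 : ℕ) + (L - (v.1 : ℕ)) - 1 = (j : ℕ) + (L - (r : ℕ)) := by omega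
    refine ⟨⟨v, r⟩, Finset.mem_sigma.2 ⟨Finset.mem_univ _, Finset.mem_filter.2
      ⟨Finset.mem_univ _, ?_, ?_⟩⟩, ?_⟩
    · rw [hjj]; exact Nat.add_le_add_right e2 _
    · rw [hjj]; exact Nat.add_le_add_right e1 _
    · have hsub : ∀ (x : ℕ) (hx : x ∈ Finset.Icc (S₂.inner r) (S₂.outer r)), x = (j : ℕ) →
          (⟨x, hx⟩ : Finset.Icc (S₂.inner r) (S₂.outer r)) = j := fun x hx h => Subtype.ext h
      have hj := hsub _ (hmem v r ⟨by rw [hjj]; exact Nat.add_le_add_right e2 _,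
        by rw [hjj]; exact Nat.add_le_add_right e1 _⟩) (by rw [hjj, Nat.add_sub_cancel])
      exact congrArg (fun y : Finset.Icc (S₂.inner r) (S₂.outer r) =>
        (⟨0, 1, v, ⟨r, y⟩⟩ : TripleData ![S₁, S₂])) hj

/-- The boundary of the two-colored lattice given by two sequences of parts. -/
def pairState (L m : ℕ) {l₁ l₂ : ℕ} (p₁ : Fin l₁ → ℕ) (p₂ : Fin l₂ → ℕ) : Fin m → Bool × Bool :=
  fun c => (pathState L m p₁ c, pathState L m p₂ c)

/-- The weight of the lattice configuration of a pair of tableaux. -/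
theorem prod_rowMatrix_tableauChain {R : Type*} [CommRing R] (t : R) (x : Fin n → R)
    {S₁ S₂ : SkewPartition} (hL₁ : S₁.len ≤ L)
    (hL₂ : S₂.len ≤ L) (hm₁ : ∀ i, S₁.outer i + L < m) (hm₂ : ∀ i, S₂.outer i + L < m)
    (T₁ : S₁.Tableau n) (T₂ : S₂.Tableau n) :
    ∏ k : Fin n, rowMatrix t m (x k)
        (fun c => (tableauChain L m T₁ k.castSucc c, tableauChain L m T₂ k.castSucc c))
        (fun c => (tableauChain L m T₁ k.succ c, tableauChain L m T₂ k.succ c)) =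
      t ^ pairCoinv L T₁ T₂ * ((∏ v, x (T₁.1 v)) * ∏ v, x (T₂.1 v)) := by
  classical
  have c1 := (tableauChain_isBoundaryChain hL₁ hm₁ T₁).2.2
  have c2 := (tableauChain_isBoundaryChain hL₂ hm₂ T₂).2.2
  have hrow : ∀ k : Fin n, rowMatrix t m (x k)
        (fun c => (tableauChain L m T₁ k.castSucc c, tableauChain L m T₂ k.castSucc c))
        (fun c => (tableauChain L m T₁ k.succ c, tableauChain L m T₂ k.succ c)) =
      ∏ c : Fin m,
        ((∏ v ∈ Finset.univ.filter (fun v : S₁.Cell =>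
            T₁.1 v = k ∧ (v.2 : ℕ) + (L - v.1) = c + 1), x (T₁.1 v)) *
          (∏ v ∈ Finset.univ.filter (fun v : S₂.Cell =>
            T₂.1 v = k ∧ (v.2 : ℕ) + (L - v.1) = c + 1), x (T₂.1 v))) *
        ∏ v ∈ Finset.univ.filter (fun v : S₁.Cell =>
            T₁.1 v = k ∧ (v.2 : ℕ) + (L - v.1) = c + 1),
          t ^ (Finset.univ.filter fun r : Fin S₂.len =>
            level T₂ (T₁.1 v) r + (L - r) ≤ (v.2 : ℕ) + (L - v.1) - 1 ∧
            (v.2 : ℕ) + (L - v.1) - 1 ≤ level T₂ (T₁.1 v + 1) r + (L - r)).card := by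
    intro k
    rw [rowMatrix, rowWeight_eq, if_pos ⟨c1 k, c2 k⟩]
    refine Finset.prod_congr rfl fun c _ => ?_
    change x k ^ (edgeCount (tableauChain L m T₁ k.castSucc) (tableauChain L m T₁ k.succ) (c + 1) +
        edgeCount (tableauChain L m T₂ k.castSucc) (tableauChain L m T₂ k.succ) (c + 1)) *
      t ^ (edgeCount (tableauChain L m T₁ k.castSucc) (tableauChain L m T₁ k.succ) (c + 1) *
        (countFrom (tableauChain L m T₂ k.succ) c -
          countFrom (tableauChain L m T₂ k.castSucc) (c + 1))) = _
    rw [edgeCount_tableauChain hL₁ hm₁, edgeCount_tableauChain hL₂ hm₂,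
      countFrom_sub_countFrom_tableauChain hL₂ hm₂, pow_add]
    congr 1
    · congr 1
      · rw [Finset.prod_congr rfl (g := fun _ => x k)
          (fun v hv => by rw [(Finset.mem_filter.1 hv).2.1]), Finset.prod_const]
      · rw [Finset.prod_congr rfl (g := fun _ => x k)
          (fun v hv => by rw [(Finset.mem_filter.1 hv).2.1]), Finset.prod_const]
    · rw [mul_comm, pow_mul, ← Finset.prod_const]
      refine Finset.prod_congr rfl fun v hv => ?_
      obtain ⟨-, hv1, hv2⟩ := Finset.mem_filter.1 hv
      rw [hv1, hv2, Nat.add_sub_cancel]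
  rw [Finset.prod_congr rfl fun k _ => hrow k]
  simp only [Finset.prod_mul_distrib]
  rw [prod_cells_eq hm₁ T₁, prod_cells_eq hm₂ T₂, prod_cells_eq hm₁ T₁,
    Finset.prod_pow_eq_pow_sum, mul_comm, pairCoinv]

/-- The coinversion LLT polynomial of a pair is a partition function of the lattice model. -/
theorem coinvLLT_pair_eq_latticeZ (S₁ S₂ : SkewPartition) (n : ℕ) (hL₁ : S₁.len ≤ L)
    (hL₂ : S₂.len ≤ L) (hm₁ : ∀ i, S₁.outer i + L < m) (hm₂ : ∀ i, S₂.outer i + L < m) :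
    coinvLLT ![S₁, S₂] n =
      latticeZ (MvPolynomial.C (LaurentPolynomial.T 1)) m MvPolynomial.X
        (pairState L m S₁.inner S₂.inner) (pairState L m S₁.outer S₂.outer) := by
  classical
  rw [latticeZ, Matrix.list_ofFn_prod_apply, coinvLLT]
  set t : MvPolynomial (Fin n) (LaurentPolynomial ℤ) := MvPolynomial.C (LaurentPolynomial.T 1)
    with ht
  refine Finset.sum_of_injOn
    (fun T k c => (tableauChain L m (S := S₁) (T 0) k c, tableauChain L m (S := S₂) (T 1) k c))
    ?_ (fun _ _ => Finset.mem_coe.2 (Finset.mem_univ _)) ?_ ?_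
  · intro T _ T' _ h
    have h1 : ∀ k c, tableauChain L m (S := S₁) (T 0) k c = tableauChain L m (S := S₁) (T' 0) k c :=
      fun k c => congrArg Prod.fst (congrFun (congrFun h k) c)
    have h2 : ∀ k c, tableauChain L m (S := S₂) (T 1) k c = tableauChain L m (S := S₂) (T' 1) k c :=
      fun k c => congrArg Prod.snd (congrFun (congrFun h k) c)
    have e1 := tableauChain_injective hL₁ hm₁ (funext fun k => funext fun c => h1 k c)
    have e2 := tableauChain_injective hL₂ hm₂ (funext fun k => funext fun c => h2 k c)
    funext p
    fin_cases p
    · exact e1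
    · exact e2
  · intro g _ hg
    split_ifs with hb
    · by_contra hne
      apply hg
      -- A nonzero weight forces the strip conditions for both colors in every row, so the chain
      -- comes from a pair of tableaux.
      have hstrip : ∀ k : Fin n,
          IsStrip (fun i => (g k.castSucc i).1) (fun i => (g k.succ i).1) false ∧
          IsStrip (fun i => (g k.castSucc i).2) (fun i => (g k.succ i).2) false := by
        intro k
        have hk : rowMatrix t m (MvPolynomial.X k) (g k.castSucc) (g k.succ) ≠ 0 := fun h =>
          hne (Finset.prod_eq_zero (Finset.mem_univ k) h)
        rw [rowMatrix, rowWeight_eq] at hk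
        by_contra hcon
        exact hk (if_neg hcon)
      obtain ⟨T₁, hT₁⟩ := IsBoundaryChain.exists_tableau hL₁ hm₁
        (g := fun k i => (g k i).1) ⟨by
          funext c
          simp only [hb.1, pairState], by
          funext c
          simp only [hb.2, pairState], fun k => (hstrip k).1⟩
      obtain ⟨T₂, hT₂⟩ := IsBoundaryChain.exists_tableau hL₂ hm₂
        (g := fun k i => (g k i).2) ⟨by
          funext c
          simp only [hb.1, pairState], by
          funext c
          simp only [hb.2, pairState], fun k => (hstrip k).2⟩
      refine ⟨fun p => match p with
        | 0 => T₁
        | 1 => T₂, Finset.mem_coe.2 (Finset.mem_univ _), ?_⟩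
      funext k c
      exact Prod.ext (congrFun (congrFun hT₁ k) c) (congrFun (congrFun hT₂ k) c)
    · rfl
  · intro T _
    obtain ⟨a1, b1, -⟩ := tableauChain_isBoundaryChain (S := S₁) hL₁ hm₁ (T 0)
    obtain ⟨a2, b2, -⟩ := tableauChain_isBoundaryChain (S := S₂) hL₂ hm₂ (T 1)
    rw [if_pos ⟨funext fun c => Prod.ext (congrFun a1 c) (congrFun a2 c),
      funext fun c => Prod.ext (congrFun b1 c) (congrFun b2 c)⟩, Fin.prod_univ_two,
      coinv_pair S₁ S₂ hL₁ hL₂ T]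
    refine Eq.trans ?_
      (prod_rowMatrix_tableauChain t MvPolynomial.X hL₁ hL₂ hm₁ hm₂ (T 0) (T 1)).symm
    congr 1
    rw [ht, ← map_pow, LaurentPolynomial.T_pow, mul_one]

end LatticeLLT

/-! ### Beads, their order along the boundary and colored boundaries -/

namespace Bead

/-- The finite set of beads of a pair of skew partitions. -/
def beadSet (S₁ S₂ : SkewPartition) : Finset Bead :=
  ((pathCols S₁ .top \ pathCols S₂ .top).image (Bead.mk .top .blue) ∪
    (pathCols S₂ .top \ pathCols S₁ .top).image (Bead.mk .top .red)) ∪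
  ((pathCols S₁ .bottom \ pathCols S₂ .bottom).image (Bead.mk .bottom .blue) ∪
    (pathCols S₂ .bottom \ pathCols S₁ .bottom).image (Bead.mk .bottom .red))

variable {S₁ S₂ : SkewPartition} {L m : ℕ}

theorem mem_beadSet {b : Bead} : b ∈ beadSet S₁ S₂ ↔ IsBead S₁ S₂ b := by
  obtain ⟨row, color, col⟩ := b
  cases row <;> cases color <;> simp [beadSet, IsBead]

theorem eq_of_row_eq_of_col_eq {b c : Bead} (hb : b ∈ beadSet S₁ S₂) (hc : c ∈ beadSet S₁ S₂)
    (hrow : b.row = c.row) (hcol : b.col = c.col) : b = c := by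
  rw [mem_beadSet] at hb hc
  obtain ⟨r, k, x⟩ := b
  obtain ⟨r', k', x'⟩ := c
  simp only at hrow hcol
  subst hrow hcol
  cases k <;> cases k' <;> simp only [IsBead] at hb hc <;> first | rfl | tauto

/-- All columns of paths, shifted by `L`, lie in the window `0, …, m - 1`. -/
structure IsWindow (S₁ S₂ : SkewPartition) (L m : ℕ) : Prop where
  len₁ : S₁.len ≤ L
  len₂ : S₂.len ≤ L
  outer₁ : ∀ i, S₁.outer i + L < m
  outer₂ : ∀ i, S₂.outer i + L < m

theorem exists_isWindow (S₁ S₂ : SkewPartition) : ∃ L m, IsWindow S₁ S₂ L m := by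
  refine ⟨S₁.len + S₂.len, ∑ i, S₁.outer i + ∑ i, S₂.outer i + (S₁.len + S₂.len) + 1,
    by omega, by omega, fun i => ?_, fun i => ?_⟩
  · have := Finset.single_le_sum (f := S₁.outer) (fun _ _ => Nat.zero_le _) (Finset.mem_univ i)
    omega
  · have := Finset.single_le_sum (f := S₂.outer) (fun _ _ => Nat.zero_le _) (Finset.mem_univ i)
    omega

theorem pathCols_bounds {S : SkewPartition} (hL : S.len ≤ L) (hm : ∀ i, S.outer i + L < m)
    {row : BeadRow} {x : ℤ} (hx : x ∈ pathCols S row) : 0 ≤ x + L ∧ x + L < m := by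
  cases row <;> simp only [pathCols, Finset.mem_image, Finset.mem_univ, true_and] at hx <;>
    obtain ⟨i, rfl⟩ := hx
  · have := hm i
    have := i.2
    omega
  · have := hm i
    have := S.inner_le_outer i
    have := i.2
    omega

theorem IsWindow.bounds (hw : IsWindow S₁ S₂ L m) {b : Bead} (hb : b ∈ beadSet S₁ S₂) :
    0 ≤ b.col + L ∧ b.col + L < m := by
  rw [mem_beadSet] at hb
  obtain ⟨r, k, x⟩ := b
  cases k <;> simp only [IsBead] at hb
  · exact pathCols_bounds hw.len₁ hw.outer₁ hb.1
  · exact pathCols_bounds hw.len₂ hw.outer₂ hb.1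

/-- The occupied columns of a boundary, in the window. -/
def occupied (S : SkewPartition) (L : ℕ) {m : ℕ} (row : BeadRow) (c : Fin m) : Bool :=
  decide ((c : ℤ) - L ∈ pathCols S row)

theorem pathState_inner {S : SkewPartition} (hL : S.len ≤ L) :
    pathState L m S.inner = occupied S L .bottom := by
  funext c
  simp only [pathState, occupied, pathCols, Finset.mem_image, Finset.mem_univ, true_and,
    decide_eq_decide]
  refine exists_congr fun i => ?_
  have := i.2
  omega

theorem pathState_outer {S : SkewPartition} (hL : S.len ≤ L) :
    pathState L m S.outer = occupied S L .top := by
  funext c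
  simp only [pathState, occupied, pathCols, Finset.mem_image, Finset.mem_univ, true_and,
    decide_eq_decide]
  refine exists_congr fun i => ?_
  have := i.2
  omega

/-- The path end in the column `c` of the window, which is red if there is no blue one. -/
def beadAt (S₁ : SkewPartition) (L : ℕ) {m : ℕ} (row : BeadRow) (c : Fin m) : Bead :=
  ⟨row, if (c : ℤ) - L ∈ pathCols S₁ row then .blue else .red, (c : ℤ) - L⟩

theorem beadAt_injective (row : BeadRow) :
    Function.Injective (beadAt S₁ L row : Fin m → Bead) := by
  intro c c' h
  have : (c : ℤ) - L = c' - L := congrArg Bead.col h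
  exact Fin.ext (by omega)

theorem beadAt_mem_iff {row : BeadRow} {c : Fin m} :
    beadAt S₁ L row c ∈ beadSet S₁ S₂ ↔ occupied S₁ L row c ≠ occupied S₂ L row c := by
  rw [mem_beadSet, beadAt, occupied, occupied]
  by_cases h : (c : ℤ) - L ∈ pathCols S₁ row <;> by_cases h' : (c : ℤ) - L ∈ pathCols S₂ row <;>
    simp [IsBead, h, h']

theorem IsWindow.exists_beadAt (hw : IsWindow S₁ S₂ L m) {b : Bead} (hb : b ∈ beadSet S₁ S₂) :
    ∃ c : Fin m, beadAt S₁ L b.row c = b := by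
  obtain ⟨h1, h2⟩ := hw.bounds hb
  have hc : (((b.col + L).toNat : ℕ) : ℤ) - L = b.col := by omega
  refine ⟨⟨(b.col + L).toNat, by omega⟩, ?_⟩
  rw [mem_beadSet] at hb
  obtain ⟨r, k, x⟩ := b
  simp only at hc
  simp only [beadAt, hc]
  cases k <;> simp only [IsBead] at hb <;> simp [hb]

/-- The boundary in the given row whose beads are colored by `P`: the beads of `P` are blue in the
bottom row and red in the top row. -/
def rowState (S₁ S₂ : SkewPartition) (L : ℕ) {m : ℕ} (row : BeadRow) (P : Finset Bead) (c : Fin m) :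
    Bool × Bool :=
  if beadAt S₁ L row c ∈ beadSet S₁ S₂ then
    if (beadAt S₁ L row c ∈ P ↔ row = .bottom) then (true, false) else (false, true)
  else (occupied S₁ L row c, occupied S₂ L row c)

theorem rowState_erase_of_ne {row row' : BeadRow} (h : row ≠ row') (P : Finset Bead) (i : Fin m) :
    (rowState S₁ S₂ L row (P.erase (beadAt S₁ L row' i)) : Fin m → Bool × Bool) =
      rowState S₁ S₂ L row P := by
  funext c
  have hne : beadAt S₁ L row c ≠ beadAt S₁ L row' i := fun e => h (congrArg Bead.row e)
  simp [rowState, Finset.mem_erase, hne]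

/-- The color convention of `rowState` is opposite in the two rows exactly so that a flip, blue to
red below or red to blue above, always removes one bead from `P`. -/
theorem rowState_erase {row : BeadRow} {P : Finset Bead} {i : Fin m}
    (hi : beadAt S₁ L row i ∈ beadSet S₁ S₂) :
    (rowState S₁ S₂ L row (P.erase (beadAt S₁ L row i)) : Fin m → Bool × Bool) =
      Function.update (rowState S₁ S₂ L row P) i
        (if row = .bottom then (false, true) else (true, false)) := by
  funext c
  by_cases hc : c = i
  · subst hc
    cases row <;> simp [rowState, hi]
  · have hne : beadAt S₁ L row c ≠ beadAt S₁ L row i := fun e => hc (beadAt_injective row e)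
    rw [Function.update_of_ne hc]
    simp [rowState, Finset.mem_erase, hne]

theorem rowState_bottom_eq_iff {P : Finset Bead} (hP : P ⊆ beadSet S₁ S₂) (i : Fin m) :
    rowState S₁ S₂ L .bottom P i = (true, false) ↔ beadAt S₁ L .bottom i ∈ P := by
  by_cases h : beadAt S₁ L .bottom i ∈ beadSet S₁ S₂
  · by_cases h' : beadAt S₁ L .bottom i ∈ P <;> simp [rowState, h, h']
  · have h' : beadAt S₁ L .bottom i ∉ P := fun e => h (hP e)
    have h'' := h
    rw [beadAt_mem_iff, not_not] at h''
    simp only [rowState, if_neg h, h', h'', iff_false, Prod.mk.injEq, not_and]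
    intro e
    simp [e]

theorem rowState_top_eq_iff {P : Finset Bead} (hP : P ⊆ beadSet S₁ S₂) (i : Fin m) :
    rowState S₁ S₂ L .top P i = (false, true) ↔ beadAt S₁ L .top i ∈ P := by
  by_cases h : beadAt S₁ L .top i ∈ beadSet S₁ S₂
  · by_cases h' : beadAt S₁ L .top i ∈ P <;> simp [rowState, h, h']
  · have h' : beadAt S₁ L .top i ∉ P := fun e => h (hP e)
    have h'' := h
    rw [beadAt_mem_iff, not_not] at h''
    simp only [rowState, if_neg h, h', h'', iff_false, Prod.mk.injEq, not_and]
    intro e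
    simp [e]

/-- The position of a bead on the boundary of the strip: first the bottom row from left to right,
then the top row from right to left. -/
def pos (K : ℤ) (b : Bead) : ℤ :=
  match b.row with
  | .bottom => b.col - K
  | .top => K - b.col

/-- Inside the window bottom beads have negative and top beads positive position, so the rows do not
interleave. -/
theorem IsWindow.pos_injOn (hw : IsWindow S₁ S₂ L m) : Set.InjOn (pos m) (beadSet S₁ S₂) := by
  intro b hb c hc h
  rw [Finset.mem_coe] at hb hc
  have h1 := hw.bounds hb
  have h2 := hw.bounds hc
  have : b.row = c.row ∧ b.col = c.col := by
    revert h h1 h2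
    obtain ⟨r, k, x⟩ := b
    obtain ⟨r', k', x'⟩ := c
    cases r <;> cases r' <;> simp only [pos] <;> intro h h1 h2 <;> simp <;> omega
  exact eq_of_row_eq_of_col_eq hb hc this.1 this.2

theorem IsWindow.before_iff (hw : IsWindow S₁ S₂ L m) {b c : Bead} (hb : b ∈ beadSet S₁ S₂)
    (hc : c ∈ beadSet S₁ S₂) : Before b c ↔ pos m c < pos m b := by
  have h1 := hw.bounds hb
  have h2 := hw.bounds hc
  revert h1 h2
  obtain ⟨r, k, x⟩ := b
  obtain ⟨r', k', x'⟩ := c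
  cases r <;> cases r' <;> simp only [pos, Before] <;> intro h1 h2 <;> simp <;> omega

/-- The number of beads to the right of a bead in its row. -/
def beadsRight (S₁ S₂ : SkewPartition) (b : Bead) : ℕ :=
  ((beadSet S₁ S₂).filter fun j => j.row = b.row ∧ b.col < j.col).card

/-- The number of columns with two paths to the right of a bead in its row. -/
def doublesRight (S₁ S₂ : SkewPartition) (b : Bead) : ℕ :=
  ((pathCols S₁ b.row ∩ pathCols S₂ b.row).filter fun x => b.col < x).card

/-- A column with two paths counts twice in the label and carries no bead. -/
theorem label_eq (S₁ S₂ : SkewPartition) (b : Bead) :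
    label S₁ S₂ b = beadsRight S₁ S₂ b + 2 * doublesRight S₁ S₂ b := by
  set A := (pathCols S₁ b.row).filter fun i => b.col < i with hA
  set C := (pathCols S₂ b.row).filter fun i => b.col < i with hC
  have h1 : doublesRight S₁ S₂ b = (A ∩ C).card := by
    rw [doublesRight, hA, hC, ← Finset.filter_inter_distrib]
  have h2 : beadsRight S₁ S₂ b = (A \ C ∪ C \ A).card := by
    refine Finset.card_bij (fun j _ => j.col) ?_ ?_ ?_
    · rintro ⟨r, k, x⟩ hj
      simp only [Finset.mem_filter, mem_beadSet] at hj
      obtain ⟨h1, rfl, h2⟩ := hj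
      cases k <;> simp only [IsBead] at h1 <;> simp [hA, hC, h1, h2]
    · intro j hj j' hj' h
      rw [Finset.mem_filter] at hj hj'
      exact eq_of_row_eq_of_col_eq hj.1 hj'.1 (hj.2.1.trans hj'.2.1.symm) h
    · intro x hx
      simp only [hA, hC, Finset.mem_union, Finset.mem_sdiff, Finset.mem_filter] at hx
      rcases hx with h | h
      · refine ⟨⟨b.row, .blue, x⟩, ?_, rfl⟩
        simp only [Finset.mem_filter, mem_beadSet, IsBead]
        tauto
      · refine ⟨⟨b.row, .red, x⟩, ?_, rfl⟩
        simp only [Finset.mem_filter, mem_beadSet, IsBead]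
        tauto
  have h3 : (A \ C ∪ C \ A).card = (A \ C).card + (C \ A).card :=
    Finset.card_union_of_disjoint (Finset.disjoint_left.2 fun x h h' => by
      rw [Finset.mem_sdiff] at h h'; tauto)
  have h4 := Finset.card_sdiff_add_card_inter A C
  have h5 := Finset.card_sdiff_add_card_inter C A
  rw [Finset.inter_comm C A] at h5
  have h6 : label S₁ S₂ b = (A.card : ℤ) + C.card := rfl
  rw [h6, h1, h2, h3]
  omega

/-- Counting columns of the window by beads. -/
theorem IsWindow.card_filter_beadAt (hw : IsWindow S₁ S₂ L m) (row : BeadRow) (i : Fin m)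
    (p : Bead → Prop) [DecidablePred p] :
    ((Finset.Ioi i).filter fun j => beadAt S₁ L row j ∈ beadSet S₁ S₂ ∧ p (beadAt S₁ L row j)).card =
      ((beadSet S₁ S₂).filter fun b => (b.row = row ∧ (i : ℤ) - L < b.col) ∧ p b).card := by
  refine Finset.card_bij (fun j _ => beadAt S₁ L row j) ?_ ?_ ?_
  · intro j hj
    simp only [Finset.mem_filter, Finset.mem_Ioi] at hj ⊢
    have h : (i : ℕ) < j := hj.1
    refine ⟨hj.2.1, ⟨rfl, ?_⟩, hj.2.2⟩
    simp only [beadAt]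
    omega
  · intro j _ j' _ h
    exact beadAt_injective row h
  · intro b hb
    simp only [Finset.mem_filter] at hb
    obtain ⟨hb, ⟨rfl, hlt⟩, hp⟩ := hb
    obtain ⟨c, hc⟩ := hw.exists_beadAt hb
    refine ⟨c, ?_, hc⟩
    simp only [Finset.mem_filter, Finset.mem_Ioi]
    refine ⟨?_, by rwa [hc], by rwa [hc]⟩
    have : (c : ℤ) - L = b.col := congrArg Bead.col hc
    rw [Fin.lt_def]
    omega

theorem IsWindow.card_filter_double (hw : IsWindow S₁ S₂ L m) (row : BeadRow) (i : Fin m) :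
    ((Finset.Ioi i).filter fun j => beadAt S₁ L row j ∉ beadSet S₁ S₂ ∧
      occupied S₂ L row j = true).card = doublesRight S₁ S₂ (beadAt S₁ L row i) := by
  rw [doublesRight]
  refine Finset.card_bij (fun j _ => (j : ℤ) - L) ?_ ?_ ?_
  · intro j hj
    simp only [Finset.mem_filter, Finset.mem_Ioi] at hj
    obtain ⟨h1, h2, h3⟩ := hj
    rw [beadAt_mem_iff, not_not] at h2
    rw [h3] at h2
    have h : (i : ℕ) < j := h1
    simp only [occupied, decide_eq_true_eq] at h2 h3
    rw [Finset.mem_filter, Finset.mem_inter]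
    refine ⟨⟨h2, h3⟩, ?_⟩
    change (i : ℤ) - L < j - L
    omega
  · intro j _ j' _ h
    exact Fin.ext (by omega)
  · intro x hx
    rw [Finset.mem_filter, Finset.mem_inter] at hx
    obtain ⟨⟨h1, h2⟩, h3⟩ := hx
    change x ∈ pathCols S₁ row at h1
    change x ∈ pathCols S₂ row at h2
    change (i : ℤ) - L < x at h3
    have hb := pathCols_bounds hw.len₁ hw.outer₁ h1
    have hc : (((x + L).toNat : ℕ) : ℤ) - L = x := by omega
    refine ⟨⟨(x + L).toNat, by omega⟩, ?_, hc⟩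
    simp only [Finset.mem_filter, Finset.mem_Ioi, beadAt_mem_iff, not_not, occupied, hc, h1, h2,
      decide_true, and_self, and_true]
    rw [Fin.lt_def]
    simp only
    omega

end Bead

/-! ### The flip relation in terms of beads -/

/-- The factor of a column is `-1` for a single blue path, `-t` for a single red one and `t` for
both. -/
theorem flipCoeff_eq {R : Type*} [CommRing R] (t : R) {m : ℕ} (σ : Fin m → Bool × Bool) (i : Fin m) :
    flipCoeff t σ i = (-1) ^ ((Finset.Ioi i).filter fun j => (σ j).1 ≠ (σ j).2).card *
      t ^ ((Finset.Ioi i).filter fun j => (σ j).2 = true).card := by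
  rw [flipCoeff, ← Finset.prod_const, ← Finset.prod_const, Finset.prod_filter, Finset.prod_filter,
    ← Finset.prod_mul_distrib]
  refine Finset.prod_congr rfl fun j _ => ?_
  rcases σ j with ⟨a, b⟩
  cases a <;> cases b <;> simp [flipFactor]

namespace Bead

variable {S₁ S₂ : SkewPartition} {L m : ℕ}

/-- The exponent that normalizes the flip coefficients. -/
def flipExponent (S₁ S₂ : SkewPartition) (b : Bead) : ℤ :=
  doublesRight S₁ S₂ b + if b.row = .top then (beadsRight S₁ S₂ b : ℤ) else 0

/-- The number of beads in the bottom row. -/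
def bottomCount (S₁ S₂ : SkewPartition) : ℕ :=
  ((beadSet S₁ S₂).filter fun j => j.row = .bottom).card

/-- The number of beads before a bead on the boundary of the strip. -/
def rank (S₁ S₂ : SkewPartition) (K : ℤ) (b : Bead) : ℕ :=
  ((beadSet S₁ S₂).filter fun j => pos K j < pos K b).card

/-- Top beads come after `b`; every other bottom bead is before `b` or to its right. -/
theorem IsWindow.rank_bottom (hw : IsWindow S₁ S₂ L m) {b : Bead} (hb : b ∈ beadSet S₁ S₂)
    (hrow : b.row = .bottom) :
    rank S₁ S₂ m b + 1 + beadsRight S₁ S₂ b = bottomCount S₁ S₂ := by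
  have h1 : 1 = ∑ j ∈ beadSet S₁ S₂, if j = b then 1 else 0 := by
    rw [Finset.sum_ite_eq' (beadSet S₁ S₂) b, if_pos hb]
  rw [h1]
  simp only [rank, beadsRight, bottomCount, Finset.card_filter]
  rw [← Finset.sum_add_distrib, ← Finset.sum_add_distrib]
  refine Finset.sum_congr rfl fun j hj => ?_
  have bb := hw.bounds hb
  have bj := hw.bounds hj
  have hne : j ≠ b → j.row = b.row → j.col ≠ b.col := fun h h1 h2 =>
    h (eq_of_row_eq_of_col_eq hj hb h1 h2)
  rw [hrow] at hne ⊢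
  by_cases hjb : j = b
  · subst hjb
    simp [hrow]
  · rw [if_neg hjb]
    cases hjr : j.row
    · have : ¬ pos m j < pos m b := by simp only [pos, hjr, hrow]; omega
      simp [this]
    · have h3 := hne hjb hjr
      have h4 : pos m j < pos m b ↔ j.col < b.col := by simp only [pos, hjr, hrow]; omega
      rcases lt_or_gt_of_ne h3 with h | h
      · simp [h4, h, not_lt.2 h.le]
      · simp [h4, h, not_lt.2 h.le]

/-- The whole bottom row comes first, and `pos` runs through the top row from right to left. -/
theorem IsWindow.rank_top (hw : IsWindow S₁ S₂ L m) {b : Bead} (hb : b ∈ beadSet S₁ S₂)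
    (hrow : b.row = .top) :
    rank S₁ S₂ m b = bottomCount S₁ S₂ + beadsRight S₁ S₂ b := by
  simp only [rank, beadsRight, bottomCount, Finset.card_filter]
  rw [← Finset.sum_add_distrib]
  refine Finset.sum_congr rfl fun j hj => ?_
  have bb := hw.bounds hb
  have bj := hw.bounds hj
  rw [hrow]
  cases hjr : j.row
  · have h4 : pos m j < pos m b ↔ b.col < j.col := by simp only [pos, hjr, hrow]; omega
    simp [h4]
  · have : pos m j < pos m b := by simp only [pos, hjr, hrow]; omega
    simp [this]

/-- The label of a bead in terms of its rank along the boundary of the strip. -/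
theorem IsWindow.label_add_eq (hw : IsWindow S₁ S₂ L m) {b : Bead} (hb : b ∈ beadSet S₁ S₂) :
    label S₁ S₂ b + (if b.row = .bottom then 1 else 0) =
      2 * flipExponent S₁ S₂ b - rank S₁ S₂ m b + bottomCount S₁ S₂ := by
  rw [label_eq, flipExponent]
  cases hrow : b.row
  · have := hw.rank_top hb hrow
    simp
    omega
  · have := hw.rank_bottom hb hrow
    simp
    omega

variable {R : Type*} [CommRing R]

/-- The coefficient factors into a part depending on the bead alone, the power of `q` in
`LoweringRelation`, and a power common to all beads of `Q`. The first part is removed by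
`normalization`, the last by factoring it out. -/
theorem IsWindow.flipCoeff_rowState (hw : IsWindow S₁ S₂ L m) {q : ℤ → R}
    (hq : ∀ a b, q (a + b) = q a * q b) (hq0 : q 0 = 1) {row : BeadRow} {i : Fin m}
    {Q : Finset Bead} (hQ : Q ⊆ beadSet S₁ S₂) (hi : beadAt S₁ L row i ∈ Q) :
    flipCoeff (q 1) (rowState S₁ S₂ L row Q) i =
      (-1) ^ beadsRight S₁ S₂ (beadAt S₁ L row i) *
        q (flipExponent S₁ S₂ (beadAt S₁ L row i) +
          ((beadSet S₁ S₂ \ Q).filter fun j => pos m (beadAt S₁ L row i) < pos m j).card -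
          ((beadSet S₁ S₂ \ Q).filter fun j => j.row = .top).card) := by
  have hpow : ∀ k : ℕ, q 1 ^ k = q k := by
    intro k
    induction k with
    | zero => simp [hq0]
    | succ k ih => rw [pow_succ, ih, ← hq]; push_cast; rfl
  rw [flipCoeff_eq, hpow]
  have hne : ∀ j : Fin m, (rowState S₁ S₂ L row Q j).1 ≠ (rowState S₁ S₂ L row Q j).2 ↔
      beadAt S₁ L row j ∈ beadSet S₁ S₂ ∧ True := by
    intro j
    by_cases h : beadAt S₁ L row j ∈ beadSet S₁ S₂
    · simp only [rowState, h, true_and, iff_true]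
      split_ifs <;> simp
    · simp only [rowState, h, false_and, iff_false, not_not]
      rwa [beadAt_mem_iff, not_not] at h
  have hred : ∀ j : Fin m, (rowState S₁ S₂ L row Q j).2 = true ↔
      (beadAt S₁ L row j ∈ beadSet S₁ S₂ ∧ ¬ (beadAt S₁ L row j ∈ Q ↔ row = .bottom)) ∨
      (beadAt S₁ L row j ∉ beadSet S₁ S₂ ∧ occupied S₂ L row j = true) := by
    intro j
    by_cases h : beadAt S₁ L row j ∈ beadSet S₁ S₂
    · rw [rowState, if_pos h]
      by_cases h' : (beadAt S₁ L row j ∈ Q ↔ row = .bottom)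
      · rw [if_pos h']
        constructor
        · intro e; exact absurd e (by simp)
        · rintro (⟨-, e⟩ | ⟨e, -⟩)
          · exact absurd h' e
          · exact absurd h e
      · rw [if_neg h']
        exact ⟨fun _ => Or.inl ⟨h, h'⟩, fun _ => rfl⟩
    · simp [rowState, h]
  have e1 : ((Finset.Ioi i).filter fun j => (rowState S₁ S₂ L row Q j).1 ≠
      (rowState S₁ S₂ L row Q j).2).card = beadsRight S₁ S₂ (beadAt S₁ L row i) := by
    rw [Finset.filter_congr fun j _ => hne j, hw.card_filter_beadAt row i (fun _ => True), beadsRight]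
    simp only [and_true]
    rfl
  have e2 : ((Finset.Ioi i).filter fun j => (rowState S₁ S₂ L row Q j).2 = true).card =
      ((beadSet S₁ S₂).filter fun b => (b.row = row ∧ (i : ℤ) - L < b.col) ∧
        ¬ (b ∈ Q ↔ row = .bottom)).card + doublesRight S₁ S₂ (beadAt S₁ L row i) := by
    rw [Finset.filter_congr fun j _ => hred j, Finset.filter_or, Finset.card_union_of_disjoint,
      hw.card_filter_beadAt row i (fun b => ¬ (b ∈ Q ↔ row = .bottom)), hw.card_filter_double]
    rw [Finset.disjoint_filter]
    tauto
  rw [e1, e2]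
  congr 2
  have hsd : ∀ (p : Bead → Prop) [DecidablePred p], ((beadSet S₁ S₂ \ Q).filter p).card =
      ∑ j ∈ beadSet S₁ S₂, if j ∉ Q ∧ p j then 1 else 0 := by
    intro p _
    rw [← Finset.card_filter]
    congr 1
    ext j
    simp only [Finset.mem_filter, Finset.mem_sdiff]
    tauto
  have hb := hQ hi
  set b := beadAt S₁ L row i with hbdef
  have hcol : (i : ℤ) - L = b.col := rfl
  have hrow : b.row = row := rfl
  have bb := hw.bounds hb
  rw [hcol, flipExponent, hrow]
  cases hr : row
  -- In the top row the red beads are those of `Q`. The beads outside `Q` in this row lie either to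
  -- the right of `b`, where they are missing from the red ones, or to its left, hence after `b`
  -- along the boundary.
  · have key : ((beadSet S₁ S₂).filter fun j => (j.row = .top ∧ b.col < j.col) ∧
        ¬ (j ∈ Q ↔ BeadRow.top = .bottom)).card +
        ((beadSet S₁ S₂ \ Q).filter fun j => j.row = .top).card =
        beadsRight S₁ S₂ b +
        ((beadSet S₁ S₂ \ Q).filter fun j => pos m b < pos m j).card := by
      rw [hsd, hsd, beadsRight, Finset.card_filter, Finset.card_filter, ← Finset.sum_add_distrib,
        ← Finset.sum_add_distrib, hrow, hr]
      refine Finset.sum_congr rfl fun j hj => ?_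
      have bj := hw.bounds hj
      cases hjr : j.row
      · have h4 : pos m b < pos m j ↔ j.col < b.col := by simp only [pos, hjr, hrow, hr]; omega
        by_cases hjQ : j ∈ Q
        · simp [hjQ]
        · have hjb : j.col ≠ b.col := fun h => hjQ
            (by rw [eq_of_row_eq_of_col_eq hj hb (hjr.trans (hrow.trans hr).symm) h]; exact hi)
          rcases lt_or_gt_of_ne hjb with h | h
          · simp [hjQ, h4, h, not_lt.2 h.le]
          · simp [hjQ, h4, h, not_lt.2 h.le]
      · have : ¬ pos m b < pos m j := by simp only [pos, hjr, hrow, hr]; omega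
        simp [this]
    have key₂ := congrArg (Nat.cast : ℕ → ℤ) key
    rw [Nat.cast_add, Nat.cast_add] at key₂
    rw [if_pos rfl, Nat.cast_add]
    linear_combination key₂
  -- In the bottom row the red beads are those outside `Q`, and the whole top row comes after `b`.
  · have key : ((beadSet S₁ S₂).filter fun j => (j.row = .bottom ∧ b.col < j.col) ∧
        ¬ (j ∈ Q ↔ BeadRow.bottom = .bottom)).card +
        ((beadSet S₁ S₂ \ Q).filter fun j => j.row = .top).card =
        ((beadSet S₁ S₂ \ Q).filter fun j => pos m b < pos m j).card := by
      rw [hsd, hsd, Finset.card_filter, ← Finset.sum_add_distrib]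
      refine Finset.sum_congr rfl fun j hj => ?_
      have bj := hw.bounds hj
      cases hjr : j.row
      · have : pos m b < pos m j := by simp only [pos, hjr, hrow, hr]; omega
        simp [this]
      · have h4 : pos m b < pos m j ↔ b.col < j.col := by simp only [pos, hjr, hrow, hr]; omega
        simp only [h4]
        by_cases hjQ : j ∈ Q <;> simp [hjQ]
    have key₂ := congrArg (Nat.cast : ℕ → ℤ) key
    rw [Nat.cast_add] at key₂
    rw [if_neg (by decide), add_zero, Nat.cast_add]
    linear_combination key₂

/-- A sum over beads as a sum over the columns of the two rows. -/
theorem IsWindow.sum_eq (hw : IsWindow S₁ S₂ L m) {Q : Finset Bead} (hQ : Q ⊆ beadSet S₁ S₂)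
    (F : Bead → R) :
    ∑ b ∈ Q, F b =
      (∑ i : Fin m, if beadAt S₁ L .bottom i ∈ Q then F (beadAt S₁ L .bottom i) else 0) +
      ∑ i : Fin m, if beadAt S₁ L .top i ∈ Q then F (beadAt S₁ L .top i) else 0 := by
  have hrow : ∀ row, (∑ i : Fin m, if beadAt S₁ L row i ∈ Q then F (beadAt S₁ L row i) else 0) =
      ∑ b ∈ Q.filter (fun b => b.row = row), F b := by
    intro row
    rw [← Finset.sum_filter]
    refine Finset.sum_bij (fun i _ => beadAt S₁ L row i) ?_ ?_ ?_ ?_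
    · intro i hi
      exact Finset.mem_filter.2 ⟨(Finset.mem_filter.1 hi).2, rfl⟩
    · intro i _ j _ h
      exact beadAt_injective row h
    · intro b hb
      obtain ⟨hbQ, rfl⟩ := Finset.mem_filter.1 hb
      obtain ⟨c, hc⟩ := hw.exists_beadAt (hQ hbQ)
      exact ⟨c, Finset.mem_filter.2 ⟨Finset.mem_univ _, by rwa [hc]⟩, hc⟩
    · intro i _
      rfl
  rw [hrow, hrow, ← Finset.sum_filter_add_sum_filter_not Q (fun b => b.row = .bottom)]
  congr 2
  refine Finset.filter_congr fun b _ => ?_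
  cases b.row <;> simp

/-- The partition function with the beads colored by `P`. -/
def coloredZ (S₁ S₂ : SkewPartition) (L m : ℕ) (t : R) {n : ℕ} (x : Fin n → R) (P : Finset Bead) :
    R :=
  latticeZ t m x (rowState S₁ S₂ L .bottom P) (rowState S₁ S₂ L .top P)

/-- The sign and the power of `t` that normalize the partition function. -/
def normalization (S₁ S₂ : SkewPartition) (q : ℤ → R) (b : Bead) : R :=
  (-1) ^ (beadsRight S₁ S₂ b + if b.row = .top then 1 else 0) * q (-flipExponent S₁ S₂ b)

/-- The normalized partition function is annihilated by the lowering operator. -/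
theorem IsWindow.loweringRelation (hw : IsWindow S₁ S₂ L m) {q : ℤ → R}
    (hq : ∀ a b, q (a + b) = q a * q b) (hq0 : q 0 = 1) {n : ℕ} (x : Fin n → R) (a : ℕ) :
    LoweringRelation q (pos m) (beadSet S₁ S₂) a fun P =>
      (∏ b ∈ P, normalization S₁ S₂ q b) * coloredZ S₁ S₂ L m (q 1) x P := by
  intro Q hQ _
  have hinv : ∀ e, q e * q (-e) = 1 := fun e => by rw [← hq, add_neg_cancel, hq0]
  have hsq : ∀ k : ℕ, ((-1 : R) ^ k) * (-1) ^ k = 1 := fun k => by rw [← mul_pow]; simp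
  obtain ⟨N, hN⟩ : ∃ N : ℤ, N = ((beadSet S₁ S₂ \ Q).filter fun j => j.row = .top).card := ⟨_, rfl⟩
  have hterm : ∀ b ∈ Q, q ((beadSet S₁ S₂ \ Q).filter fun j => pos m b < pos m j).card *
      ((∏ c ∈ Q.erase b, normalization S₁ S₂ q c) * coloredZ S₁ S₂ L m (q 1) x (Q.erase b)) =
      (∏ c ∈ Q, normalization S₁ S₂ q c) * q N *
      ((-1) ^ (if b.row = .top then 1 else 0) * ((-1) ^ beadsRight S₁ S₂ b * q (flipExponent S₁ S₂ b +
        ((beadSet S₁ S₂ \ Q).filter fun j => pos m b < pos m j).card - N)) *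
        coloredZ S₁ S₂ L m (q 1) x (Q.erase b)) := by
    intro b hb
    rw [← Finset.mul_prod_erase Q _ hb, normalization, sub_eq_add_neg, hq, hq, pow_add]
    have i1 := hinv N
    have i2 := hinv (flipExponent S₁ S₂ b)
    have i3 := hsq (beadsRight S₁ S₂ b)
    have i4 := hsq (if b.row = .top then 1 else 0)
    generalize q N = u1 at *
    generalize q (-N) = u2 at *
    generalize q (flipExponent S₁ S₂ b) = u3 at *
    generalize q (-flipExponent S₁ S₂ b) = u4 at *
    generalize ((-1 : R) ^ beadsRight S₁ S₂ b) = u5 at *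
    generalize ((-1 : R) ^ (if b.row = .top then 1 else 0)) = u6 at *
    generalize q _ = u7
    generalize (∏ c ∈ Q.erase b, normalization S₁ S₂ q c) = u8
    generalize coloredZ S₁ S₂ L m (q 1) x (Q.erase b) = u9
    linear_combination (-u7 * u8 * u9) * (i1 + (u1 * u2) * i2 + (u1 * u2 * u3 * u4) * i3 +
      (u1 * u2 * u3 * u4 * u5 * u5) * i4)
  rw [Finset.sum_congr rfl hterm, ← Finset.mul_sum, hw.sum_eq hQ]
  have hflip := latticeZ_flip (q 1) m x (rowState S₁ S₂ L .bottom Q) (rowState S₁ S₂ L .top Q)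
  have hbot : (∑ i : Fin m, if beadAt S₁ L .bottom i ∈ Q then
      (-1) ^ (if (beadAt S₁ L .bottom i).row = .top then 1 else 0) *
        ((-1) ^ beadsRight S₁ S₂ (beadAt S₁ L .bottom i) *
          q (flipExponent S₁ S₂ (beadAt S₁ L .bottom i) + ((beadSet S₁ S₂ \ Q).filter fun j =>
            pos m (beadAt S₁ L .bottom i) < pos m j).card - N)) *
        coloredZ S₁ S₂ L m (q 1) x (Q.erase (beadAt S₁ L .bottom i)) else 0) =
      ∑ i : Fin m, if rowState S₁ S₂ L .bottom Q i = (true, false) then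
        flipCoeff (q 1) (rowState S₁ S₂ L .bottom Q) i * latticeZ (q 1) m x
          (Function.update (rowState S₁ S₂ L .bottom Q) i (false, true))
          (rowState S₁ S₂ L .top Q) else 0 := by
    refine Finset.sum_congr rfl fun i _ => ?_
    by_cases hi : beadAt S₁ L .bottom i ∈ Q
    · rw [if_pos hi, if_pos ((rowState_bottom_eq_iff hQ i).2 hi), hw.flipCoeff_rowState hq hq0 hQ hi,
        coloredZ, rowState_erase (hQ hi), rowState_erase_of_ne (by decide)]
      simp [beadAt, hN]
    · rw [if_neg hi, if_neg (mt (rowState_bottom_eq_iff hQ i).1 hi)]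
  have htop : (∑ i : Fin m, if beadAt S₁ L .top i ∈ Q then
      (-1) ^ (if (beadAt S₁ L .top i).row = .top then 1 else 0) *
        ((-1) ^ beadsRight S₁ S₂ (beadAt S₁ L .top i) *
          q (flipExponent S₁ S₂ (beadAt S₁ L .top i) + ((beadSet S₁ S₂ \ Q).filter fun j =>
            pos m (beadAt S₁ L .top i) < pos m j).card - N)) *
        coloredZ S₁ S₂ L m (q 1) x (Q.erase (beadAt S₁ L .top i)) else 0) =
      -∑ i : Fin m, if rowState S₁ S₂ L .top Q i = (false, true) then
        flipCoeff (q 1) (rowState S₁ S₂ L .top Q) i * latticeZ (q 1) m x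
          (rowState S₁ S₂ L .bottom Q)
          (Function.update (rowState S₁ S₂ L .top Q) i (true, false)) else 0 := by
    rw [← Finset.sum_neg_distrib]
    refine Finset.sum_congr rfl fun i _ => ?_
    by_cases hi : beadAt S₁ L .top i ∈ Q
    · rw [if_pos hi, if_pos ((rowState_top_eq_iff hQ i).2 hi), hw.flipCoeff_rowState hq hq0 hQ hi,
        coloredZ, rowState_erase (hQ hi), rowState_erase_of_ne (by decide)]
      simp [beadAt, hN]
    · rw [if_neg hi, if_neg (mt (rowState_top_eq_iff hQ i).1 hi), neg_zero]
  -- The extra sign of the top row in `normalization` brings both sides of `latticeZ_flip` to one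
  -- side.
  rw [hbot, htop, hflip, add_neg_cancel, mul_zero]

end Bead

/-! ### Swapping the shapes, and matchings of beads as two-class matchings -/

namespace Bead

variable {S₁ S₂ : SkewPartition} {L m : ℕ}

/-- The beads that are blue in the bottom row or red in the top row. -/
def minusSet (S₁ S₂ : SkewPartition) : Finset Bead :=
  (beadSet S₁ S₂).filter fun b => b.color = .blue ↔ b.row = .bottom

theorem minusSet_subset : minusSet S₁ S₂ ⊆ beadSet S₁ S₂ := Finset.filter_subset _ _

theorem beadAt_color_eq_blue_iff {row : BeadRow} {c : Fin m} :
    (beadAt S₁ L row c).color = .blue ↔ occupied S₁ L row c = true := by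
  simp only [beadAt, occupied, decide_eq_true_eq]
  split_ifs with h <;> simp [h]

theorem rowState_minusSet (row : BeadRow) :
    (rowState S₁ S₂ L row (minusSet S₁ S₂) : Fin m → Bool × Bool) =
      fun c => (occupied S₁ L row c, occupied S₂ L row c) := by
  funext c
  by_cases h : beadAt S₁ L row c ∈ beadSet S₁ S₂
  · have h' := beadAt_mem_iff.1 h
    have hb := beadAt_color_eq_blue_iff (S₁ := S₁) (L := L) (row := row) (c := c)
    have hmem : (beadAt S₁ L row c ∈ minusSet S₁ S₂ ↔ row = .bottom) ↔
        occupied S₁ L row c = true := by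
      rw [minusSet, Finset.mem_filter, hb]
      have hr : (beadAt S₁ L row c).row = row := rfl
      rw [hr]
      tauto
    rw [rowState, if_pos h]
    cases h1 : occupied S₁ L row c <;> cases h2 : occupied S₂ L row c <;> simp_all
  · rw [rowState, if_neg h]

/-- Passing to the complement changes the color of every bead, and a column with two paths or none
is unaffected by exchanging the colors. -/
theorem rowState_compl_minusSet (row : BeadRow) :
    (rowState S₁ S₂ L row (beadSet S₁ S₂ \ minusSet S₁ S₂) : Fin m → Bool × Bool) =
      fun c => (occupied S₂ L row c, occupied S₁ L row c) := by
  funext c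
  by_cases h : beadAt S₁ L row c ∈ beadSet S₁ S₂
  · have h' := beadAt_mem_iff.1 h
    have hb := beadAt_color_eq_blue_iff (S₁ := S₁) (L := L) (row := row) (c := c)
    have hmem : (beadAt S₁ L row c ∈ beadSet S₁ S₂ \ minusSet S₁ S₂ ↔ row = .bottom) ↔
        ¬ occupied S₁ L row c = true := by
      rw [Finset.mem_sdiff, minusSet, Finset.mem_filter, hb]
      have hr : (beadAt S₁ L row c).row = row := rfl
      rw [hr]
      tauto
    rw [rowState, if_pos h]
    cases h1 : occupied S₁ L row c <;> cases h2 : occupied S₂ L row c <;> simp_all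
  · rw [rowState, if_neg h]
    have h' := h
    rw [beadAt_mem_iff, not_not] at h'
    rw [h']

theorem IsWindow.coinvLLT_eq (hw : IsWindow S₁ S₂ L m) (n : ℕ) :
    coinvLLT ![S₁, S₂] n = coloredZ S₁ S₂ L m (MvPolynomial.C (LaurentPolynomial.T 1))
      MvPolynomial.X (minusSet S₁ S₂) := by
  rw [coinvLLT_pair_eq_latticeZ S₁ S₂ n hw.len₁ hw.len₂ hw.outer₁ hw.outer₂, coloredZ,
    rowState_minusSet, rowState_minusSet]
  unfold pairState
  rw [pathState_inner hw.len₁, pathState_inner hw.len₂, pathState_outer hw.len₁,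
    pathState_outer hw.len₂]

theorem IsWindow.coinvLLT_swap_eq (hw : IsWindow S₁ S₂ L m) (n : ℕ) :
    coinvLLT ![S₂, S₁] n = coloredZ S₁ S₂ L m (MvPolynomial.C (LaurentPolynomial.T 1))
      MvPolynomial.X (beadSet S₁ S₂ \ minusSet S₁ S₂) := by
  rw [coinvLLT_pair_eq_latticeZ S₂ S₁ n hw.len₂ hw.len₁ hw.outer₂ hw.outer₁, coloredZ,
    rowState_compl_minusSet, rowState_compl_minusSet]
  unfold pairState
  rw [pathState_inner hw.len₁, pathState_inner hw.len₂, pathState_outer hw.len₁,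
    pathState_outer hw.len₂]

/-- Membership in `minusSet` toggles with the color and with the row; along an allowed arc exactly
one of the two changes. -/
theorem arcAllowed_iff {b c : Bead} (hb : b ∈ beadSet S₁ S₂) (hc : c ∈ beadSet S₁ S₂) :
    ArcAllowed b c ↔ (b ∈ minusSet S₁ S₂ ↔ c ∉ minusSet S₁ S₂) := by
  simp only [minusSet, Finset.mem_filter, hb, hc, true_and, ArcAllowed]
  obtain ⟨r, k, x⟩ := b
  obtain ⟨r', k', x'⟩ := c
  cases r <;> cases k <;> cases r' <;> cases k' <;> simp

/-- The order of `pos` is the reverse of `Before`, and endpoints that alternate still alternate when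
read backwards. -/
theorem IsWindow.isNCMatching_iff (hw : IsWindow S₁ S₂ L m) (M : Finset (Sym2 Bead)) :
    IsNCMatching (pos m) (beadSet S₁ S₂) (minusSet S₁ S₂) M ↔
      IsMatching S₁ S₂ M ∧ IsNonCrossing M := by
  constructor
  · intro h
    have hl : ∀ b c, s(b, c) ∈ M → b ∈ beadSet S₁ S₂ := fun b c e => h.mem _ e b (Sym2.mem_mk_left _ _)
    have hr : ∀ b c, s(b, c) ∈ M → c ∈ beadSet S₁ S₂ := fun b c e =>
      h.mem _ e c (Sym2.mem_mk_right _ _)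
    refine ⟨⟨fun a ha b hb => mem_beadSet.1 (h.mem a ha b hb), fun b c e =>
      (arcAllowed_iff (hl b c e) (hr b c e)).2 (h.opposite b c e),
      fun b hb => h.covers b (mem_beadSet.2 hb)⟩, ?_⟩
    intro b₁ b₂ c₁ c₂ e₁ e₂ ⟨h1, h2, h3⟩
    rw [hw.before_iff (hl _ _ e₁) (hl _ _ e₂)] at h1
    rw [hw.before_iff (hl _ _ e₂) (hr _ _ e₁)] at h2
    rw [hw.before_iff (hr _ _ e₁) (hr _ _ e₂)] at h3
    exact h.noncrossing c₂ c₁ b₂ b₁ (by rwa [Sym2.eq_swap]) (by rwa [Sym2.eq_swap]) ⟨h3, h2, h1⟩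
  · rintro ⟨h, hn⟩
    have hmem : ∀ a ∈ M, ∀ b ∈ a, b ∈ beadSet S₁ S₂ := fun a ha b hb =>
      mem_beadSet.2 (h.isBead a ha b hb)
    have hl : ∀ b c, s(b, c) ∈ M → b ∈ beadSet S₁ S₂ := fun b c e => hmem _ e b (Sym2.mem_mk_left _ _)
    have hr : ∀ b c, s(b, c) ∈ M → c ∈ beadSet S₁ S₂ := fun b c e =>
      hmem _ e c (Sym2.mem_mk_right _ _)
    refine ⟨hmem, fun b c e => (arcAllowed_iff (hl b c e) (hr b c e)).1 (h.allowed b c e),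
      fun b hb => h.covers b (mem_beadSet.1 hb), ?_⟩
    intro b₁ b₂ c₁ c₂ e₁ e₂ ⟨h1, h2, h3⟩
    rw [← hw.before_iff (hl _ _ e₂) (hl _ _ e₁)] at h1
    rw [← hw.before_iff (hr _ _ e₁) (hl _ _ e₂)] at h2
    rw [← hw.before_iff (hr _ _ e₂) (hr _ _ e₁)] at h3
    exact hn c₂ c₁ b₂ b₁ (by rwa [Sym2.eq_swap]) (by rwa [Sym2.eq_swap]) ⟨h3, h2, h1⟩

/-- The exponent of an arc in terms of its ends. -/
theorem IsWindow.twiceArcExponent_eq (hw : IsWindow S₁ S₂ L m) {p c : Bead}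
    (hp : p ∈ minusSet S₁ S₂) (hc : c ∈ beadSet S₁ S₂) (hcm : c ∉ minusSet S₁ S₂) :
    twiceArcExponent S₁ S₂ s(p, c) =
      (label S₁ S₂ p + if p.row = .bottom then 1 else 0) -
        (label S₁ S₂ c + if c.row = .bottom then 1 else 0) +
        if pos m p < pos m c then -1 else 1 := by
  have hps := minusSet_subset hp
  have hne : p ≠ c := fun h => hcm (h ▸ hp)
  have hcol : p.row = c.row → p.col ≠ c.col := fun h h' =>
    hne (eq_of_row_eq_of_col_eq hps hc h h')
  have b1 := hw.bounds hps
  have b2 := hw.bounds hc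
  replace hp := (Finset.mem_filter.1 hp).2
  replace hcm : ¬ (c.color = .blue ↔ c.row = .bottom) := fun h =>
    hcm (Finset.mem_filter.2 ⟨hc, h⟩)
  change arcTable S₁ S₂ p c + arcTable S₁ S₂ c p = _
  obtain ⟨l₁, hl₁⟩ : ∃ l, l = label S₁ S₂ p := ⟨_, rfl⟩
  obtain ⟨l₂, hl₂⟩ : ∃ l, l = label S₁ S₂ c := ⟨_, rfl⟩
  obtain ⟨r, k, x⟩ := p
  obtain ⟨r', k', x'⟩ := c
  cases r <;> cases k <;> simp at hp <;> cases r' <;> cases k' <;> simp at hcm <;>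
    simp only [arcTable, pos, ← hl₁, ← hl₂] <;> simp at hcol b1 b2 ⊢ <;> split_ifs <;> omega

end Bead

/-! ### Nonvanishing of `q`-integers, signs and parities -/

/-- The value at `t = 1` is `k + 1`. -/
theorem mvPolynomial_sum_T_ne_zero (n k : ℕ) :
    ∑ j ∈ Finset.range (k + 1), (MvPolynomial.C (LaurentPolynomial.T (j : ℤ)) :
      MvPolynomial (Fin n) (LaurentPolynomial ℤ)) ≠ 0 := by
  have h1 : ∑ j ∈ Finset.range (k + 1), (MvPolynomial.C (LaurentPolynomial.T (j : ℤ)) :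
      MvPolynomial (Fin n) (LaurentPolynomial ℤ)) =
      MvPolynomial.C (Polynomial.toLaurent (∑ j ∈ Finset.range (k + 1), Polynomial.X ^ j)) := by
    rw [map_sum, map_sum]
    exact Finset.sum_congr rfl fun j _ => by rw [Polynomial.toLaurent_X_pow]
  rw [h1, Ne, MvPolynomial.C_eq_zero, ← map_zero (Polynomial.toLaurent (R := ℤ)),
    Polynomial.toLaurent_injective.eq_iff]
  intro h
  have := congrArg (Polynomial.eval 1) h
  simp [Polynomial.eval_finsetSum] at this
  omega

/-- Collects the signs of both normalizations and of the proportionality. The ranks of `2 * a` beads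
sum to `a * (2 * a - 1)`, which has the parity of `a`. -/
theorem neg_one_pow_sum_rank {R : Type*} [CommRing R] (N a : ℕ) :
    ((-1 : R) ^ (N + 1)) ^ (2 * a) * (-1) ^ ((2 * a).choose 2) * (-1) ^ a = 1 := by
  have h : (2 * a).choose 2 = a * (2 * a - 1) := by
    rw [Nat.choose_two_right, mul_assoc, Nat.mul_div_cancel_left _ (by norm_num)]
  rw [← pow_mul, ← pow_add, ← pow_add, h]
  apply Even.neg_one_pow
  rcases Nat.eq_zero_or_pos a with rfl | ha
  · simp
  · have e : (N + 1) * (2 * a) + a * (2 * a - 1) + a = 2 * ((N + 1) * a + a * a) := by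
      obtain ⟨b, rfl⟩ : ∃ b, a = b + 1 := ⟨a - 1, by omega⟩
      have : 2 * (b + 1) - 1 = 2 * b + 1 := by omega
      rw [this]
      ring
    rw [e]
    exact even_two_mul _


section Partner

variable {α : Type*} [DecidableEq α] {pos : α → ℤ} {s P : Finset α} {M : Finset (Sym2 α)}

/-- A sum over the arcs is a sum over their ends in `P`. -/
theorem IsNCMatching.sum_eq {A : Type*} [AddCommMonoid A] (hM : IsNCMatching pos s P M)
    (hPs : P ⊆ s) {π : α → α}
    (hπ : ∀ b ∈ s, s(b, π b) ∈ M ∧ π b ∈ s ∧ (b ∈ P ↔ π b ∉ P) ∧ π (π b) = b)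
    (hu : ∀ b c, s(b, c) ∈ M → c = π b) (f : Sym2 α → A) :
    ∑ e ∈ M, f e = ∑ p ∈ P, f s(p, π p) := by
  symm
  refine Finset.sum_bij (fun p _ => s(p, π p)) (fun p hp => (hπ p (hPs hp)).1) ?_ ?_ fun _ _ => rfl
  · intro p hp p' hp' h
    rcases Sym2.eq_iff.1 h with ⟨h, -⟩ | ⟨h, -⟩
    · exact h
    · exact absurd (h ▸ hp) ((hπ p' (hPs hp')).2.2.1.1 hp')
  · intro e he
    induction e using Sym2.ind with
    | _ b c =>
    by_cases hb : b ∈ P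
    · exact ⟨b, hb, by rw [← hu b c he]⟩
    · have hcb : s(c, b) ∈ M := by rwa [Sym2.eq_swap]
      have hc : c ∈ P := (hM.opposite c b hcb).2 hb
      exact ⟨c, hc, by rw [← hu c b hcb, Sym2.eq_swap]⟩

theorem bijOn_partner (hPs : P ⊆ s) {π : α → α}
    (hπ : ∀ b ∈ s, s(b, π b) ∈ M ∧ π b ∈ s ∧ (b ∈ P ↔ π b ∉ P) ∧ π (π b) = b) :
    Set.BijOn π P (s \ P : Finset α) := by
  refine ⟨fun p hp => ?_, fun p hp p' hp' h => ?_, fun c hc => ?_⟩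
  · have h := hπ p (hPs hp)
    exact Finset.mem_coe.2 (Finset.mem_sdiff.2 ⟨h.2.1, h.2.2.1.1 hp⟩)
  · rw [← (hπ p (hPs hp)).2.2.2, h, (hπ p' (hPs hp')).2.2.2]
  · obtain ⟨hcs, hcP⟩ := Finset.mem_sdiff.1 (Finset.mem_coe.1 hc)
    have h := hπ c hcs
    exact ⟨π c, not_not.1 fun h' => hcP (h.2.2.1.2 h'), h.2.2.2⟩

/-- The ends of an arc of a non-crossing matching have ranks of opposite parity. -/
theorem IsNCMatching.odd_rank_sub (hM : IsNCMatching pos s P M) (hpos : Set.InjOn pos s)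
    {x y : α} (hxy : s(x, y) ∈ M) (hlt : pos x < pos y) :
    Odd (((s.filter fun j => pos j < pos y).card : ℤ) - (s.filter fun j => pos j < pos x).card) := by
  have hx : x ∈ s := hM.mem _ hxy x (Sym2.mem_mk_left _ _)
  have h : (s.filter fun j => pos j < pos y) = (s.filter fun j => pos j < pos x) ∪
      insert x (s.filter fun j => pos x < pos j ∧ pos j < pos y) := by
    ext j
    simp only [Finset.mem_filter, Finset.mem_union, Finset.mem_insert]
    constructor
    · rintro ⟨hj, hjy⟩
      rcases lt_trichotomy (pos j) (pos x) with h | h | h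
      · exact Or.inl ⟨hj, h⟩
      · exact Or.inr (Or.inl (hpos hj hx h))
      · exact Or.inr (Or.inr ⟨hj, h, hjy⟩)
    · rintro (⟨hj, h⟩ | rfl | ⟨hj, -, h⟩)
      · exact ⟨hj, h.trans hlt⟩
      · exact ⟨hx, hlt⟩
      · exact ⟨hj, h⟩
  have hd : Disjoint (s.filter fun j => pos j < pos x)
      (insert x (s.filter fun j => pos x < pos j ∧ pos j < pos y)) := by
    rw [Finset.disjoint_left]
    intro j hj hj'
    rcases Finset.mem_insert.1 hj' with rfl | hj'
    · exact lt_irrefl _ (Finset.mem_filter.1 hj).2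
    · exact lt_asymm (Finset.mem_filter.1 hj).2 (Finset.mem_filter.1 hj').2.1
  rw [h, Finset.card_union_of_disjoint hd, Finset.card_insert_of_notMem (by simp)]
  obtain ⟨k, hk⟩ := hM.even_card_between hpos hxy
  exact ⟨k, by rw [hk]; push_cast; ring⟩

end Partner

theorem neg_one_pow_mul_self {R : Type*} [CommRing R] (k : ℕ) : (-1 : R) ^ k * (-1) ^ k = 1 := by
  rw [← mul_pow]
  simp

/-! ### The constant of proportionality -/

namespace Bead

variable {S₁ S₂ : SkewPartition} {L m : ℕ}

/-- The extra sign of the top row makes the total sign the parity of the rank, up to a constant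
common to both rows. -/
theorem IsWindow.normalization_eq {R : Type*} [CommRing R] (hw : IsWindow S₁ S₂ L m) (q : ℤ → R)
    {b : Bead} (hb : b ∈ beadSet S₁ S₂) :
    normalization S₁ S₂ q b = (-1) ^ (bottomCount S₁ S₂ + 1) * (-1) ^ rank S₁ S₂ m b *
      q (-flipExponent S₁ S₂ b) := by
  rw [normalization, ← pow_add]
  congr 1
  rcases h : b.row
  · rw [hw.rank_top hb h, if_pos rfl]
    exact neg_one_pow_congr (by rw [Nat.even_iff, Nat.even_iff]; omega)
  · rw [if_neg (by decide), ← hw.rank_bottom hb h]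
    exact neg_one_pow_congr (by rw [Nat.even_iff, Nat.even_iff]; omega)

/-- The product of the normalizing factors over a set of beads. -/
theorem IsWindow.prod_normalization {R : Type*} [CommRing R] (hw : IsWindow S₁ S₂ L m) {q : ℤ → R}
    (hq : ∀ a b, q (a + b) = q a * q b) (hq0 : q 0 = 1) {P : Finset Bead}
    (hP : P ⊆ beadSet S₁ S₂) :
    ∏ b ∈ P, normalization S₁ S₂ q b = ((-1) ^ (bottomCount S₁ S₂ + 1)) ^ P.card *
      (-1) ^ (∑ b ∈ P, rank S₁ S₂ m b) * q (-∑ b ∈ P, flipExponent S₁ S₂ b) := by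
  have hprod : ∀ f : Bead → ℤ, ∏ b ∈ P, q (f b) = q (∑ b ∈ P, f b) := fun f =>
    (Finset.prod_hom_rel (s := P) (f := fun b => Multiplicative.ofAdd (f b)) (g := fun b => q (f b))
      (r := fun x y => y = q (Multiplicative.toAdd x)) (by simp [hq0])
      (fun b x y h => by simp [h, hq]))
  rw [Finset.prod_congr rfl fun b hb => hw.normalization_eq q (hP hb), Finset.prod_mul_distrib,
    Finset.prod_mul_distrib, Finset.prod_const, Finset.prod_pow_eq_pow_sum, hprod,
    Finset.sum_neg_distrib]

/-- The ranks of the two ends differ by an odd number, which compensates the `±1` in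
`twiceArcExponent_eq`. -/
theorem IsWindow.even_twiceArcExponent (hw : IsWindow S₁ S₂ L m) {M : Finset (Sym2 Bead)}
    (hM : IsNCMatching (pos m) (beadSet S₁ S₂) (minusSet S₁ S₂) M) {p c : Bead}
    (hp : p ∈ minusSet S₁ S₂) (hpc : s(p, c) ∈ M) : Even (twiceArcExponent S₁ S₂ s(p, c)) := by
  have hps := minusSet_subset hp
  have hc : c ∈ beadSet S₁ S₂ := hM.mem _ hpc c (Sym2.mem_mk_right _ _)
  have hcm : c ∉ minusSet S₁ S₂ := (hM.opposite p c hpc).1 hp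
  have hne : pos m p ≠ pos m c := fun h => hcm (hw.pos_injOn hps hc h ▸ hp)
  rw [hw.twiceArcExponent_eq hp hc hcm, hw.label_add_eq hps, hw.label_add_eq hc]
  rcases lt_or_gt_of_ne hne with h | h
  · obtain ⟨k, hk⟩ := hM.odd_rank_sub hw.pos_injOn hpc h
    rw [if_pos h]
    change (rank S₁ S₂ m c : ℤ) - rank S₁ S₂ m p = _ at hk
    exact ⟨flipExponent S₁ S₂ p - flipExponent S₁ S₂ c + k, by linarith⟩
  · obtain ⟨k, hk⟩ := hM.odd_rank_sub hw.pos_injOn (Sym2.eq_swap ▸ hpc) h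
    rw [if_neg h.asymm]
    change (rank S₁ S₂ m p : ℤ) - rank S₁ S₂ m c = _ at hk
    exact ⟨flipExponent S₁ S₂ p - flipExponent S₁ S₂ c - k, by linarith⟩

/-- Exchanging the two colors multiplies the partition function by a power of `t`. -/
theorem IsWindow.coloredZ_eq {R : Type*} [CommRing R] [IsDomain R] (hw : IsWindow S₁ S₂ L m)
    {q : ℤ → R} (hq : ∀ a b, q (a + b) = q a * q b) (hq0 : q 0 = 1)
    (hne : ∀ k : ℕ, ∑ j ∈ Finset.range (k + 1), q j ≠ 0) {P : Finset Bead} {a : ℕ}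
    (hPs : P ⊆ beadSet S₁ S₂) (ha : P.card = a) (hac : (beadSet S₁ S₂ \ P).card = a)
    (halt : ¬ HasAlternation (pos m) (beadSet S₁ S₂) P) {n : ℕ} (x : Fin n → R) :
    ∃ d : ℕ, coloredZ S₁ S₂ L m (q 1) x P =
        q (∑ b ∈ P, flipExponent S₁ S₂ b - ∑ b ∈ beadSet S₁ S₂ \ P, flipExponent S₁ S₂ b +
          ((a - 1) * d - (a.choose 2 : ℕ))) * coloredZ S₁ S₂ L m (q 1) x (beadSet S₁ S₂ \ P) ∧
      (∀ π : Bead → Bead, Set.BijOn π P (beadSet S₁ S₂ \ P : Finset Bead) →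
        (P.filter fun i => pos m i < pos m (π i)).card = d) ∧
      (∑ i ∈ P, (rank S₁ S₂ m i : ℤ)) - ∑ i ∈ beadSet S₁ S₂ \ P, (rank S₁ S₂ m i : ℤ) =
        a * a - 2 * a * d := by
  obtain ⟨d, hH, hd, hrank⟩ := LoweringRelation.compl_of_not_hasAlternation hq hq0 hne hPs ha hac
    hw.pos_injOn halt (hw.loweringRelation hq hq0 x a)
  refine ⟨d, ?_, hd, hrank⟩
  rw [hw.prod_normalization hq hq0 hPs, hw.prod_normalization hq hq0 Finset.sdiff_subset, ha,
    hac] at hH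
  have hrk : ∑ b ∈ beadSet S₁ S₂ \ P, rank S₁ S₂ m b + ∑ b ∈ P, rank S₁ S₂ m b =
      (2 * a).choose 2 := by
    have h := sum_card_filter_lt_eq_choose (pos m) (beadSet S₁ S₂) hw.pos_injOn
    rw [← Finset.card_sdiff_add_card_eq_card hPs, ha, hac, ← two_mul] at h
    rw [Finset.sum_sdiff hPs, ← h]
    rfl
  have hs := neg_one_pow_sum_rank (R := R) (bottomCount S₁ S₂) a
  rw [← hrk, two_mul, pow_add _ a a, pow_add _ (∑ b ∈ beadSet S₁ S₂ \ P, _)] at hs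
  have hinv : q (∑ b ∈ P, flipExponent S₁ S₂ b) * q (-∑ b ∈ P, flipExponent S₁ S₂ b) = 1 := by
    rw [← hq, add_neg_cancel, hq0]
  rw [sub_eq_add_neg (∑ b ∈ P, flipExponent S₁ S₂ b), hq, hq]
  have h2 : ((-1 : R) ^ (bottomCount S₁ S₂ + 1)) ^ a * ((-1) ^ (bottomCount S₁ S₂ + 1)) ^ a = 1 := by
    rw [← mul_pow, neg_one_pow_mul_self, one_pow]
  have h3 := neg_one_pow_mul_self (R := R) (∑ b ∈ P, rank S₁ S₂ m b)
  generalize (-1 : R) ^ (∑ b ∈ P, rank S₁ S₂ m b) = r at *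
  generalize (-1 : R) ^ (∑ b ∈ beadSet S₁ S₂ \ P, rank S₁ S₂ m b) = r' at *
  generalize ((-1 : R) ^ (bottomCount S₁ S₂ + 1)) ^ a = g at *
  generalize coloredZ S₁ S₂ L m (q 1) x P = Z at *
  generalize coloredZ S₁ S₂ L m (q 1) x (beadSet S₁ S₂ \ P) = Z' at *
  generalize q (∑ b ∈ P, flipExponent S₁ S₂ b) = u at *
  generalize q (-∑ b ∈ P, flipExponent S₁ S₂ b) = v at *
  generalize q (-∑ b ∈ beadSet S₁ S₂ \ P, flipExponent S₁ S₂ b) = w at *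
  generalize q ((a - 1) * d - (a.choose 2 : ℕ)) = y at *
  -- Inserting factors equal to `1` makes the left side of `hH` appear; afterwards `hs` removes all
  -- signs at once.
  calc Z = (g * g) * (r * r) * (u * v) * Z := by rw [h2, h3, hinv]; ring
    _ = g * r * u * (g * r * v * Z) := by ring
    _ = (g * g * (r' * r) * (-1) ^ a) * (u * w * y * Z') := by rw [hH]; ring
    _ = u * w * y * Z' := by rw [hs, one_mul]

end Bead

/-! ### The theorem -/

open Bead in
theorem mainTheorem1 (n : ℕ) (S₁ S₂ : SkewPartition) (M : Finset (Sym2 Bead))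
    (hM : Bead.IsMatching S₁ S₂ M ∧ Bead.IsNonCrossing M)
    (hunique : ∀ M' : Finset (Sym2 Bead),
      Bead.IsMatching S₁ S₂ M' ∧ Bead.IsNonCrossing M' → M' = M) :
    LLTEquivalent (coinvLLT ![S₁, S₂] n) (coinvLLT ![S₂, S₁] n) ∧
    (∀ a ∈ M, Even (Bead.twiceArcExponent S₁ S₂ a)) ∧
    coinvLLT ![S₁, S₂] n =
      MvPolynomial.C (∏ a ∈ M, Bead.arcWeight S₁ S₂ a) * coinvLLT ![S₂, S₁] n := by
  obtain ⟨L, m, hw⟩ := exists_isWindow S₁ S₂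
  have hNC := (hw.isNCMatching_iff M).2 hM
  obtain ⟨π, hπ, hu⟩ := hNC.exists_partner
  have hPs : minusSet S₁ S₂ ⊆ beadSet S₁ S₂ := minusSet_subset
  have hbij := bijOn_partner hPs hπ
  have heven : ∀ p ∈ minusSet S₁ S₂, Even (twiceArcExponent S₁ S₂ s(p, π p)) := fun p hp =>
    hw.even_twiceArcExponent hNC hp (hπ p (hPs hp)).1
  have hsum : ∀ f : Bead → ℤ, ∑ p ∈ minusSet S₁ S₂, f (π p) =
      ∑ c ∈ beadSet S₁ S₂ \ minusSet S₁ S₂, f c := fun f =>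
    Finset.sum_bij (fun p _ => π p) (fun p hp => Finset.mem_coe.1 (hbij.1 hp))
      (fun p hp p' hp' h => hbij.2.1 hp hp' h)
      (fun c hc => by
        obtain ⟨p, hp, h⟩ := hbij.2.2 (Finset.mem_coe.2 hc)
        exact ⟨p, hp, h⟩)
      fun _ _ => rfl
  obtain ⟨a, ha⟩ : ∃ a, (minusSet S₁ S₂).card = a := ⟨_, rfl⟩
  have hac : (beadSet S₁ S₂ \ minusSet S₁ S₂).card = a := by
    have h := hsum fun _ => 1
    simp only [Finset.sum_const, nsmul_eq_mul, mul_one, Nat.cast_inj] at h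
    rw [← h, ha]
  have halt : ¬ HasAlternation (pos m) (beadSet S₁ S₂) (minusSet S₁ S₂) := by
    refine not_hasAlternation_of_unique _ _ _ hw.pos_injOn ?_ fun M₁ M₂ h₁ h₂ => ?_
    · rw [Finset.filter_mem_eq_inter, Finset.inter_eq_right.2 hPs, Finset.filter_notMem_eq_sdiff,
        ha, hac]
    · rw [hunique M₁ ((hw.isNCMatching_iff M₁).1 h₁), hunique M₂ ((hw.isNCMatching_iff M₂).1 h₂)]
  -- Integral powers of `t` as a homomorphism; `q 1` is `t`.
  obtain ⟨q, hqdef⟩ : ∃ q : ℤ → MvPolynomial (Fin n) (LaurentPolynomial ℤ),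
      q = fun e => MvPolynomial.C (LaurentPolynomial.T e) := ⟨_, rfl⟩
  have hq : ∀ a b, q (a + b) = q a * q b := fun a b => by
    simp only [hqdef, LaurentPolynomial.T_add, map_mul]
  have hq0 : q 0 = 1 := by simp only [hqdef, LaurentPolynomial.T_zero, map_one]
  have hne : ∀ k : ℕ, ∑ j ∈ Finset.range (k + 1), q j ≠ 0 := fun k => by
    simpa only [hqdef] using mvPolynomial_sum_T_ne_zero n k
  obtain ⟨d, hZ, hd, hrank⟩ := hw.coloredZ_eq hq hq0 hne hPs ha hac halt MvPolynomial.X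
  replace hd := hd π hbij
  obtain ⟨E, hE⟩ : ∃ E : ℤ, E = ∑ b ∈ minusSet S₁ S₂, flipExponent S₁ S₂ b -
      ∑ b ∈ beadSet S₁ S₂ \ minusSet S₁ S₂, flipExponent S₁ S₂ b +
      ((a - 1) * d - (a.choose 2 : ℕ)) := ⟨_, rfl⟩
  have hchoose : 2 * ((a.choose 2 : ℕ) : ℤ) = a * a - a := by
    have h : 2 * a.choose 2 + a = a * a := by
      rw [mul_comm 2, Nat.choose_two_right, Nat.div_two_mul_two_of_even (Nat.even_mul_pred_self a)]
      cases a with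
      | zero => rfl
      | succ b => rw [Nat.add_sub_cancel]; ring
    have h' : (2 * a.choose 2 + a : ℤ) = a * a := by exact_mod_cast h
    linarith
  -- The `d` arcs pointing forward from `minusSet` contribute `-1` each, the other `a - d`
  -- contribute `1`.
  have hsign : ∑ p ∈ minusSet S₁ S₂, (if pos m p < pos m (π p) then (-1 : ℤ) else 1) =
      a - 2 * d := by
    have h : ∀ p, (if pos m p < pos m (π p) then (-1 : ℤ) else 1) =
        1 - 2 * if pos m p < pos m (π p) then 1 else 0 := fun p => by split_ifs <;> rfl
    rw [Finset.sum_congr rfl fun p _ => h p, Finset.sum_sub_distrib, ← Finset.mul_sum,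
      Finset.sum_boole, hd, Finset.sum_const, ha]
    simp
  have hexp : ∑ e ∈ M, twiceArcExponent S₁ S₂ e / 2 = E := by
    -- The rank sums give `-(a * a - 2 * a * d)` and the signs give `a - 2 * d`; together this is `2
    -- * ((a - 1) * d - a.choose 2)`, and the terms with `bottomCount` cancel.
    have h2 : 2 * ∑ e ∈ M, twiceArcExponent S₁ S₂ e / 2 = 2 * E := by
      have hlab : ∀ Q ⊆ beadSet S₁ S₂, ∑ b ∈ Q, (label S₁ S₂ b + if b.row = .bottom then 1 else 0) =
          2 * ∑ b ∈ Q, flipExponent S₁ S₂ b - ∑ b ∈ Q, (rank S₁ S₂ m b : ℤ) +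
            Q.card * bottomCount S₁ S₂ := fun Q hQ => by
        rw [Finset.sum_congr rfl fun b hb => hw.label_add_eq (hQ hb), Finset.sum_add_distrib,
          Finset.sum_sub_distrib, ← Finset.mul_sum, Finset.sum_const, nsmul_eq_mul]
      rw [hNC.sum_eq hPs hπ hu, Finset.mul_sum,
        Finset.sum_congr rfl fun p hp => Int.two_mul_ediv_two_of_even (heven p hp),
        Finset.sum_congr rfl fun p hp => hw.twiceArcExponent_eq hp (hπ p (hPs hp)).2.1
          ((hπ p (hPs hp)).2.2.1.1 hp), Finset.sum_add_distrib, Finset.sum_sub_distrib,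
        hsum fun c => label S₁ S₂ c + if c.row = .bottom then 1 else 0,
        hlab _ hPs, hlab _ Finset.sdiff_subset, ha, hac, hsign, hE]
      linarith
    linarith
  have hweight : MvPolynomial.C (∏ e ∈ M, arcWeight S₁ S₂ e) = q E := by
    have h : ∏ e ∈ M, arcWeight S₁ S₂ e =
        LaurentPolynomial.T (∑ e ∈ M, twiceArcExponent S₁ S₂ e / 2) :=
      (Finset.prod_hom_rel (s := M)
        (f := fun e => Multiplicative.ofAdd (twiceArcExponent S₁ S₂ e / 2))
        (g := fun e => arcWeight S₁ S₂ e)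
        (r := fun x y => y = LaurentPolynomial.T (Multiplicative.toAdd x)) (by simp)
        (fun b x y h => by rw [h]; exact (LaurentPolynomial.T_add _ _).symm))
    rw [h, hexp, hqdef]
  have hmain : coinvLLT ![S₁, S₂] n = q E * coinvLLT ![S₂, S₁] n := by
    have hq1 : (MvPolynomial.C (LaurentPolynomial.T 1) :
        MvPolynomial (Fin n) (LaurentPolynomial ℤ)) = q 1 := by rw [hqdef]
    rw [hw.coinvLLT_eq, hw.coinvLLT_swap_eq, hq1, hE]
    exact hZ
  refine ⟨⟨E, by rw [hmain, hqdef]⟩, fun e he => ?_, by rw [hweight, hmain]⟩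
  induction e using Sym2.ind with
  | _ b c =>
  by_cases hb : b ∈ minusSet S₁ S₂
  · exact hw.even_twiceArcExponent hNC hb he
  · rw [Sym2.eq_swap] at he ⊢
    exact hw.even_twiceArcExponent hNC ((hNC.opposite c b he).2 hb) he
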